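/- **Setting.** Fix function symbols, built-in constraint symbols and user-defined constraint symbols (with arities) and a countably infinite set of variables. *Atomic built-in constraints* are $\bot$, $t\doteq u$ and $c_b(\bar t)$; *atomic user-defined constraints* are $c_u(\bar t)$. *Built-in constraints* $\mathbb B$ and *user-defined constraints* $\mathbb U$ are possibly empty conjunctions ($\top$ if empty) of the respective atoms; *goals* $\mathbb G$ are built from $\top$ and atoms of both kinds by $\wedge$ and $\vee$. A *state* is a pair $\langle\mathbb G;\mathbb V\rangle$ with a finite set $\mathbb V$ of (global) variables. A *configuration* $\bar S$ is a finite, possibly empty disjunction of states; $\varepsilon$ is the empty one. A *rule* is $H_1\backslash H_2\Leftrightarrow G\mid B$ with $H_1,H_2$ user-defined constraints, $G$ a built-in constraint and $B$ a goal; its *local variables* are $\bar y_r=vars(B,G)\setminus vars(H_1,H_2)$. A variant of a rule arises by replacing its variables by pairwise distinct variables. A *program* $\mathbb P$ is a set of rules. A *constraint theory* $CT$ is a set of formulas $\forall(\exists\bar x.\mathbb B\to\exists\bar x'.\mathbb B')$; $CT\models\varphi$ means that $\varphi$ (its free variables read universally) is derivable from $CT$ in intuitionistic first-order logic. Assume that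 * $\doteq$ is an equality in $CT$: $CT\models t\doteq t$ and $CT\models t\doteq u\wedge b[x/t]\to b[x/u]$ for all terms $t,u$, variables $x$ and atomic built-in constraints $b$ (here and below $[x/t]$ replaces $x$ by $t$); * $CT$ is complete: for every built-in constraint $\mathbb B$, $CT\models\exists\mathbb B$ or $CT\models\neg\exists\mathbb B$ (existential closures). **Operational side.** $\equiv_G$ is the congruence on goals generated by associativity and commutativity of $\wedge$, neutrality of $\top$ for $\wedge$, and distributivity $\mathbb G\wedge(\mathbb G_1\vee\mathbb G_2)\equiv_G(\mathbb G\wedge\mathbb G_1)\vee(\mathbb G\wedge\mathbb G_2)$. The *strictly local* variables of $\langle\mathbb U\wedge\mathbb B;\mathbb V\rangle$ are those in $vars(\mathbb B)\setminus(\mathbb V\cup vars(\mathbb U))$. State equivalence $\equiv$ is the smallest equivalence relation with: $\langle\mathbb G;\mathbb V\rangle\equiv\langle\mathbb G';\mathbb V\rangle$ if $\mathbb G\equiv_G\mathbb G'$; $\langle\mathbb U\wedge x\doteq t\wedge\mathbb B;\mathbb V\rangle\equiv\langle\mathbb U[x/t]\wedge x\doteq t\wedge\mathbb B;\mathbb V\rangle$;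 $\langle\mathbb U\wedge\mathbb B;\mathbb V\rangle\equiv\langle\mathbb U\wedge\mathbb B';\mathbb V\rangle$ if $CT\models\exists\bar s.\mathbb B\leftrightarrow\exists\bar s'.\mathbb B'$ for the respective strictly local variables $\bar s,\bar s'$; $\langle\mathbb G;\{x\}\cup\mathbb V\rangle\equiv\langle\mathbb G;\mathbb V\rangle$ if $x\notin vars(\mathbb G)$; and $\langle\mathbb G\wedge\bot;\mathbb V\rangle\equiv\langle\mathbb G'\wedge\bot;\mathbb V'\rangle$. Put $S_\bot=\langle\bot;\emptyset\rangle$. *State entailment* is the smallest reflexive and transitive relation on $\equiv$-classes for which $\langle\mathbb U\wedge\mathbb B;\mathbb V\rangle$ entails $\langle\mathbb U\wedge\mathbb B';\mathbb V\rangle$ whenever $CT\models\exists\bar s.\mathbb B\to\exists\bar s'.\mathbb B'$ (with $\bar s,\bar s'$ as before), and $\langle\mathbb U\wedge\mathbb B;\{x\}\cup\mathbb V\rangle$ entails $\langle\mathbb U\wedge\mathbb B;\mathbb V\rangle$. Configuration equivalence is the smallest equivalence relation, compatible with $\vee$, under which $\vee$ is associative and commutative, $S\vee\bar T$ is equivalent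 to $S'\vee\bar T$ if $S\equiv S'$, $S_\bot\vee\bar T$ to $\bar T$, $\varepsilon$ to $S_\bot$, and $\langle\mathbb G_1\vee\mathbb G_2;\mathbb V\rangle\vee\bar T$ to $\langle\mathbb G_1;\mathbb V\rangle\vee\langle\mathbb G_2;\mathbb V\rangle\vee\bar T$; $[\cdot]$ denotes its classes. For every variant $H_1\backslash H_2\Leftrightarrow G\mid B$ of a rule of $\mathbb P$ whose local variables do not occur in $H_1,H_2,\mathbb G,\mathbb V$, and with $CT\models\exists(G\wedge\mathbb B)$, where $\mathbb B$ is the conjunction of the atomic built-in constraints of $\mathbb G$ outside disjunctions, there is a transition $$[\langle H_1\wedge H_2\wedge G\wedge\mathbb G;\mathbb V\rangle\vee\bar T]\mapsto[\langle H_1\wedge G\wedge B\wedge\mathbb G;\mathbb V\rangle\vee\bar T];$$ $\mapsto^*$ is the reflexive-transitive closure, and $\bar S\mapsto^*\bar U$ means $[\bar S]\mapsto^*[\bar U]$. *Entailment of configurations* is the smallest reflexive and transitive relation on classes such that $[\bar T]$ entails $[S\vee\bar T]$ and, whenever the state $S_1$ entails the state $S_2$, $[S_1\vee S_2\vee\bar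 T]$ entails $[S_2\vee\bar T]$. **Logical side.** $\vdash$ is derivability in the sequent calculus of first-order intuitionistic linear logic ($\otimes,\mathbf 1,\multimap,\&,\top,\oplus,\mathbf 0,!,\forall,\exists$, with cut). Put $c_u(\bar t)^L=c_u(\bar t)$, $c_b(\bar t)^L={!c_b(\bar t)}$, $(t\doteq u)^L={!(t\doteq u)}$, $\bot^L=\mathbf 0$, $\top^L=\mathbf 1$, $(\mathbb G_1\wedge\mathbb G_2)^L=\mathbb G_1^L\otimes\mathbb G_2^L$, $(\mathbb G_1\vee\mathbb G_2)^L=\mathbb G_1^L\oplus\mathbb G_2^L$, $\langle\mathbb G;\mathbb V\rangle^L=\exists_{-\mathbb V}.\mathbb G^L$ (quantifying all variables of $\mathbb G$ outside $\mathbb V$), $(\bar S\vee\bar T)^L=\bar S^L\oplus\bar T^L$, $\varepsilon^L=\mathbf 0$. Put $\mathbb P^L=\{\,!\forall(H_1^L\otimes H_2^L\otimes G^L\multimap H_1^L\otimes\exists\bar y_r.(B^L\otimes G^L))\;:\;(H_1\backslash H_2\Leftrightarrow G\mid B)\in\mathbb P\}$. Let $CT^L$ consist of the translations $\alpha^*$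 of the axioms $\alpha\in CT$, where $p(\bar t)^*={!p(\bar t)}$ for atoms (including $\doteq$), $\bot^*=\mathbf 0$, $\top^*=\mathbf 1$, $(\varphi\wedge\psi)^*=\varphi^*\otimes\psi^*$, $(\varphi\to\psi)^*={!(\varphi^*\multimap\psi^*)}$, $(\forall x.\varphi)^*={!\forall x.\varphi^*}$, $(\exists x.\varphi)^*=\exists x.\varphi^*$, together with, for every user-defined symbol $c_u$ of arity $n$ and $1\le j\le n$, the formula $!\forall(c_u(x_1,\dots,x_j,\dots,x_n)\otimes{!(x_j\doteq y)}\multimap c_u(x_1,\dots,y,\dots,x_n)\otimes{!(x_j\doteq y)})$, where $x_1,\dots,x_n,y$ are distinct variables. Provability from the (possibly infinite) set $\mathbb P^L\cup CT^L$ means provability from a finite multiset of its members. **Theorem.** Let $\mathbb P$ be a CHR$^\vee$ program, $CT$ a constraint theory as above and $\bar S,\bar T$ configurations. There is a configuration $\bar U$ such that $\bar S\mapsto^*\bar U$ and $\bar U$ entails $\bar T$ if and only if $$\mathbb P^L,\,CT^L\;\vdash\;\forall(\bar S^L\multimap\bar T^L).$$ -/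

import Mathlib

universe u v w

namespace CHR

/-! ### Constraints, goals, rules, states and configurations

Variables are natural numbers and terms are `L.Term ℕ`, where `L` supplies the function symbols
and, as its relation symbols, the built-in constraint symbols other than `⊥` and `≐`.  The family
`K` supplies the user-defined constraint symbols, `K n` being those of arity `n`. -/

/-- Atomic built-in constraints: falsity, syntactic equality `t ≐ u`, and the others. -/
inductive BuiltInAtom (L : FirstOrder.Language.{u, v}) : Type (max u v)
  | bot : BuiltInAtom L
  | eq (t s : L.Term ℕ) : BuiltInAtom L
  | rel {n : ℕ} (R : L.Relations n) (ts : Fin n → L.Term ℕ) : BuiltInAtom L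

/-- Atomic user-defined constraints. -/
inductive UserAtom (L : FirstOrder.Language.{u, v}) (K : ℕ → Type w) : Type (max u w)
  | mk {n : ℕ} (c : K n) (ts : Fin n → L.Term ℕ) : UserAtom L K

/-- Possibly empty conjunctions of elements of `A`. -/
inductive Conj (A : Type u) : Type u
  | top : Conj A
  | atom (a : A) : Conj A
  | and (C D : Conj A) : Conj A

/-- The conjunction with `f` applied to each of its atoms. -/
def Conj.map {A : Type u} {A' : Type v} (f : A → A') : Conj A → Conj A'
  | .top => .top
  | .atom a => .atom (f a)
  | .and C D => .and (C.map f) (D.map f)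

/-- Built-in constraints `𝔹`. -/
abbrev BuiltIn (L : FirstOrder.Language.{u, v}) : Type (max u v) := Conj (BuiltInAtom L)

/-- User-defined constraints `𝕌`. -/
abbrev User (L : FirstOrder.Language.{u, v}) (K : ℕ → Type w) : Type (max u w) :=
  Conj (UserAtom L K)

/-- Goals of CHR with disjunction. -/
inductive Goal (L : FirstOrder.Language.{u, v}) (K : ℕ → Type w) : Type (max u v w)
  | top : Goal L K
  | user (a : UserAtom L K) : Goal L K
  | builtIn (b : BuiltInAtom L) : Goal L K
  | and (G H : Goal L K) : Goal L K
  | or (G H : Goal L K) : Goal L K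

section Basic

variable {L : FirstOrder.Language.{u, v}} {K : ℕ → Type w}

/-- The substitution that replaces `x` by `t` and fixes every other variable. -/
def single (x : ℕ) (t : L.Term ℕ) : ℕ → L.Term ℕ :=
  Function.update FirstOrder.Language.Term.var x t

/-- The substitution that renames every variable `x` to `ρ x`. -/
def renameSubst (ρ : ℕ → ℕ) : ℕ → L.Term ℕ := fun x => .var (ρ x)

def BuiltInAtom.subst (σ : ℕ → L.Term ℕ) : BuiltInAtom L → BuiltInAtom L
  | .bot => .bot
  | .eq t s => .eq (t.subst σ) (s.subst σ)
  | .rel R ts => .rel R fun i => (ts i).subst σ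

def BuiltInAtom.vars : BuiltInAtom L → Finset ℕ
  | .bot => ∅
  | .eq t s => t.varFinset ∪ s.varFinset
  | .rel _ ts => Finset.univ.biUnion fun i => (ts i).varFinset

def UserAtom.subst (σ : ℕ → L.Term ℕ) : UserAtom L K → UserAtom L K
  | .mk c ts => .mk c fun i => (ts i).subst σ

def UserAtom.vars : UserAtom L K → Finset ℕ
  | .mk _ ts => Finset.univ.biUnion fun i => (ts i).varFinset

def BuiltIn.subst (σ : ℕ → L.Term ℕ) (B : BuiltIn L) : BuiltIn L :=
  Conj.map (BuiltInAtom.subst σ) B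

def User.subst (σ : ℕ → L.Term ℕ) (U : User L K) : User L K :=
  Conj.map (UserAtom.subst σ) U

def BuiltIn.vars : BuiltIn L → Finset ℕ
  | .top => ∅
  | .atom b => b.vars
  | .and B C => BuiltIn.vars B ∪ BuiltIn.vars C

def User.vars : User L K → Finset ℕ
  | .top => ∅
  | .atom a => a.vars
  | .and U U' => User.vars U ∪ User.vars U'

def Goal.subst (σ : ℕ → L.Term ℕ) : Goal L K → Goal L K
  | .top => .top
  | .user a => .user (a.subst σ)
  | .builtIn b => .builtIn (b.subst σ)
  | .and G H => .and (G.subst σ) (H.subst σ)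
  | .or G H => .or (G.subst σ) (H.subst σ)

def Goal.vars : Goal L K → Finset ℕ
  | .top => ∅
  | .user a => a.vars
  | .builtIn b => b.vars
  | .and G H => G.vars ∪ H.vars
  | .or G H => G.vars ∪ H.vars

/-- A built-in constraint, seen as a goal. -/
def BuiltIn.toGoal (K : ℕ → Type w) : BuiltIn L → Goal L K
  | .top => .top
  | .atom b => .builtIn b
  | .and B C => .and (BuiltIn.toGoal K B) (BuiltIn.toGoal K C)

/-- A user-defined constraint, seen as a goal. -/
def User.toGoal : User L K → Goal L K
  | .top => .top
  | .atom a => .user a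
  | .and U U' => .and (User.toGoal U) (User.toGoal U')

/-- The built-in store of a goal: the conjunction of its atomic built-in constraints that are not
in the scope of a disjunction.  For a goal `𝕌 ∧ 𝔹` without disjunctions this is `𝔹`. -/
def Goal.store : Goal L K → BuiltIn L
  | .top => .top
  | .user _ => .top
  | .builtIn b => .atom b
  | .and G H => .and G.store H.store
  | .or _ _ => .top

end Basic

/-- A rule `H₁ \ H₂ ⇔ G | B`. -/
structure Rule (L : FirstOrder.Language.{u, v}) (K : ℕ → Type w) : Type (max u v w) where
  kept : User L K
  removed : User L K
  guard : BuiltIn L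
  body : Goal L K

/-- A state `⟨𝔾; 𝕍⟩`. -/
structure State (L : FirstOrder.Language.{u, v}) (K : ℕ → Type w) : Type (max u v w) where
  goal : Goal L K
  globals : Finset ℕ

/-- Configurations: finite, possibly empty, disjunctions of states. -/
inductive Config (L : FirstOrder.Language.{u, v}) (K : ℕ → Type w) : Type (max u v w)
  | empty : Config L K
  | state (S : State L K) : Config L K
  | or (C D : Config L K) : Config L K

section RulesStates

variable {L : FirstOrder.Language.{u, v}} {K : ℕ → Type w}

def Rule.vars (r : Rule L K) : Finset ℕ :=
  User.vars r.kept ∪ User.vars r.removed ∪ BuiltIn.vars r.guard ∪ r.body.vars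

/-- The local variables of a rule. -/
def Rule.localVars (r : Rule L K) : Finset ℕ :=
  (r.body.vars ∪ BuiltIn.vars r.guard) \ (User.vars r.kept ∪ User.vars r.removed)

def Rule.rename (ρ : ℕ → ℕ) (r : Rule L K) : Rule L K where
  kept := User.subst (renameSubst ρ) r.kept
  removed := User.subst (renameSubst ρ) r.removed
  guard := BuiltIn.subst (renameSubst ρ) r.guard
  body := r.body.subst (renameSubst ρ)

/-- `r'` is `r` with its variables replaced by pairwise distinct variables. -/
def Rule.IsVariant (r' r : Rule L K) : Prop :=
  ∃ ρ : ℕ → ℕ, Set.InjOn ρ (r.vars : Set ℕ) ∧ r' = r.rename ρ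

/-- The strictly local variables of `⟨𝕌 ∧ 𝔹; 𝕍⟩`. -/
def strictlyLocal (U : User L K) (B : BuiltIn L) (V : Finset ℕ) : Finset ℕ :=
  ((User.vars U ∪ BuiltIn.vars B) \ V) \ User.vars U

/-- The state `⟨𝕌 ∧ 𝔹; 𝕍⟩`, also written `⟨𝕌; 𝔹; 𝕍⟩`. -/
def State.ofStores (U : User L K) (B : BuiltIn L) (V : Finset ℕ) : State L K :=
  ⟨.and (User.toGoal U) (BuiltIn.toGoal K B), V⟩

/-- The failed state `⟨⊥; ∅⟩`. -/
def State.failed : State L K := ⟨.builtIn .bot, ∅⟩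

end RulesStates

/-! ### Intuitionistic logic over the built-in constraints

Quantified formulas use de Bruijn indices: directly below a quantifier, `0` is the bound variable
and `x + 1` is the variable that is called `x` outside. -/

/-- The substitution `σ`, moved below a quantifier. -/
def up {L : FirstOrder.Language.{u, v}} (σ : ℕ → L.Term ℕ) : ℕ → L.Term ℕ
  | 0 => .var 0
  | x + 1 => (σ x).relabel Nat.succ

/-- Instantiates index `0` by `t` and lowers all the other indices by one. -/
def instSubst {L : FirstOrder.Language.{u, v}} (t : L.Term ℕ) : ℕ → L.Term ℕ
  | 0 => t
  | x + 1 => .var x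

/-- Turns the variable `x` into index `0` and raises all the other variables by one. -/
def bindSubst {L : FirstOrder.Language.{u, v}} (x : ℕ) : ℕ → L.Term ℕ :=
  fun y => if y = x then .var 0 else .var (y + 1)

/-- First-order formulas over the built-in constraints. -/
inductive Formula (L : FirstOrder.Language.{u, v}) : Type (max u v)
  | top : Formula L
  | bot : Formula L
  | eq (t s : L.Term ℕ) : Formula L
  | rel {n : ℕ} (R : L.Relations n) (ts : Fin n → L.Term ℕ) : Formula L
  | and (φ ψ : Formula L) : Formula L
  | or (φ ψ : Formula L) : Formula L
  | imp (φ ψ : Formula L) : Formula L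
  | all (φ : Formula L) : Formula L
  | ex (φ : Formula L) : Formula L

namespace Formula

variable {L : FirstOrder.Language.{u, v}}

def subst : (ℕ → L.Term ℕ) → Formula L → Formula L
  | _, .top => .top
  | _, .bot => .bot
  | σ, .eq t s => .eq (t.subst σ) (s.subst σ)
  | σ, .rel R ts => .rel R fun i => (ts i).subst σ
  | σ, .and φ ψ => .and (subst σ φ) (subst σ ψ)
  | σ, .or φ ψ => .or (subst σ φ) (subst σ ψ)
  | σ, .imp φ ψ => .imp (subst σ φ) (subst σ ψ)
  | σ, .all φ => .all (subst (up σ) φ)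
  | σ, .ex φ => .ex (subst (up σ) φ)

/-- Free variables. -/
def fv : Formula L → Finset ℕ
  | .top => ∅
  | .bot => ∅
  | .eq t s => t.varFinset ∪ s.varFinset
  | .rel _ ts => Finset.univ.biUnion fun i => (ts i).varFinset
  | .and φ ψ => φ.fv ∪ ψ.fv
  | .or φ ψ => φ.fv ∪ ψ.fv
  | .imp φ ψ => φ.fv ∪ ψ.fv
  | .all φ => (φ.fv.erase 0).image Nat.pred
  | .ex φ => (φ.fv.erase 0).image Nat.pred

/-- The formula with all its free variables raised by one, as it reads below a quantifier. -/
def shift (φ : Formula L) : Formula L := φ.subst (renameSubst Nat.succ)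

def inst (φ : Formula L) (t : L.Term ℕ) : Formula L := φ.subst (instSubst t)

/-- `∃ x̄. φ` for a finite set `x̄` of variables. -/
def exVars (X : Finset ℕ) (φ : Formula L) : Formula L :=
  (X.sort (· ≤ ·)).foldr (fun x ψ => .ex (ψ.subst (bindSubst x))) φ

/-- `∀ x̄. φ` for a finite set `x̄` of variables. -/
def allVars (X : Finset ℕ) (φ : Formula L) : Formula L :=
  (X.sort (· ≤ ·)).foldr (fun x ψ => .all (ψ.subst (bindSubst x))) φ

/-- The universal closure `∀ φ`. -/
def univClosure (φ : Formula L) : Formula L := allVars φ.fv φ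

/-- The existential closure `∃ φ`. -/
def exClosure (φ : Formula L) : Formula L := exVars φ.fv φ

/-- Natural deduction for intuitionistic first-order logic. -/
inductive Provable : Set (Formula L) → Formula L → Prop
  | hyp {Γ : Set (Formula L)} {φ : Formula L} : φ ∈ Γ → Provable Γ φ
  | topI {Γ : Set (Formula L)} : Provable Γ .top
  | botE {Γ : Set (Formula L)} {φ : Formula L} : Provable Γ .bot → Provable Γ φ
  | andI {Γ : Set (Formula L)} {φ ψ : Formula L} :
      Provable Γ φ → Provable Γ ψ → Provable Γ (.and φ ψ)
  | andE₁ {Γ : Set (Formula L)} {φ ψ : Formula L} : Provable Γ (.and φ ψ) → Provable Γ φ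
  | andE₂ {Γ : Set (Formula L)} {φ ψ : Formula L} : Provable Γ (.and φ ψ) → Provable Γ ψ
  | orI₁ {Γ : Set (Formula L)} {φ ψ : Formula L} : Provable Γ φ → Provable Γ (.or φ ψ)
  | orI₂ {Γ : Set (Formula L)} {φ ψ : Formula L} : Provable Γ ψ → Provable Γ (.or φ ψ)
  | orE {Γ : Set (Formula L)} {φ ψ χ : Formula L} :
      Provable Γ (.or φ ψ) → Provable (insert φ Γ) χ → Provable (insert ψ Γ) χ → Provable Γ χ
  | impI {Γ : Set (Formula L)} {φ ψ : Formula L} :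
      Provable (insert φ Γ) ψ → Provable Γ (.imp φ ψ)
  | impE {Γ : Set (Formula L)} {φ ψ : Formula L} :
      Provable Γ (.imp φ ψ) → Provable Γ φ → Provable Γ ψ
  | allI {Γ : Set (Formula L)} {φ : Formula L} :
      Provable (shift '' Γ) φ → Provable Γ (.all φ)
  | allE {Γ : Set (Formula L)} {φ : Formula L} (t : L.Term ℕ) :
      Provable Γ (.all φ) → Provable Γ (φ.inst t)
  | exI {Γ : Set (Formula L)} {φ : Formula L} (t : L.Term ℕ) :
      Provable Γ (φ.inst t) → Provable Γ (.ex φ)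
  | exE {Γ : Set (Formula L)} {φ ψ : Formula L} :
      Provable Γ (.ex φ) → Provable (insert φ (shift '' Γ)) ψ.shift → Provable Γ ψ

end Formula

section Theories

variable {L : FirstOrder.Language.{u, v}}

def BuiltInAtom.toFormula : BuiltInAtom L → Formula L
  | .bot => .bot
  | .eq t s => .eq t s
  | .rel R ts => .rel R ts

def BuiltIn.toFormula : BuiltIn L → Formula L
  | .top => .top
  | .atom b => b.toFormula
  | .and B C => .and (BuiltIn.toFormula B) (BuiltIn.toFormula C)

/-- The formula `∃ x̄. 𝔹`. -/
def BuiltIn.exFormula (X : Finset ℕ) (B : BuiltIn L) : Formula L :=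
  Formula.exVars X (BuiltIn.toFormula B)

end Theories

/-- The data of a `CT`-axiom `∀(∃ x̄. 𝔹 → ∃ x̄'. 𝔹')`. -/
structure CTAxiom (L : FirstOrder.Language.{u, v}) : Type (max u v) where
  lhsVars : Finset ℕ
  lhs : BuiltIn L
  rhsVars : Finset ℕ
  rhs : BuiltIn L

section Theories

variable {L : FirstOrder.Language.{u, v}}

def CTAxiom.toFormula (α : CTAxiom L) : Formula L :=
  Formula.univClosure (.imp (BuiltIn.exFormula α.lhsVars α.lhs)
    (BuiltIn.exFormula α.rhsVars α.rhs))

/-- `CT ⊨ φ`: the formula `φ` follows from the axioms `CT` in intuitionistic logic.  As the axioms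
are closed, the free variables of `φ` are read as universally quantified. -/
def Models (CT : Set (CTAxiom L)) (φ : Formula L) : Prop :=
  Formula.Provable (CTAxiom.toFormula '' CT) φ

/-- In the theory `CT`, the constraint `≐` is an equality: it is reflexive, and equals may be
substituted for equals in atomic built-in constraints. -/
def HasEquality (CT : Set (CTAxiom L)) : Prop :=
  (∀ t : L.Term ℕ, Models CT (.eq t t)) ∧
    ∀ (b : BuiltInAtom L) (x : ℕ) (t s : L.Term ℕ),
      Models CT (.imp (.and (.eq t s) (b.subst (single x t)).toFormula)
        (b.subst (single x s)).toFormula)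

/-- The theory `CT` is complete for the satisfiability of built-in constraints: it proves `∃ 𝔹` or
`¬ ∃ 𝔹`, for every built-in constraint `𝔹`. -/
def IsComplete (CT : Set (CTAxiom L)) : Prop :=
  ∀ B : BuiltIn L, Models CT (BuiltIn.toFormula B).exClosure ∨
    Models CT (.imp (BuiltIn.toFormula B).exClosure .bot)

end Theories

/-! ### Operational semantics -/

section Operational

variable {L : FirstOrder.Language.{u, v}} {K : ℕ → Type w}

/-- Goal equivalence: associativity and commutativity of `∧`, neutrality of `⊤` with respect to
`∧`, and distributivity of `∧` over `∨`. -/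
inductive GoalEquiv : Goal L K → Goal L K → Prop
  | refl (G : Goal L K) : GoalEquiv G G
  | symm {G H : Goal L K} : GoalEquiv G H → GoalEquiv H G
  | trans {G H I : Goal L K} : GoalEquiv G H → GoalEquiv H I → GoalEquiv G I
  | andCongr {G G' H H' : Goal L K} :
      GoalEquiv G G' → GoalEquiv H H' → GoalEquiv (.and G H) (.and G' H')
  | orCongr {G G' H H' : Goal L K} :
      GoalEquiv G G' → GoalEquiv H H' → GoalEquiv (.or G H) (.or G' H')
  | andAssoc (G H I : Goal L K) : GoalEquiv (.and (.and G H) I) (.and G (.and H I))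
  | andComm (G H : Goal L K) : GoalEquiv (.and G H) (.and H G)
  | topAnd (G : Goal L K) : GoalEquiv (.and .top G) G
  | distrib (G H I : Goal L K) :
      GoalEquiv (.and G (.or H I)) (.or (.and G H) (.and G I))

/-- Equivalence of states. -/
inductive StateEquiv (CT : Set (CTAxiom L)) : State L K → State L K → Prop
  | refl (S : State L K) : StateEquiv CT S S
  | symm {S T : State L K} : StateEquiv CT S T → StateEquiv CT T S
  | trans {S T R : State L K} : StateEquiv CT S T → StateEquiv CT T R → StateEquiv CT S R
  | goal {G G' : Goal L K} (V : Finset ℕ) : GoalEquiv G G' → StateEquiv CT ⟨G, V⟩ ⟨G', V⟩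
  | subst (U : User L K) (x : ℕ) (t : L.Term ℕ) (B : BuiltIn L) (V : Finset ℕ) :
      StateEquiv CT (State.ofStores U (.and (.atom (.eq (.var x) t)) B) V)
        (State.ofStores (User.subst (single x t) U) (.and (.atom (.eq (.var x) t)) B) V)
  | theory (U : User L K) (B B' : BuiltIn L) (V : Finset ℕ) :
      Models CT (.imp (BuiltIn.exFormula (strictlyLocal U B V) B)
        (BuiltIn.exFormula (strictlyLocal U B' V) B')) →
      Models CT (.imp (BuiltIn.exFormula (strictlyLocal U B' V) B')
        (BuiltIn.exFormula (strictlyLocal U B V) B)) →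
      StateEquiv CT (State.ofStores U B V) (State.ofStores U B' V)
  | redundantGlobal (G : Goal L K) (x : ℕ) (V : Finset ℕ) :
      x ∉ G.vars → StateEquiv CT ⟨G, insert x V⟩ ⟨G, V⟩
  | failed (G G' : Goal L K) (V V' : Finset ℕ) :
      StateEquiv CT ⟨.and G (.builtIn .bot), V⟩ ⟨.and G' (.builtIn .bot), V'⟩

def stateSetoid (K : ℕ → Type w) (CT : Set (CTAxiom L)) : Setoid (State L K) where
  r := StateEquiv CT
  iseqv := ⟨.refl, .symm, .trans⟩

/-- Equivalence classes of states. -/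
def StateClass (K : ℕ → Type w) (CT : Set (CTAxiom L)) : Type (max u v w) :=
  Quotient (stateSetoid K CT)

/-- The equivalence class of a state. -/
def State.cls (CT : Set (CTAxiom L)) (S : State L K) : StateClass K CT :=
  Quotient.mk (stateSetoid K CT) S

/-- Entailment of states, a relation between equivalence classes. -/
inductive StateEntails (CT : Set (CTAxiom L)) : StateClass K CT → StateClass K CT → Prop
  | refl (s : StateClass K CT) : StateEntails CT s s
  | trans {s t r : StateClass K CT} :
      StateEntails CT s t → StateEntails CT t r → StateEntails CT s r
  | weaken (U : User L K) (B B' : BuiltIn L) (V : Finset ℕ) :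
      Models CT (.imp (BuiltIn.exFormula (strictlyLocal U B V) B)
        (BuiltIn.exFormula (strictlyLocal U B' V) B')) →
      StateEntails CT ((State.ofStores U B V).cls CT) ((State.ofStores U B' V).cls CT)
  | omitGlobal (U : User L K) (B : BuiltIn L) (x : ℕ) (V : Finset ℕ) :
      StateEntails CT ((State.ofStores U B (insert x V)).cls CT)
        ((State.ofStores U B V).cls CT)

/-- Equivalence of configurations. -/
inductive ConfigEquiv (CT : Set (CTAxiom L)) : Config L K → Config L K → Prop
  | refl (C : Config L K) : ConfigEquiv CT C C
  | symm {C D : Config L K} : ConfigEquiv CT C D → ConfigEquiv CT D C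
  | trans {C D E : Config L K} : ConfigEquiv CT C D → ConfigEquiv CT D E → ConfigEquiv CT C E
  | orCongr {C C' : Config L K} (D : Config L K) :
      ConfigEquiv CT C C' → ConfigEquiv CT (.or C D) (.or C' D)
  | orComm (C D : Config L K) : ConfigEquiv CT (.or C D) (.or D C)
  | orAssoc (C D E : Config L K) : ConfigEquiv CT (.or (.or C D) E) (.or C (.or D E))
  | stateEquiv {S S' : State L K} (C : Config L K) :
      StateEquiv CT S S' → ConfigEquiv CT (.or (.state S) C) (.or (.state S') C)
  | failedOr (C : Config L K) : ConfigEquiv CT (.or (.state State.failed) C) C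
  | empty : ConfigEquiv CT .empty (.state State.failed)
  | split (G H : Goal L K) (V : Finset ℕ) (C : Config L K) :
      ConfigEquiv CT (.or (.state ⟨.or G H, V⟩) C)
        (.or (.state ⟨G, V⟩) (.or (.state ⟨H, V⟩) C))

def configSetoid (K : ℕ → Type w) (CT : Set (CTAxiom L)) : Setoid (Config L K) where
  r := ConfigEquiv CT
  iseqv := ⟨.refl, .symm, .trans⟩

/-- Equivalence classes of configurations. -/
def ConfigClass (K : ℕ → Type w) (CT : Set (CTAxiom L)) : Type (max u v w) :=
  Quotient (configSetoid K CT)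

/-- The equivalence class of a configuration. -/
def Config.cls (CT : Set (CTAxiom L)) (C : Config L K) : ConfigClass K CT :=
  Quotient.mk (configSetoid K CT) C

/-- One transition `[⟨H₁ ∧ H₂ ∧ G ∧ 𝔾; 𝕍⟩ ∨ T̄] ↦ [⟨H₁ ∧ G ∧ B ∧ 𝔾; 𝕍⟩ ∨ T̄]` with a variant
`r' = (H₁ \ H₂ ⇔ G | B)` of a rule of the program whose local variables are fresh. -/
inductive Step (CT : Set (CTAxiom L)) (P : Set (Rule L K)) :
    ConfigClass K CT → ConfigClass K CT → Prop
  | apply (r r' : Rule L K) (G : Goal L K) (V : Finset ℕ) (T : Config L K) :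
      r ∈ P → r'.IsVariant r →
      Disjoint r'.localVars (User.vars r'.kept ∪ User.vars r'.removed ∪ G.vars ∪ V) →
      Models CT (BuiltIn.toFormula (.and r'.guard G.store)).exClosure →
      Step CT P
        ((Config.or (.state ⟨.and (User.toGoal r'.kept) (.and (User.toGoal r'.removed)
          (.and (BuiltIn.toGoal K r'.guard) G)), V⟩) T).cls CT)
        ((Config.or (.state ⟨.and (User.toGoal r'.kept) (.and (BuiltIn.toGoal K r'.guard)
          (.and r'.body G)), V⟩) T).cls CT)

/-- The reflexive-transitive closure `↦*`. -/
def Steps (CT : Set (CTAxiom L)) (P : Set (Rule L K)) :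
    ConfigClass K CT → ConfigClass K CT → Prop :=
  Relation.ReflTransGen (Step CT P)

/-- Entailment of configurations, a relation between equivalence classes. -/
inductive ConfigEntails (CT : Set (CTAxiom L)) : ConfigClass K CT → ConfigClass K CT → Prop
  | refl (c : ConfigClass K CT) : ConfigEntails CT c c
  | trans {c d e : ConfigClass K CT} :
      ConfigEntails CT c d → ConfigEntails CT d e → ConfigEntails CT c e
  | weaken (S : State L K) (T : Config L K) :
      ConfigEntails CT (T.cls CT) ((Config.or (.state S) T).cls CT)
  | redundant (S₁ S₂ : State L K) (T : Config L K) :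
      StateEntails CT (S₁.cls CT) (S₂.cls CT) →
      ConfigEntails CT ((Config.or (.state S₁) (.or (.state S₂) T)).cls CT)
        ((Config.or (.state S₂) T).cls CT)

end Operational

/-! ### Intuitionistic linear logic -/

/-- Formulas of first-order intuitionistic linear logic, again with de Bruijn indices. -/
inductive LFormula (L : FirstOrder.Language.{u, v}) (K : ℕ → Type w) : Type (max u v w)
  | user {n : ℕ} (c : K n) (ts : Fin n → L.Term ℕ) : LFormula L K
  | eq (t s : L.Term ℕ) : LFormula L K
  | rel {n : ℕ} (R : L.Relations n) (ts : Fin n → L.Term ℕ) : LFormula L K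
  | one : LFormula L K
  | zero : LFormula L K
  | top : LFormula L K
  | tensor (α β : LFormula L K) : LFormula L K
  | plus (α β : LFormula L K) : LFormula L K
  | with (α β : LFormula L K) : LFormula L K
  | lolli (α β : LFormula L K) : LFormula L K
  | bang (α : LFormula L K) : LFormula L K
  | all (α : LFormula L K) : LFormula L K
  | ex (α : LFormula L K) : LFormula L K

namespace LFormula

variable {L : FirstOrder.Language.{u, v}} {K : ℕ → Type w}

def subst : (ℕ → L.Term ℕ) → LFormula L K → LFormula L K
  | σ, .user c ts => .user c fun i => (ts i).subst σ
  | σ, .eq t s => .eq (t.subst σ) (s.subst σ)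
  | σ, .rel R ts => .rel R fun i => (ts i).subst σ
  | _, .one => .one
  | _, .zero => .zero
  | _, .top => .top
  | σ, .tensor α β => .tensor (subst σ α) (subst σ β)
  | σ, .plus α β => .plus (subst σ α) (subst σ β)
  | σ, .with α β => .with (subst σ α) (subst σ β)
  | σ, .lolli α β => .lolli (subst σ α) (subst σ β)
  | σ, .bang α => .bang (subst σ α)
  | σ, .all α => .all (subst (up σ) α)
  | σ, .ex α => .ex (subst (up σ) α)

/-- Free variables. -/
def fv : LFormula L K → Finset ℕ
  | .user _ ts => Finset.univ.biUnion fun i => (ts i).varFinset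
  | .eq t s => t.varFinset ∪ s.varFinset
  | .rel _ ts => Finset.univ.biUnion fun i => (ts i).varFinset
  | .one => ∅
  | .zero => ∅
  | .top => ∅
  | .tensor α β => α.fv ∪ β.fv
  | .plus α β => α.fv ∪ β.fv
  | .with α β => α.fv ∪ β.fv
  | .lolli α β => α.fv ∪ β.fv
  | .bang α => α.fv
  | .all α => (α.fv.erase 0).image Nat.pred
  | .ex α => (α.fv.erase 0).image Nat.pred

/-- The formula with all its free variables raised by one, as it reads below a quantifier. -/
def shift (α : LFormula L K) : LFormula L K := α.subst (renameSubst Nat.succ)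

def inst (α : LFormula L K) (t : L.Term ℕ) : LFormula L K := α.subst (instSubst t)

/-- `∃ x̄. α` for a finite set `x̄` of variables. -/
def exVars (X : Finset ℕ) (α : LFormula L K) : LFormula L K :=
  (X.sort (· ≤ ·)).foldr (fun x β => .ex (β.subst (bindSubst x))) α

/-- `∀ x̄. α` for a finite set `x̄` of variables. -/
def allVars (X : Finset ℕ) (α : LFormula L K) : LFormula L K :=
  (X.sort (· ≤ ·)).foldr (fun x β => .all (β.subst (bindSubst x))) α

/-- The universal closure `∀ α`. -/
def univClosure (α : LFormula L K) : LFormula L K := allVars α.fv α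

/-- The sequent calculus of intuitionistic linear logic.  In `allR` and `exL` the eigenvariable is
index `0`; shifting the rest of the sequent makes it fresh. -/
inductive Provable : Multiset (LFormula L K) → LFormula L K → Prop
  | identity (α : LFormula L K) : Provable {α} α
  | cut {Γ Δ : Multiset (LFormula L K)} {α β : LFormula L K} :
      Provable Γ α → Provable (α ::ₘ Δ) β → Provable (Γ + Δ) β
  | tensorL {Γ : Multiset (LFormula L K)} {α β γ : LFormula L K} :
      Provable (α ::ₘ β ::ₘ Γ) γ → Provable (.tensor α β ::ₘ Γ) γ
  | tensorR {Γ Δ : Multiset (LFormula L K)} {α β : LFormula L K} :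
      Provable Γ α → Provable Δ β → Provable (Γ + Δ) (.tensor α β)
  | oneL {Γ : Multiset (LFormula L K)} {α : LFormula L K} :
      Provable Γ α → Provable (.one ::ₘ Γ) α
  | oneR : Provable 0 .one
  | lolliL {Γ Δ : Multiset (LFormula L K)} {α β γ : LFormula L K} :
      Provable Γ α → Provable (β ::ₘ Δ) γ → Provable (.lolli α β ::ₘ (Γ + Δ)) γ
  | lolliR {Γ : Multiset (LFormula L K)} {α β : LFormula L K} :
      Provable (α ::ₘ Γ) β → Provable Γ (.lolli α β)
  | bangR {Γ : Multiset (LFormula L K)} {α : LFormula L K} :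
      Provable (Γ.map .bang) α → Provable (Γ.map .bang) (.bang α)
  | dereliction {Γ : Multiset (LFormula L K)} {α β : LFormula L K} :
      Provable (α ::ₘ Γ) β → Provable (.bang α ::ₘ Γ) β
  | contraction {Γ : Multiset (LFormula L K)} {α β : LFormula L K} :
      Provable (.bang α ::ₘ .bang α ::ₘ Γ) β → Provable (.bang α ::ₘ Γ) β
  | weakening {Γ : Multiset (LFormula L K)} {α β : LFormula L K} :
      Provable Γ β → Provable (.bang α ::ₘ Γ) β
  | withL₁ {Γ : Multiset (LFormula L K)} {α β γ : LFormula L K} :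
      Provable (α ::ₘ Γ) γ → Provable (.with α β ::ₘ Γ) γ
  | withL₂ {Γ : Multiset (LFormula L K)} {α β γ : LFormula L K} :
      Provable (β ::ₘ Γ) γ → Provable (.with α β ::ₘ Γ) γ
  | withR {Γ : Multiset (LFormula L K)} {α β : LFormula L K} :
      Provable Γ α → Provable Γ β → Provable Γ (.with α β)
  | topR {Γ : Multiset (LFormula L K)} : Provable Γ .top
  | plusL {Γ : Multiset (LFormula L K)} {α β γ : LFormula L K} :
      Provable (α ::ₘ Γ) γ → Provable (β ::ₘ Γ) γ → Provable (.plus α β ::ₘ Γ) γ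
  | plusR₁ {Γ : Multiset (LFormula L K)} {α β : LFormula L K} :
      Provable Γ α → Provable Γ (.plus α β)
  | plusR₂ {Γ : Multiset (LFormula L K)} {α β : LFormula L K} :
      Provable Γ β → Provable Γ (.plus α β)
  | zeroL {α : LFormula L K} : Provable {.zero} α
  | allL {Γ : Multiset (LFormula L K)} {α β : LFormula L K} (t : L.Term ℕ) :
      Provable (α.inst t ::ₘ Γ) β → Provable (.all α ::ₘ Γ) β
  | allR {Γ : Multiset (LFormula L K)} {β : LFormula L K} :
      Provable (Γ.map shift) β → Provable Γ (.all β)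
  | exL {Γ : Multiset (LFormula L K)} {α β : LFormula L K} :
      Provable (α ::ₘ Γ.map shift) β.shift → Provable (.ex α ::ₘ Γ) β
  | exR {Γ : Multiset (LFormula L K)} {β : LFormula L K} (t : L.Term ℕ) :
      Provable Γ (β.inst t) → Provable Γ (.ex β)

/-- `Θ ⊢ α` for a possibly infinite set `Θ` of banged formulas, each of which may be used any
number of times: some finite multiset of formulas of `Θ` proves `α`. -/
def ProvableFrom (Θ : Set (LFormula L K)) (α : LFormula L K) : Prop :=
  ∃ Γ : Multiset (LFormula L K), (∀ γ ∈ Γ, γ ∈ Θ) ∧ Provable Γ α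

end LFormula

/-! ### Translation into linear logic -/

section Translation

variable {L : FirstOrder.Language.{u, v}} {K : ℕ → Type w}

/-- The translation `(·)*` of intuitionistic logic into intuitionistic linear logic. -/
def Formula.star (K : ℕ → Type w) : Formula L → LFormula L K
  | .top => .one
  | .bot => .zero
  | .eq t s => .bang (.eq t s)
  | .rel R ts => .bang (.rel R ts)
  | .and φ ψ => .tensor (φ.star K) (ψ.star K)
  | .or φ ψ => .plus (φ.star K) (ψ.star K)
  | .imp φ ψ => .bang (.lolli (φ.star K) (ψ.star K))
  | .all φ => .bang (.all (φ.star K))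
  | .ex φ => .ex (φ.star K)

def UserAtom.toL : UserAtom L K → LFormula L K
  | .mk c ts => .user c ts

def BuiltInAtom.toL (K : ℕ → Type w) : BuiltInAtom L → LFormula L K
  | .bot => .zero
  | .eq t s => .bang (.eq t s)
  | .rel R ts => .bang (.rel R ts)

def Goal.toL : Goal L K → LFormula L K
  | .top => .one
  | .user a => a.toL
  | .builtIn b => b.toL K
  | .and G H => .tensor G.toL H.toL
  | .or G H => .plus G.toL H.toL

/-- `⟨𝔾; 𝕍⟩` is translated by quantifying existentially the variables of `𝔾` outside `𝕍`. -/
def State.toL (S : State L K) : LFormula L K :=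
  LFormula.exVars (S.goal.vars \ S.globals) S.goal.toL

def Config.toL : Config L K → LFormula L K
  | .empty => .zero
  | .state S => S.toL
  | .or C D => .plus C.toL D.toL

/-- `!∀(H₁ ⊗ H₂ ⊗ G ⊸ H₁ ⊗ ∃ȳ.(B ⊗ G))`, where `ȳ` are the local variables of the rule. -/
def Rule.toL (r : Rule L K) : LFormula L K :=
  .bang (LFormula.univClosure (.lolli
    (.tensor (User.toGoal r.kept).toL
      (.tensor (User.toGoal r.removed).toL (BuiltIn.toGoal K r.guard).toL))
    (.tensor (User.toGoal r.kept).toL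
      (LFormula.exVars r.localVars (.tensor r.body.toL (BuiltIn.toGoal K r.guard).toL)))))

/-- The translation of a program. -/
def programL (P : Set (Rule L K)) : Set (LFormula L K) := Rule.toL '' P

/-- `!∀(c(x₁, …, xⱼ, …, xₙ) ⊗ !(xⱼ ≐ y) ⊸ c(x₁, …, y, …, xₙ) ⊗ !(xⱼ ≐ y))`; the variables are
`xᵢ = i` for `i < n` and `y = n`. -/
def equalityL {n : ℕ} (c : K n) (j : Fin n) : LFormula L K :=
  let x : Fin n → L.Term ℕ := fun i => .var i
  let y : L.Term ℕ := .var n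
  .bang (LFormula.univClosure (.lolli
    (.tensor (.user c x) (.bang (.eq (x j) y)))
    (.tensor (.user c (Function.update x j y)) (.bang (.eq (x j) y)))))

/-- The translation of a constraint theory. -/
def theoryL (K : ℕ → Type w) (CT : Set (CTAxiom L)) : Set (LFormula L K) :=
  (fun α : CTAxiom L => α.toFormula.star K) '' CT ∪
    {α | ∃ (n : ℕ) (c : K n) (j : Fin n), α = equalityL c j}

end Translation

end CHR

/-! Soundness (operational to logical). Over the axioms $\Theta=\mathbb P^L\cup CT^L$, every
operational relation becomes an entailment between translations, by induction on its definition.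
Goal equivalence is the commutative monoid structure of $\otimes$ and its distribution over
$\oplus$. Each use of $CT\models\varphi\to\psi$ passes through the embedding of intuitionistic into
linear logic (`LFormula.Entails.of_formula`), and substitution in user-defined constraints uses the
congruence axioms in $CT^L$. A transition is an instance of the rule formula; since the local
variables are fresh, their quantifier can be extruded over the rest of the state (`Rule.toL_apply`).

Completeness (logical to operational). Instead of cut elimination, a phase model is built from the
operational semantics. Its monoid consists of stores, that is, pairs of multisets of user-defined
and built-in atoms. Its pole consists of the stores which, with any further built-in constraints,
reach $\bar T$ (`canonicalModel`). Formulas are evaluated under valuations of the variables by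
terms, and `PhaseModel.soundness` shows that every derivable sequent, cut included, holds in the
model.

It remains to see that the axioms hold, i.e. that their facts contain the empty store. For a rule
this means: if every outcome of the rule leads to the pole, then so does a store that contains an
instance of its heads and guard (`zero_mem_rule`). Transitions match heads only up to renaming, so
the instance is first unfolded into a copy with fresh variables plus equations
(`StateEquiv.expand`); afterwards the equations are applied backwards. Completeness of $CT$ decides
whether the guard is consistent with the store: if so, the transition fires; if not, the state is
failed and reaches everything (`Reach.of_complete_step`).

Now $0$ lies in the fact of $\bar S^L\multimap\bar T^L$, so the fact of $\bar S^L$ is included in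
that of $\bar T^L$. The latter lies in the pole, because instances of a state entail it
(`sem_subset_pole`). Hence the fact of $\bar S^L$ lies in the pole, which says that $\bar S$ reaches
$\bar T$ (`reach_of_sem_subset_pole`). -/

namespace CHR

/-! ### Substitution in terms and below binders -/

section Terms

variable {L : FirstOrder.Language.{u, v}}

theorem Term.subst_congr {σ τ : ℕ → L.Term ℕ} (t : L.Term ℕ)
    (h : ∀ x ∈ t.varFinset, σ x = τ x) : t.subst σ = t.subst τ := by
  induction t with
  | var x => exact h x (by simp [FirstOrder.Language.Term.varFinset])
  | func f ts ih =>
    simp only [FirstOrder.Language.Term.subst]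
    congr 1
    funext i
    exact ih i fun x hx => h x (by
      simp only [FirstOrder.Language.Term.varFinset, Finset.mem_biUnion]
      exact ⟨i, Finset.mem_univ _, hx⟩)

theorem Term.subst_subst (σ τ : ℕ → L.Term ℕ) (t : L.Term ℕ) :
    (t.subst σ).subst τ = t.subst fun x => (σ x).subst τ := by
  induction t with
  | var x => rfl
  | func f ts ih => simp only [FirstOrder.Language.Term.subst, ih]

theorem Term.subst_var (t : L.Term ℕ) : t.subst FirstOrder.Language.Term.var = t := by
  induction t with
  | var x => rfl
  | func f ts ih => simp only [FirstOrder.Language.Term.subst, ih]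

theorem Term.subst_eq_self {σ : ℕ → L.Term ℕ} (t : L.Term ℕ)
    (h : ∀ x ∈ t.varFinset, σ x = .var x) : t.subst σ = t :=
  (Term.subst_congr t h).trans (Term.subst_var t)

theorem Term.relabel_eq_subst (f : ℕ → ℕ) (t : L.Term ℕ) :
    t.relabel f = t.subst (renameSubst f) := by
  induction t with
  | var x => rfl
  | func f ts ih => simp only [FirstOrder.Language.Term.subst, FirstOrder.Language.Term.relabel, ih]

theorem Term.mem_varFinset_subst {σ : ℕ → L.Term ℕ} {t : L.Term ℕ} {y : ℕ} :
    y ∈ (t.subst σ).varFinset ↔ ∃ x ∈ t.varFinset, y ∈ (σ x).varFinset := by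
  induction t with
  | var x => simp [FirstOrder.Language.Term.subst, FirstOrder.Language.Term.varFinset]
  | func f ts ih =>
    simp only [FirstOrder.Language.Term.subst, FirstOrder.Language.Term.varFinset, Finset.mem_biUnion, Finset.mem_univ,
      true_and, ih]
    exact ⟨fun ⟨i, x, h⟩ => ⟨x, ⟨i, h.1⟩, h.2⟩, fun ⟨x, ⟨i, h⟩, h'⟩ => ⟨i, x, h, h'⟩⟩

theorem Term.mem_varFinset_var {x y : ℕ} :
    y ∈ (FirstOrder.Language.Term.var x : L.Term ℕ).varFinset ↔ y = x := by
  simp [FirstOrder.Language.Term.varFinset]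

theorem up_comp (σ τ : ℕ → L.Term ℕ) :
    (fun x => (up σ x).subst (up τ)) = up fun x => (σ x).subst τ := by
  funext x
  cases x with
  | zero => rfl
  | succ x =>
    simp only [up, Term.relabel_eq_subst, Term.subst_subst]
    congr 1
    funext y
    simp [renameSubst, FirstOrder.Language.Term.subst, up, Term.relabel_eq_subst]

theorem up_var : up (FirstOrder.Language.Term.var : ℕ → L.Term ℕ) = FirstOrder.Language.Term.var := by
  funext x
  cases x <;> rfl

theorem up_congr {σ τ : ℕ → L.Term ℕ} {X : Finset ℕ}
    (h : ∀ x, x + 1 ∈ X → σ x = τ x) : ∀ x ∈ X, up σ x = up τ x := by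
  intro x hx
  cases x with
  | zero => rfl
  | succ x => simp only [up, h x hx]

theorem mem_varFinset_up {σ : ℕ → L.Term ℕ} {x y : ℕ} :
    y + 1 ∈ (up σ x).varFinset ↔ ∃ z, x = z + 1 ∧ y ∈ (σ z).varFinset := by
  cases x with
  | zero => simp [up, FirstOrder.Language.Term.varFinset]
  | succ x =>
    simp only [up, Term.relabel_eq_subst, Term.mem_varFinset_subst, renameSubst,
      Term.mem_varFinset_var]
    simp

theorem mem_image_pred_erase {X : Finset ℕ} {y : ℕ} :
    y ∈ (X.erase 0).image Nat.pred ↔ y + 1 ∈ X := by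
  simp only [Finset.mem_image, Finset.mem_erase]
  constructor
  · rintro ⟨x, ⟨h0, hx⟩, rfl⟩
    rwa [← Nat.succ_eq_add_one, Nat.succ_pred h0]
  · exact fun h => ⟨y + 1, ⟨Nat.succ_ne_zero _, h⟩, rfl⟩

theorem subst_up_inst (σ : ℕ → L.Term ℕ) (t : L.Term ℕ) :
    (fun x => (instSubst t x).subst σ) =
      fun x => (up σ x).subst (instSubst (t.subst σ)) := by
  funext x
  cases x with
  | zero => rfl
  | succ x =>
    simp only [instSubst, up, Term.relabel_eq_subst, Term.subst_subst, renameSubst,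
      FirstOrder.Language.Term.subst]
    exact (Term.subst_var _).symm

theorem subst_up_shift (σ : ℕ → L.Term ℕ) :
    (fun x => (renameSubst Nat.succ x : L.Term ℕ).subst (up σ)) =
      fun x => (σ x).subst (renameSubst Nat.succ) := by
  funext x
  simp [renameSubst, FirstOrder.Language.Term.subst, up, Term.relabel_eq_subst]

end Terms

/-! ### Substitution in intuitionistic formulas and derivations -/

namespace Formula

variable {L : FirstOrder.Language.{u, v}}

theorem subst_subst (σ τ : ℕ → L.Term ℕ) (φ : Formula L) :
    (φ.subst σ).subst τ = φ.subst fun x => (σ x).subst τ := by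
  induction φ generalizing σ τ with
  | top => rfl
  | bot => rfl
  | eq t s => simp only [subst, Term.subst_subst]
  | rel R ts => simp only [subst, Term.subst_subst]
  | and φ ψ h1 h2 => simp only [subst, h1, h2]
  | or φ ψ h1 h2 => simp only [subst, h1, h2]
  | imp φ ψ h1 h2 => simp only [subst, h1, h2]
  | all φ h => simp only [subst, h, up_comp]
  | ex φ h => simp only [subst, h, up_comp]

theorem subst_congr {σ τ : ℕ → L.Term ℕ} (φ : Formula L) (h : ∀ x ∈ φ.fv, σ x = τ x) :
    φ.subst σ = φ.subst τ := by
  induction φ generalizing σ τ with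
  | top => rfl
  | bot => rfl
  | eq t s =>
    simp only [subst]
    rw [Term.subst_congr t fun x hx => h x (by simp [fv, hx]),
      Term.subst_congr s fun x hx => h x (by simp [fv, hx])]
  | rel R ts =>
    simp only [subst]
    congr 1
    funext i
    exact Term.subst_congr _ fun x hx => h x (by
      simp only [fv, Finset.mem_biUnion]; exact ⟨i, Finset.mem_univ _, hx⟩)
  | and φ ψ h1 h2 | or φ ψ h1 h2 | imp φ ψ h1 h2 =>
    simp only [subst]
    rw [h1 fun x hx => h x (by simp [fv, hx]), h2 fun x hx => h x (by simp [fv, hx])]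
  | all φ ih | ex φ ih =>
    simp only [subst]
    rw [ih (up_congr fun x hx => h x (mem_image_pred_erase.2 hx))]

theorem subst_var (φ : Formula L) : φ.subst FirstOrder.Language.Term.var = φ := by
  induction φ with
  | top => rfl
  | bot => rfl
  | eq t s => simp only [subst, Term.subst_var]
  | rel R ts => simp only [subst, Term.subst_var]
  | and φ ψ h1 h2 | or φ ψ h1 h2 | imp φ ψ h1 h2 => simp only [subst, h1, h2]
  | all φ h | ex φ h => simp only [subst, up_var, h]

theorem mem_fv_subst {σ : ℕ → L.Term ℕ} {φ : Formula L} {y : ℕ} :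
    y ∈ (φ.subst σ).fv → ∃ x ∈ φ.fv, y ∈ (σ x).varFinset := by
  induction φ generalizing σ y with
  | top => simp [fv, subst]
  | bot => simp [fv, subst]
  | eq t s =>
    simp only [fv, subst, Finset.mem_union, Term.mem_varFinset_subst]
    rintro (⟨x, h, h'⟩ | ⟨x, h, h'⟩)
    exacts [⟨x, .inl h, h'⟩, ⟨x, .inr h, h'⟩]
  | rel R ts =>
    simp only [fv, subst, Finset.mem_biUnion, Term.mem_varFinset_subst]
    rintro ⟨i, hi, x, h, h'⟩
    exact ⟨x, ⟨i, hi, h⟩, h'⟩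
  | and φ ψ h1 h2 | or φ ψ h1 h2 | imp φ ψ h1 h2 =>
    simp only [fv, subst, Finset.mem_union]
    rintro (h | h)
    · obtain ⟨x, h, h'⟩ := h1 h
      exact ⟨x, .inl h, h'⟩
    · obtain ⟨x, h, h'⟩ := h2 h
      exact ⟨x, .inr h, h'⟩
  | all φ ih | ex φ ih =>
    simp only [fv, subst, mem_image_pred_erase]
    intro h
    obtain ⟨x, h, h'⟩ := ih h
    obtain ⟨z, rfl, hz⟩ := mem_varFinset_up.1 h'
    exact ⟨z, h, hz⟩

theorem subst_inst (σ : ℕ → L.Term ℕ) (φ : Formula L) (t : L.Term ℕ) :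
    (φ.inst t).subst σ = (φ.subst (up σ)).inst (t.subst σ) := by
  simp only [inst, subst_subst, subst_up_inst]

theorem subst_shift (σ : ℕ → L.Term ℕ) (φ : Formula L) :
    φ.shift.subst (up σ) = (φ.subst σ).shift := by
  simp only [shift, subst_subst, subst_up_shift]

theorem Provable.mono {Γ Δ : Set (Formula L)} {φ : Formula L} (h : Provable Γ φ) (hs : Γ ⊆ Δ) :
    Provable Δ φ := by
  induction h generalizing Δ with
  | hyp h => exact .hyp (hs h)
  | topI => exact .topI
  | botE _ ih => exact .botE (ih hs)
  | andI _ _ h1 h2 => exact .andI (h1 hs) (h2 hs)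
  | andE₁ _ ih => exact .andE₁ (ih hs)
  | andE₂ _ ih => exact .andE₂ (ih hs)
  | orI₁ _ ih => exact .orI₁ (ih hs)
  | orI₂ _ ih => exact .orI₂ (ih hs)
  | orE _ _ _ h1 h2 h3 =>
    exact .orE (h1 hs) (h2 (Set.insert_subset_insert hs)) (h3 (Set.insert_subset_insert hs))
  | impI _ ih => exact .impI (ih (Set.insert_subset_insert hs))
  | impE _ _ h1 h2 => exact .impE (h1 hs) (h2 hs)
  | allI _ ih => exact .allI (ih (Set.image_mono hs))
  | allE t _ ih => exact .allE t (ih hs)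
  | exI t _ ih => exact .exI t (ih hs)
  | exE _ _ h1 h2 => exact .exE (h1 hs) (h2 (Set.insert_subset_insert (Set.image_mono hs)))

theorem image_subst_shift (σ : ℕ → L.Term ℕ) (Γ : Set (Formula L)) :
    subst (up σ) '' (shift '' Γ) = shift '' (subst σ '' Γ) := by
  simp only [Set.image_image, subst_shift]

/-- At the quantifier rules the substitution is moved below the binder by `up`; `subst_inst` and
`subst_shift` then say that it commutes with instantiation and with the shift that makes the
eigenvariable fresh. -/
theorem Provable.subst {Γ : Set (Formula L)} {φ : Formula L} (h : Provable Γ φ)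
    (σ : ℕ → L.Term ℕ) : Provable (Formula.subst σ '' Γ) (φ.subst σ) := by
  induction h generalizing σ with
  | hyp h => exact .hyp ⟨_, h, rfl⟩
  | topI => exact .topI
  | botE _ ih => exact .botE (ih σ)
  | andI _ _ h1 h2 => exact .andI (h1 σ) (h2 σ)
  | andE₁ _ ih => exact .andE₁ (ih σ)
  | andE₂ _ ih => exact .andE₂ (ih σ)
  | orI₁ _ ih => exact .orI₁ (ih σ)
  | orI₂ _ ih => exact .orI₂ (ih σ)
  | orE _ _ _ h1 h2 h3 =>
    have h2 := h2 σ
    have h3 := h3 σ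
    rw [Set.image_insert_eq] at h2 h3
    exact .orE (h1 σ) h2 h3
  | impI _ ih =>
    have ih := ih σ
    rw [Set.image_insert_eq] at ih
    exact .impI ih
  | impE _ _ h1 h2 => exact .impE (h1 σ) (h2 σ)
  | allI _ ih =>
    have ih := ih (up σ)
    rw [image_subst_shift] at ih
    exact .allI ih
  | allE t _ ih =>
    rw [subst_inst]
    exact .allE _ (ih σ)
  | exI t _ ih =>
    have ih := ih σ
    rw [subst_inst] at ih
    exact .exI _ ih
  | exE _ _ h1 h2 =>
    have h2 := h2 (up σ)
    rw [Set.image_insert_eq, image_subst_shift, subst_shift] at h2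
    exact .exE (h1 σ) h2

end Formula

/-! ### Substitution in linear formulas and derivations -/

namespace LFormula

variable {L : FirstOrder.Language.{u, v}} {K : ℕ → Type w}

theorem subst_subst (σ τ : ℕ → L.Term ℕ) (φ : LFormula L K) :
    (φ.subst σ).subst τ = φ.subst fun x => (σ x).subst τ := by
  induction φ generalizing σ τ with
  | one => rfl
  | zero => rfl
  | top => rfl
  | eq t s => simp only [subst, Term.subst_subst]
  | rel R ts | user R ts => simp only [subst, Term.subst_subst]
  | bang φ h => simp only [subst, h]
  | all φ h | ex φ h => simp only [subst, h, up_comp]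
  | _ =>
    rename_i φ ψ h1 h2
    simp only [subst, h1, h2]

theorem subst_congr {σ τ : ℕ → L.Term ℕ} (φ : LFormula L K) (h : ∀ x ∈ φ.fv, σ x = τ x) :
    φ.subst σ = φ.subst τ := by
  induction φ generalizing σ τ with
  | one => rfl
  | zero => rfl
  | top => rfl
  | eq t s =>
    simp only [subst]
    rw [Term.subst_congr t fun x hx => h x (by simp [fv, hx]),
      Term.subst_congr s fun x hx => h x (by simp [fv, hx])]
  | rel R ts | user R ts =>
    simp only [subst]
    congr 1
    funext i
    exact Term.subst_congr _ fun x hx => h x (by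
      simp only [fv, Finset.mem_biUnion]; exact ⟨i, Finset.mem_univ _, hx⟩)
  | bang φ ih => simp only [subst, ih h]
  | all φ ih | ex φ ih =>
    simp only [subst]
    rw [ih (up_congr fun x hx => h x (mem_image_pred_erase.2 hx))]
  | _ =>
    rename_i φ ψ h1 h2
    simp only [subst]
    rw [h1 fun x hx => h x (by simp [fv, hx]), h2 fun x hx => h x (by simp [fv, hx])]

theorem subst_var (φ : LFormula L K) : φ.subst FirstOrder.Language.Term.var = φ := by
  induction φ with
  | one => rfl
  | zero => rfl
  | top => rfl
  | eq t s => simp only [subst, Term.subst_var]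
  | rel R ts | user R ts => simp only [subst, Term.subst_var]
  | bang φ h => simp only [subst, h]
  | all φ h | ex φ h => simp only [subst, up_var, h]
  | _ =>
    rename_i φ ψ h1 h2
    simp only [subst, h1, h2]

theorem mem_fv_subst {σ : ℕ → L.Term ℕ} {φ : LFormula L K} {y : ℕ} :
    y ∈ (φ.subst σ).fv → ∃ x ∈ φ.fv, y ∈ (σ x).varFinset := by
  induction φ generalizing σ y with
  | one => simp [fv, subst]
  | zero => simp [fv, subst]
  | top => simp [fv, subst]
  | eq t s =>
    simp only [fv, subst, Finset.mem_union, Term.mem_varFinset_subst]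
    rintro (⟨x, h, h'⟩ | ⟨x, h, h'⟩)
    exacts [⟨x, .inl h, h'⟩, ⟨x, .inr h, h'⟩]
  | rel R ts | user R ts =>
    simp only [fv, subst, Finset.mem_biUnion, Term.mem_varFinset_subst]
    rintro ⟨i, hi, x, h, h'⟩
    exact ⟨x, ⟨i, hi, h⟩, h'⟩
  | bang φ ih => exact ih
  | all φ ih | ex φ ih =>
    simp only [fv, subst, mem_image_pred_erase]
    intro h
    obtain ⟨x, h, h'⟩ := ih h
    obtain ⟨z, rfl, hz⟩ := mem_varFinset_up.1 h'
    exact ⟨z, h, hz⟩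
  | _ =>
    rename_i φ ψ h1 h2
    simp only [fv, subst, Finset.mem_union]
    rintro (h | h)
    · obtain ⟨x, h, h'⟩ := h1 h
      exact ⟨x, .inl h, h'⟩
    · obtain ⟨x, h, h'⟩ := h2 h
      exact ⟨x, .inr h, h'⟩

theorem subst_inst (σ : ℕ → L.Term ℕ) (φ : LFormula L K) (t : L.Term ℕ) :
    (φ.inst t).subst σ = (φ.subst (up σ)).inst (t.subst σ) := by
  simp only [inst, subst_subst, subst_up_inst]

theorem subst_shift (σ : ℕ → L.Term ℕ) (φ : LFormula L K) :
    φ.shift.subst (up σ) = (φ.subst σ).shift := by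
  simp only [shift, subst_subst, subst_up_shift]

theorem map_subst_shift (σ : ℕ → L.Term ℕ) (Γ : Multiset (LFormula L K)) :
    (Γ.map shift).map (subst (up σ)) = (Γ.map (subst σ)).map shift := by
  simp only [Multiset.map_map, Function.comp_def, subst_shift]

theorem Provable.subst {Γ : Multiset (LFormula L K)} {φ : LFormula L K} (h : Provable Γ φ)
    (σ : ℕ → L.Term ℕ) : Provable (Γ.map (LFormula.subst σ)) (φ.subst σ) := by
  induction h generalizing σ with
  | identity => exact .identity _
  | cut _ _ h1 h2 =>
    have h2 := h2 σ
    rw [Multiset.map_cons] at h2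
    rw [Multiset.map_add]
    exact .cut (h1 σ) h2
  | tensorL _ ih =>
    have ih := ih σ
    simp only [Multiset.map_cons] at ih ⊢
    exact .tensorL ih
  | tensorR _ _ h1 h2 =>
    rw [Multiset.map_add]
    exact .tensorR (h1 σ) (h2 σ)
  | oneL _ ih =>
    rw [Multiset.map_cons]
    exact .oneL (ih σ)
  | oneR => exact .oneR
  | lolliL _ _ h1 h2 =>
    have h2 := h2 σ
    simp only [Multiset.map_cons, Multiset.map_add] at h2 ⊢
    exact .lolliL (h1 σ) h2
  | lolliR _ ih =>
    have ih := ih σ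
    rw [Multiset.map_cons] at ih
    exact .lolliR ih
  | @bangR Γ α _ ih =>
    have ih := ih σ
    have e : (Γ.map bang).map (LFormula.subst σ) = (Γ.map (LFormula.subst σ)).map bang := by
      simp only [Multiset.map_map, Function.comp_def, LFormula.subst]
    rw [e] at ih ⊢
    exact .bangR ih
  | dereliction _ ih =>
    have ih := ih σ
    simp only [Multiset.map_cons] at ih ⊢
    exact .dereliction ih
  | contraction _ ih =>
    have ih := ih σ
    simp only [Multiset.map_cons] at ih ⊢
    exact .contraction ih
  | weakening _ ih =>
    rw [Multiset.map_cons]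
    exact .weakening (ih σ)
  | withL₁ _ ih =>
    have ih := ih σ
    simp only [Multiset.map_cons] at ih ⊢
    exact .withL₁ ih
  | withL₂ _ ih =>
    have ih := ih σ
    simp only [Multiset.map_cons] at ih ⊢
    exact .withL₂ ih
  | withR _ _ h1 h2 => exact .withR (h1 σ) (h2 σ)
  | topR => exact .topR
  | plusL _ _ h1 h2 =>
    have h1 := h1 σ
    have h2 := h2 σ
    simp only [Multiset.map_cons] at h1 h2 ⊢
    exact .plusL h1 h2
  | plusR₁ _ ih => exact .plusR₁ (ih σ)
  | plusR₂ _ ih => exact .plusR₂ (ih σ)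
  | zeroL => exact .zeroL
  | allL t _ ih =>
    have ih := ih σ
    simp only [Multiset.map_cons, subst_inst] at ih ⊢
    exact .allL _ ih
  | allR _ ih =>
    have ih := ih (up σ)
    rw [map_subst_shift] at ih
    exact .allR ih
  | exL _ ih =>
    have ih := ih (up σ)
    rw [Multiset.map_cons, map_subst_shift, subst_shift] at ih
    rw [Multiset.map_cons]
    exact .exL ih
  | exR t _ ih =>
    have ih := ih σ
    rw [subst_inst] at ih
    exact .exR _ ih

end LFormula

/-! ### Quantification over named variables -/

/-- A preordered logic with de Bruijn substitution and an operation on formulas that is left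
adjoint to shifting.  Existential quantification is one, and so is universal quantification with
respect to the reversed order. -/
structure QuantLogic (L : FirstOrder.Language.{u, v}) (F : Type w) where
  subst : (ℕ → L.Term ℕ) → F → F
  fv : F → Finset ℕ
  q : F → F
  le : F → F → Prop
  subst_subst : ∀ σ τ φ, subst τ (subst σ φ) = subst (fun x => (σ x).subst τ) φ
  subst_congr : ∀ σ τ φ, (∀ x ∈ fv φ, σ x = τ x) → subst σ φ = subst τ φ
  subst_var : ∀ φ, subst FirstOrder.Language.Term.var φ = φ
  mem_fv_subst : ∀ σ φ y, y ∈ fv (subst σ φ) → ∃ x ∈ fv φ, y ∈ (σ x).varFinset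
  subst_q : ∀ σ φ, subst σ (q φ) = q (subst (up σ) φ)
  mem_fv_q : ∀ φ y, y ∈ fv (q φ) ↔ y + 1 ∈ fv φ
  refl : ∀ φ, le φ φ
  trans : ∀ φ ψ χ, le φ ψ → le ψ χ → le φ χ
  le_subst : ∀ σ φ ψ, le φ ψ → le (subst σ φ) (subst σ ψ)
  intro : ∀ φ t, le (subst (instSubst t) φ) (q φ)
  elim : ∀ φ ψ, le φ (subst (renameSubst Nat.succ) ψ) → le (q φ) ψ

namespace QuantLogic

variable {L : FirstOrder.Language.{u, v}} {F : Type w} (S : QuantLogic L F)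

/-- Quantification over a list of named variables. -/
def qList (xs : List ℕ) (φ : F) : F := xs.foldr (fun x ψ => S.q (S.subst (bindSubst x) ψ)) φ

theorem mem_fv_qList {xs : List ℕ} {φ : F} {y : ℕ} (h : y ∈ S.fv (S.qList xs φ)) :
    y ∈ S.fv φ ∧ y ∉ xs := by
  induction xs with
  | nil => exact ⟨h, by simp⟩
  | cons x xs ih =>
    replace h : y ∈ S.fv (S.q (S.subst (bindSubst x) (S.qList xs φ))) := h
    rw [S.mem_fv_q] at h
    obtain ⟨z, hz, h⟩ := S.mem_fv_subst _ _ _ h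
    simp only [bindSubst] at h
    split_ifs at h with hx
    · simp at h
    · rw [Term.mem_varFinset_var] at h
      obtain rfl : y = z := by omega
      exact ⟨(ih hz).1, by simp [hx, (ih hz).2]⟩

/-- This turns de Bruijn instantiation into an update of the substitution at the name `x`, which
lets a list of named quantifiers be treated one name at a time. -/
theorem inst_bind (σ : ℕ → L.Term ℕ) (x : ℕ) (t : L.Term ℕ) (φ : F) :
    S.subst (instSubst t) (S.subst (up σ) (S.subst (bindSubst x) φ)) =
      S.subst (Function.update σ x t) φ := by
  rw [S.subst_subst, S.subst_subst]
  congr 1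
  funext y
  by_cases h : y = x
  · subst h
    simp [bindSubst, FirstOrder.Language.Term.subst, up, instSubst]
  · simp only [bindSubst, h, if_false, FirstOrder.Language.Term.subst, up, Term.relabel_eq_subst,
      Term.subst_subst, renameSubst, instSubst, Function.update_of_ne, ne_eq, not_false_eq_true]
    exact Term.subst_var _

/-- The values of `τ` on `xs` serve as witnesses, supplied one name at a time. -/
theorem le_qList (xs : List ℕ) (φ : F) (σ τ : ℕ → L.Term ℕ)
    (h : ∀ y ∈ S.fv φ, y ∉ xs → τ y = σ y) : S.le (S.subst τ φ) (S.subst σ (S.qList xs φ)) := by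
  induction xs generalizing σ with
  | nil =>
    rw [S.subst_congr τ σ φ fun y hy => h y hy (by simp)]
    exact S.refl _
  | cons x xs ih =>
    change S.le _ (S.subst σ (S.q (S.subst (bindSubst x) (S.qList xs φ))))
    rw [S.subst_q]
    refine S.trans _ _ _ ?_ (S.intro _ (τ x))
    rw [S.inst_bind]
    refine ih _ fun y hy hy' => ?_
    by_cases hx : y = x
    · subst hx; simp
    · rw [Function.update_of_ne hx]
      exact h y hy (by simp [hx, hy'])

/-- Elimination with a named eigenvariable. Rebinding `z` in the hypothesis undoes the instantiation
by `z`, since `z` is not free under the quantifier, and acts on `ψ` as the shift, since `z` is not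
free there either. This is the form that `elim` asks for. -/
theorem q_le {α ψ : F} {z : ℕ} (hα : z ∉ S.fv (S.q α)) (hψ : z ∉ S.fv ψ)
    (h : S.le (S.subst (instSubst (.var z)) α) ψ) : S.le (S.q α) ψ := by
  apply S.elim
  have h := S.le_subst (bindSubst z) _ _ h
  rw [S.subst_subst] at h
  have e1 : S.subst (fun x => (instSubst (.var z) x).subst (bindSubst z)) α = α := by
    refine (S.subst_congr _ _ _ fun x hx => ?_).trans (S.subst_var α)
    cases x with
    | zero => simp [instSubst, FirstOrder.Language.Term.subst, bindSubst]
    | succ x =>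
      have : x ≠ z := by
        rintro rfl
        exact hα ((S.mem_fv_q _ _).2 hx)
      simp [instSubst, FirstOrder.Language.Term.subst, bindSubst, this]
  have e2 : S.subst (bindSubst z) ψ = S.subst (renameSubst Nat.succ) ψ := by
    refine S.subst_congr _ _ _ fun x hx => ?_
    have : x ≠ z := by
      rintro rfl
      exact hψ hx
    simp [bindSubst, renameSubst, this]
  rwa [e1, e2] at h

/-- The bound names `x` are eliminated with eigenvariables `ρ x`. These have to be pairwise
distinct, not free in `ψ`, and absent from the images under `σ` of the variables that remain free.
-/
theorem qList_le (xs : List ℕ) (hxs : xs.Nodup) (φ ψ : F) (σ τ : ℕ → L.Term ℕ) (ρ : ℕ → ℕ)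
    (hρ : Set.InjOn ρ {x | x ∈ xs}) (hτρ : ∀ x ∈ xs, τ x = .var (ρ x))
    (hτ : ∀ y ∈ S.fv φ, y ∉ xs → τ y = σ y)
    (hψ : ∀ x ∈ xs, ρ x ∉ S.fv ψ)
    (hσ : ∀ x ∈ xs, ∀ y ∈ S.fv φ, y ∉ xs → ρ x ∉ (σ y).varFinset)
    (h : S.le (S.subst τ φ) ψ) : S.le (S.subst σ (S.qList xs φ)) ψ := by
  induction xs generalizing σ with
  | nil =>
    change S.le (S.subst σ φ) ψ
    rwa [← S.subst_congr τ σ φ fun y hy => hτ y hy (by simp)]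
  | cons x xs ih =>
    change S.le (S.subst σ (S.q (S.subst (bindSubst x) (S.qList xs φ)))) ψ
    have hfv : ρ x ∉ S.fv (S.subst σ (S.q (S.subst (bindSubst x) (S.qList xs φ)))) := by
      intro hmem
      obtain ⟨y, hy, hy'⟩ := S.mem_fv_subst _ _ _ hmem
      obtain ⟨hy1, hy2⟩ := S.mem_fv_qList (xs := x :: xs) hy
      exact hσ x (by simp) y hy1 hy2 hy'
    rw [S.subst_q] at hfv ⊢
    refine S.q_le (z := ρ x) hfv (hψ x (by simp)) ?_
    rw [S.inst_bind]
    have hnd := List.nodup_cons.1 hxs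
    refine ih hnd.2 _ (hρ.mono fun y hy => List.mem_cons_of_mem _ hy)
      (fun y hy => hτρ y (List.mem_cons_of_mem _ hy)) (fun y hy hy' => ?_)
      (fun y hy => hψ y (List.mem_cons_of_mem _ hy)) (fun x' hx' y hy hy' => ?_)
    · by_cases hx : y = x
      · subst hx
        simpa using hτρ y (by simp)
      · rw [Function.update_of_ne hx]
        exact hτ y hy (by simp [hx, hy'])
    · by_cases hx : y = x
      · subst hx
        rw [Function.update_self, Term.mem_varFinset_var]
        intro e
        -- Two names with the same eigenvariable would coincide by injectivity, but `xs` has no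
        -- duplicates.
        exact hnd.1 (hρ (List.mem_cons_of_mem _ hx') (by simp) e ▸ hx')
      · rw [Function.update_of_ne hx]
        exact hσ x' (List.mem_cons_of_mem _ hx') y hy (by simp [hx, hy'])

/-- Quantification over a finite set of named variables. -/
def qVars (X : Finset ℕ) (φ : F) : F := S.qList (X.sort (· ≤ ·)) φ

theorem mem_fv_qVars {X : Finset ℕ} {φ : F} {y : ℕ} (h : y ∈ S.fv (S.qVars X φ)) :
    y ∈ S.fv φ ∧ y ∉ X := by
  simpa using S.mem_fv_qList h

theorem le_qVars_subst (X : Finset ℕ) (φ : F) (σ τ : ℕ → L.Term ℕ)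
    (h : ∀ y ∈ S.fv φ, y ∉ X → τ y = σ y) : S.le (S.subst τ φ) (S.subst σ (S.qVars X φ)) :=
  S.le_qList _ _ _ _ (by simpa using h)

theorem qVars_subst_le (X : Finset ℕ) (φ ψ : F) (σ τ : ℕ → L.Term ℕ) (ρ : ℕ → ℕ)
    (hρ : Set.InjOn ρ X) (hτρ : ∀ x ∈ X, τ x = .var (ρ x))
    (hτ : ∀ y ∈ S.fv φ, y ∉ X → τ y = σ y) (hψ : ∀ x ∈ X, ρ x ∉ S.fv ψ)
    (hσ : ∀ x ∈ X, ∀ y ∈ S.fv φ, y ∉ X → ρ x ∉ (σ y).varFinset)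
    (h : S.le (S.subst τ φ) ψ) : S.le (S.subst σ (S.qVars X φ)) ψ :=
  S.qList_le _ (X.sort_nodup _) φ ψ σ τ ρ (by simpa using hρ) (by simpa using hτρ)
    (by simpa using hτ) (by simpa using hψ) (by simpa using hσ) h

theorem le_qVars (X : Finset ℕ) (φ : F) (τ : ℕ → L.Term ℕ)
    (h : ∀ y ∈ S.fv φ, y ∉ X → τ y = .var y) : S.le (S.subst τ φ) (S.qVars X φ) := by
  simpa only [S.subst_var] using S.le_qVars_subst X φ .var τ h

theorem le_qVars_self (X : Finset ℕ) (φ : F) : S.le φ (S.qVars X φ) := by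
  simpa only [S.subst_var] using S.le_qVars X φ .var fun _ _ _ => rfl

theorem qVars_le {X : Finset ℕ} {φ ψ : F} (hψ : ∀ x ∈ X, x ∉ S.fv ψ) (h : S.le φ ψ) :
    S.le (S.qVars X φ) ψ := by
  rw [← S.subst_var (S.qVars X φ)]
  refine S.qVars_subst_le X φ ψ .var .var id (Set.injOn_id _) (fun _ _ => rfl)
    (fun _ _ _ => rfl) hψ (fun x hx y _ hy => ?_) (by rwa [S.subst_var])
  rw [Term.mem_varFinset_var]
  rintro rfl
  exact hy hx

end QuantLogic

/-! ### Entailment over a closed theory and named quantifiers in intuitionistic logic -/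

namespace Formula

variable {L : FirstOrder.Language.{u, v}}

theorem subst_eq_self {σ : ℕ → L.Term ℕ} {φ : Formula L} (h : ∀ x ∈ φ.fv, σ x = .var x) :
    φ.subst σ = φ :=
  (subst_congr φ h).trans (subst_var φ)

theorem image_subst_eq_self {Γ : Set (Formula L)} (hΓ : ∀ γ ∈ Γ, γ.fv = ∅) (σ : ℕ → L.Term ℕ) :
    Formula.subst σ '' Γ = Γ := by
  have h : Set.EqOn (Formula.subst σ) id Γ := fun γ hγ => subst_eq_self (by simp [hΓ γ hγ])
  rw [h.image_eq, Set.image_id]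

/-- Provability of an implication from `Γ`. -/
def Entails (Γ : Set (Formula L)) (φ ψ : Formula L) : Prop := Provable Γ (.imp φ ψ)

namespace Entails

variable {Γ : Set (Formula L)} {φ ψ χ : Formula L}

theorem elim (h : Entails Γ φ ψ) : Provable (insert φ Γ) ψ :=
  .impE (Provable.mono h (Set.subset_insert _ _)) (.hyp (Set.mem_insert _ _))

theorem refl (φ : Formula L) : Entails Γ φ φ := .impI (.hyp (Set.mem_insert _ _))

theorem trans (h : Entails Γ φ ψ) (h' : Entails Γ ψ χ) : Entails Γ φ χ :=
  .impI (.impE (Provable.mono h' (Set.subset_insert _ _)) h.elim)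

theorem of_provable (h : Provable Γ ψ) : Entails Γ φ ψ := .impI (h.mono (Set.subset_insert _ _))

theorem le_top : Entails Γ φ .top := .impI .topI

theorem and_left : Entails Γ (.and φ ψ) φ := .impI (.andE₁ (.hyp (Set.mem_insert _ _)))

theorem and_right : Entails Γ (.and φ ψ) ψ := .impI (.andE₂ (.hyp (Set.mem_insert _ _)))

theorem le_and (h : Entails Γ φ ψ) (h' : Entails Γ φ χ) : Entails Γ φ (.and ψ χ) :=
  .impI (.andI h.elim h'.elim)

theorem le_imp (h : Entails Γ (.and φ ψ) χ) : Entails Γ φ (.imp ψ χ) :=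
  .impI (.impI (.impE (h.mono ((Set.subset_insert _ _).trans (Set.subset_insert _ _)))
    (.andI (.hyp (Set.mem_insert_of_mem _ (Set.mem_insert _ _))) (.hyp (Set.mem_insert _ _)))))

theorem and_le_of_le_imp (h : Entails Γ φ (.imp ψ χ)) : Entails Γ (.and φ ψ) χ :=
  .impI (.impE (and_left.trans h).elim and_right.elim)

theorem subst (hΓ : ∀ γ ∈ Γ, γ.fv = ∅) (σ : ℕ → L.Term ℕ) (h : Entails Γ φ ψ) :
    Entails Γ (φ.subst σ) (ψ.subst σ) := by
  have h := Provable.subst h σ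
  rwa [image_subst_eq_self hΓ] at h

end Entails

/-- Existential quantification over the theory `Γ`. -/
def exLogic (Γ : Set (Formula L)) (hΓ : ∀ γ ∈ Γ, γ.fv = ∅) : QuantLogic L (Formula L) where
  subst := Formula.subst
  fv := fv
  q := .ex
  le := Entails Γ
  subst_subst := Formula.subst_subst
  subst_congr _ _ φ h := Formula.subst_congr φ h
  subst_var := Formula.subst_var
  mem_fv_subst _ _ _ h := Formula.mem_fv_subst h
  subst_q _ _ := rfl
  mem_fv_q _ _ := mem_image_pred_erase
  refl := .refl
  trans _ _ _ := .trans
  le_subst σ _ _ h := h.subst hΓ σ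
  intro _ t := .impI (.exI t (.hyp (Set.mem_insert _ _)))
  elim φ ψ h := by
    refine .impI (.exE (.hyp (Set.mem_insert _ _)) (h.elim.mono (Set.insert_subset_insert ?_)))
    -- A closed theory is fixed by the shift, so the eigenvariable condition restricts only the
    -- conclusion.
    have e := image_subst_eq_self hΓ (renameSubst Nat.succ)
    calc Γ = shift '' Γ := e.symm
      _ ⊆ _ := Set.image_mono (Set.subset_insert _ _)

/-- Universal quantification over the theory `Γ`, with respect to the reversed order. -/
def allLogic (Γ : Set (Formula L)) (hΓ : ∀ γ ∈ Γ, γ.fv = ∅) : QuantLogic L (Formula L) where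
  subst := Formula.subst
  fv := fv
  q := .all
  le φ ψ := Entails Γ ψ φ
  subst_subst := Formula.subst_subst
  subst_congr _ _ φ h := Formula.subst_congr φ h
  subst_var := Formula.subst_var
  mem_fv_subst _ _ _ h := Formula.mem_fv_subst h
  subst_q _ _ := rfl
  mem_fv_q _ _ := mem_image_pred_erase
  refl := .refl
  trans _ _ _ h h' := h'.trans h
  le_subst σ _ _ h := h.subst hΓ σ
  intro _ t := .impI (.allE t (.hyp (Set.mem_insert _ _)))
  elim φ ψ h := by
    refine .impI (.allI ?_)
    rw [Set.image_insert_eq]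
    have e : shift '' Γ = Γ := image_subst_eq_self hΓ (renameSubst Nat.succ)
    rw [e]
    exact Entails.elim h

theorem fv_univClosure (φ : Formula L) : φ.univClosure.fv = ∅ := by
  refine Finset.eq_empty_of_forall_notMem fun y hy => ?_
  -- Free variables do not depend on the theory; the empty one serves.
  have h := (allLogic (L := L) ∅ (by simp)).mem_fv_qVars (X := φ.fv) (φ := φ) hy
  exact h.2 h.1

theorem mem_fv_exVars {X : Finset ℕ} {φ : Formula L} {y : ℕ} (h : y ∈ (exVars X φ).fv) :
    y ∈ φ.fv ∧ y ∉ X :=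
  (exLogic (L := L) ∅ (by simp)).mem_fv_qVars h

section

variable {Γ : Set (Formula L)} (hΓ : ∀ γ ∈ Γ, γ.fv = ∅)
include hΓ

theorem Entails.univClosure_le (φ : Formula L) (τ : ℕ → L.Term ℕ) :
    Entails Γ φ.univClosure (φ.subst τ) :=
  (allLogic Γ hΓ).le_qVars φ.fv φ τ fun _ hy hy' => absurd hy hy'

theorem Entails.le_exVars_subst {X : Finset ℕ} {φ : Formula L} {σ τ : ℕ → L.Term ℕ}
    (h : ∀ y ∈ φ.fv, y ∉ X → τ y = σ y) : Entails Γ (φ.subst τ) ((exVars X φ).subst σ) :=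
  (exLogic Γ hΓ).le_qVars_subst X φ σ τ h

theorem Entails.exVars_subst_le {X : Finset ℕ} {φ ψ : Formula L} {σ τ : ℕ → L.Term ℕ} {ρ : ℕ → ℕ}
    (hρ : Set.InjOn ρ X) (hτρ : ∀ x ∈ X, τ x = .var (ρ x))
    (hτ : ∀ y ∈ φ.fv, y ∉ X → τ y = σ y) (hψ : ∀ x ∈ X, ρ x ∉ ψ.fv)
    (hσ : ∀ x ∈ X, ∀ y ∈ φ.fv, y ∉ X → ρ x ∉ (σ y).varFinset)
    (h : Entails Γ (φ.subst τ) ψ) : Entails Γ ((exVars X φ).subst σ) ψ :=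
  (exLogic Γ hΓ).qVars_subst_le X φ ψ σ τ ρ hρ hτρ hτ hψ hσ h

theorem Entails.le_exVars {X : Finset ℕ} {φ : Formula L} (τ : ℕ → L.Term ℕ)
    (h : ∀ y ∈ φ.fv, y ∉ X → τ y = .var y) : Entails Γ (φ.subst τ) (exVars X φ) :=
  (exLogic Γ hΓ).le_qVars X φ τ h

theorem Entails.le_exVars_self (X : Finset ℕ) (φ : Formula L) : Entails Γ φ (exVars X φ) :=
  (exLogic Γ hΓ).le_qVars_self X φ

theorem Entails.exVars_le {X : Finset ℕ} {φ ψ : Formula L} (hψ : ∀ x ∈ X, x ∉ ψ.fv)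
    (h : Entails Γ φ ψ) : Entails Γ (exVars X φ) ψ :=
  (exLogic Γ hΓ).qVars_le hψ h

end

end Formula

section

variable {L : FirstOrder.Language.{u, v}}

theorem CTAxiom.closed (CT : Set (CTAxiom L)) : ∀ γ ∈ CTAxiom.toFormula '' CT, γ.fv = ∅ := by
  rintro _ ⟨α, _, rfl⟩
  exact Formula.fv_univClosure _

end

/-! ### Entailment over a theory of closed banged formulas and named quantifiers in linear logic -/

namespace LFormula

variable {L : FirstOrder.Language.{u, v}} {K : ℕ → Type w}

theorem subst_eq_self {σ : ℕ → L.Term ℕ} {φ : LFormula L K} (h : ∀ x ∈ φ.fv, σ x = .var x) :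
    φ.subst σ = φ :=
  (subst_congr φ h).trans (subst_var φ)

theorem map_subst_eq_self {Γ : Multiset (LFormula L K)} (hΓ : ∀ γ ∈ Γ, γ.fv = ∅)
    (σ : ℕ → L.Term ℕ) : Γ.map (subst σ) = Γ :=
  (Multiset.map_congr rfl fun γ hγ => subst_eq_self (by simp [hΓ γ hγ])).trans (Multiset.map_id Γ)

/-- A set of closed formulas that start with `!`. -/
def IsTheory (Θ : Set (LFormula L K)) : Prop := ∀ γ ∈ Θ, γ.fv = ∅ ∧ ∃ α, γ = .bang α

theorem Provable.weaken {Θ : Set (LFormula L K)} (hΘ : IsTheory Θ) {Γ Δ : Multiset (LFormula L K)}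
    {α : LFormula L K} (hΔ : ∀ γ ∈ Δ, γ ∈ Θ) (h : Provable Γ α) : Provable (Γ + Δ) α := by
  induction Δ using Multiset.induction with
  | empty => simpa using h
  | cons γ Δ ih =>
    obtain ⟨_, β, rfl⟩ := hΘ γ (hΔ γ (Multiset.mem_cons_self _ _))
    rw [Multiset.add_cons]
    exact .weakening (ih fun γ' h' => hΔ γ' (Multiset.mem_cons_of_mem h'))

/-- Provability from one formula and the theory `Θ`. -/
def Entails (Θ : Set (LFormula L K)) (α β : LFormula L K) : Prop :=
  ∃ Γ : Multiset (LFormula L K), (∀ γ ∈ Γ, γ ∈ Θ) ∧ Provable (α ::ₘ Γ) β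

namespace Entails

variable {Θ : Set (LFormula L K)} {α β γ δ : LFormula L K}

theorem of_provable (h : Provable {α} β) : Entails Θ α β := ⟨0, by simp, h⟩

theorem refl (α : LFormula L K) : Entails Θ α α := of_provable (.identity α)

theorem trans (h : Entails Θ α β) (h' : Entails Θ β γ) : Entails Θ α γ := by
  obtain ⟨Γ, hΓ, h⟩ := h
  obtain ⟨Δ, hΔ, h'⟩ := h'
  refine ⟨Γ + Δ, fun x hx => (Multiset.mem_add.1 hx).elim (hΓ x) (hΔ x), ?_⟩
  rw [← Multiset.cons_add]
  exact .cut h h'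

theorem tensor_mono (h : Entails Θ α β) (h' : Entails Θ γ δ) :
    Entails Θ (.tensor α γ) (.tensor β δ) := by
  obtain ⟨Γ, hΓ, h⟩ := h
  obtain ⟨Δ, hΔ, h'⟩ := h'
  refine ⟨Γ + Δ, fun x hx => (Multiset.mem_add.1 hx).elim (hΓ x) (hΔ x), .tensorL ?_⟩
  have := Provable.tensorR h h'
  simpa only [Multiset.cons_add, Multiset.add_cons, Multiset.cons_swap] using this

theorem tensor_comm : Entails Θ (.tensor α β) (.tensor β α) := by
  refine of_provable (.tensorL ?_)
  have := Provable.tensorR (.identity β) (.identity α)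
  rwa [add_comm] at this

theorem tensor_assoc : Entails Θ (.tensor (.tensor α β) γ) (.tensor α (.tensor β γ)) := by
  refine of_provable (.tensorL (.tensorL ?_))
  exact .tensorR (.identity α) (.tensorR (.identity β) (.identity γ))

theorem tensor_assoc' : Entails Θ (.tensor α (.tensor β γ)) (.tensor (.tensor α β) γ) := by
  refine of_provable (.tensorL ?_)
  have h := Provable.tensorR (.tensorR (.identity α) (.identity β)) (.identity γ)
  have e : α ::ₘ {β.tensor γ} = β.tensor γ ::ₘ {α} := Multiset.pair_comm _ _
  have e' : ({α} + {β} + {γ} : Multiset (LFormula L K)) = β ::ₘ γ ::ₘ {α} := by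
    rw [← Multiset.singleton_add, ← Multiset.singleton_add]
    abel
  change Provable (α ::ₘ {β.tensor γ}) _
  rw [e]
  exact .tensorL (e' ▸ h)

theorem one_tensor : Entails Θ (.tensor .one α) α := of_provable (.tensorL (.oneL (.identity α)))

theorem one_tensor' : Entails Θ α (.tensor .one α) :=
  of_provable (by simpa using Provable.tensorR .oneR (.identity α))

theorem le_lolli (h : Entails Θ (.tensor α β) γ) : Entails Θ α (.lolli β γ) := by
  obtain ⟨Γ, hΓ, h⟩ := h
  refine ⟨Γ, hΓ, .lolliR ?_⟩
  have := Provable.cut (.tensorR (.identity α) (.identity β)) h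
  rw [Multiset.cons_swap]
  simpa only [Multiset.cons_add, Multiset.singleton_add] using this

theorem tensor_le (h : Entails Θ α (.lolli β γ)) : Entails Θ (.tensor α β) γ := by
  obtain ⟨Γ, hΓ, h⟩ := h
  refine ⟨Γ, hΓ, .tensorL ?_⟩
  have := Provable.cut h (.lolliL (.identity β) (.identity γ))
  rw [Multiset.cons_swap]
  simpa only [Multiset.cons_add, Multiset.add_cons, add_zero, Multiset.add_zero,
    ← Multiset.cons_zero, Multiset.cons_swap] using this

theorem zero_le : Entails Θ .zero α := of_provable .zeroL

theorem tensor_zero_le : Entails Θ (.tensor α .zero) β := tensor_comm.trans (tensor_le zero_le)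

theorem le_plus_left : Entails Θ α (.plus α β) := of_provable (.plusR₁ (.identity α))

theorem le_plus_right : Entails Θ β (.plus α β) := of_provable (.plusR₂ (.identity β))

theorem bang_le_one : Entails Θ (.bang α) .one := of_provable (.weakening .oneR)

theorem bang_dup : Entails Θ (.bang α) (.tensor (.bang α) (.bang α)) :=
  of_provable (.contraction (.tensorR (.identity _) (.identity _)))

/-- The rule for $\oplus$ wants the same context in both premises. Each derivation is weakened by
the axioms that the other one uses, which is possible because they start with `!`. -/
theorem plus_le (hΘ : IsTheory Θ) (h : Entails Θ α γ) (h' : Entails Θ β γ) :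
    Entails Θ (.plus α β) γ := by
  obtain ⟨Γ, hΓ, h⟩ := h
  obtain ⟨Δ, hΔ, h'⟩ := h'
  refine ⟨Γ + Δ, fun x hx => (Multiset.mem_add.1 hx).elim (hΓ x) (hΔ x), .plusL ?_ ?_⟩
  · rw [← Multiset.cons_add]
    exact h.weaken hΘ hΔ
  · rw [add_comm, ← Multiset.cons_add]
    exact h'.weaken hΘ hΓ

theorem plus_mono (hΘ : IsTheory Θ) (h : Entails Θ α γ) (h' : Entails Θ β δ) :
    Entails Θ (.plus α β) (.plus γ δ) :=
  plus_le hΘ (h.trans le_plus_left) (h'.trans le_plus_right)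

theorem subst (hΘ : IsTheory Θ) (σ : ℕ → L.Term ℕ) (h : Entails Θ α β) :
    Entails Θ (α.subst σ) (β.subst σ) := by
  obtain ⟨Γ, hΓ, h⟩ := h
  refine ⟨Γ, hΓ, ?_⟩
  have h := h.subst σ
  rwa [Multiset.map_cons, map_subst_eq_self fun γ hγ => (hΘ γ (hΓ γ hγ)).1] at h

end Entails

theorem map_shift_eq_self {Θ : Set (LFormula L K)} (hΘ : IsTheory Θ) {Γ : Multiset (LFormula L K)}
    (hΓ : ∀ γ ∈ Γ, γ ∈ Θ) : Γ.map shift = Γ :=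
  map_subst_eq_self (fun γ hγ => (hΘ γ (hΓ γ hγ)).1) _

/-- Existential quantification over the theory `Θ`. -/
def exLogic (Θ : Set (LFormula L K)) (hΘ : IsTheory Θ) : QuantLogic L (LFormula L K) where
  subst := LFormula.subst
  fv := fv
  q := .ex
  le := Entails Θ
  subst_subst := LFormula.subst_subst
  subst_congr _ _ φ h := LFormula.subst_congr φ h
  subst_var := LFormula.subst_var
  mem_fv_subst _ _ _ h := LFormula.mem_fv_subst h
  subst_q _ _ := rfl
  mem_fv_q _ _ := mem_image_pred_erase
  refl := .refl
  trans _ _ _ := .trans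
  le_subst σ _ _ h := h.subst hΘ σ
  intro _ t := .of_provable (.exR t (.identity _))
  elim φ ψ h := by
    obtain ⟨Γ, hΓ, h⟩ := h
    refine ⟨Γ, hΓ, .exL ?_⟩
    rwa [map_shift_eq_self hΘ hΓ]

/-- Universal quantification over the theory `Θ`, with respect to the reversed order. -/
def allLogic (Θ : Set (LFormula L K)) (hΘ : IsTheory Θ) : QuantLogic L (LFormula L K) where
  subst := LFormula.subst
  fv := fv
  q := .all
  le α β := Entails Θ β α
  subst_subst := LFormula.subst_subst
  subst_congr _ _ φ h := LFormula.subst_congr φ h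
  subst_var := LFormula.subst_var
  mem_fv_subst _ _ _ h := LFormula.mem_fv_subst h
  subst_q _ _ := rfl
  mem_fv_q _ _ := mem_image_pred_erase
  refl := .refl
  trans _ _ _ h h' := h'.trans h
  le_subst σ _ _ h := h.subst hΘ σ
  intro _ t := .of_provable (.allL t (.identity _))
  elim φ ψ h := by
    obtain ⟨Γ, hΓ, h⟩ := h
    refine ⟨Γ, hΓ, .allR ?_⟩
    rwa [Multiset.map_cons, map_shift_eq_self hΘ hΓ]

theorem isTheory_empty : IsTheory (∅ : Set (LFormula L K)) := fun _ h => h.elim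

theorem fv_univClosure (α : LFormula L K) : α.univClosure.fv = ∅ := by
  refine Finset.eq_empty_of_forall_notMem fun y hy => ?_
  have h := (allLogic (L := L) (K := K) ∅ isTheory_empty).mem_fv_qVars (X := α.fv) (φ := α) hy
  exact h.2 h.1

theorem mem_fv_exVars {X : Finset ℕ} {α : LFormula L K} {y : ℕ} (h : y ∈ (exVars X α).fv) :
    y ∈ α.fv ∧ y ∉ X :=
  (exLogic (L := L) (K := K) ∅ isTheory_empty).mem_fv_qVars h

section

variable {Θ : Set (LFormula L K)} (hΘ : IsTheory Θ)
include hΘ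

theorem Entails.univClosure_le (α : LFormula L K) (τ : ℕ → L.Term ℕ) :
    Entails Θ α.univClosure (α.subst τ) :=
  (allLogic Θ hΘ).le_qVars α.fv α τ fun _ hy hy' => absurd hy hy'

theorem Entails.le_univClosure {α β : LFormula L K} (hβ : β.fv = ∅) (h : Entails Θ β α) :
    Entails Θ β α.univClosure :=
  (allLogic Θ hΘ).qVars_le (fun x _ => by simp [allLogic, hβ]) h

theorem Entails.exVars_subst_le {X : Finset ℕ} {α β : LFormula L K} {σ τ : ℕ → L.Term ℕ}
    {ρ : ℕ → ℕ}
    (hρ : Set.InjOn ρ X) (hτρ : ∀ x ∈ X, τ x = .var (ρ x))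
    (hτ : ∀ y ∈ α.fv, y ∉ X → τ y = σ y) (hβ : ∀ x ∈ X, ρ x ∉ β.fv)
    (hσ : ∀ x ∈ X, ∀ y ∈ α.fv, y ∉ X → ρ x ∉ (σ y).varFinset)
    (h : Entails Θ (α.subst τ) β) : Entails Θ ((exVars X α).subst σ) β :=
  (exLogic Θ hΘ).qVars_subst_le X α β σ τ ρ hρ hτρ hτ hβ hσ h

theorem Entails.le_exVars_self (X : Finset ℕ) (α : LFormula L K) : Entails Θ α (exVars X α) :=
  (exLogic Θ hΘ).le_qVars_self X α

theorem Entails.exVars_le {X : Finset ℕ} {α β : LFormula L K} (hβ : ∀ x ∈ X, x ∉ β.fv)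
    (h : Entails Θ α β) : Entails Θ (exVars X α) β :=
  (exLogic Θ hΘ).qVars_le hβ h

end

end LFormula

open scoped Pointwise

/-! ### Phase semantics -/

/-- A phase space with an interpretation of the atoms by elements of the monoid. -/
structure PhaseModel (L : FirstOrder.Language.{u, v}) (K : ℕ → Type w) (M : Type*) where
  pole : Set M
  user : ∀ {n : ℕ}, K n → (Fin n → L.Term ℕ) → M
  eq : L.Term ℕ → L.Term ℕ → M
  rel : ∀ {n : ℕ}, L.Relations n → (Fin n → L.Term ℕ) → M

/-- The valuation that sends `0` to `t` and `x + 1` to `σ x`. -/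
def consVal {L : FirstOrder.Language.{u, v}} (t : L.Term ℕ) (σ : ℕ → L.Term ℕ) : ℕ → L.Term ℕ
  | 0 => t
  | x + 1 => σ x

theorem subst_up_consVal {L : FirstOrder.Language.{u, v}} (t : L.Term ℕ) (σ τ : ℕ → L.Term ℕ) :
    (fun x => (up τ x).subst (consVal t σ)) = consVal t fun x => (τ x).subst σ := by
  funext x
  cases x with
  | zero => rfl
  | succ x =>
    simp only [up, Term.relabel_eq_subst, Term.subst_subst, consVal]
    rfl

namespace PhaseModel

variable {L : FirstOrder.Language.{u, v}} {K : ℕ → Type w} {M : Type*} [AddCommMonoid M]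
  (𝓜 : PhaseModel L K M)

/-- Orthogonal of a set. -/
def neg (X : Set M) : Set M := {m | ∀ x ∈ X, m + x ∈ 𝓜.pole}

/-- The least fact that includes a set. -/
def cl (X : Set M) : Set M := 𝓜.neg (𝓜.neg X)

/-- Facts are closed sets. -/
def IsFact (X : Set M) : Prop := 𝓜.cl X ⊆ X

variable {𝓜}

theorem subset_cl (X : Set M) : X ⊆ 𝓜.cl X := fun x hx n hn => by
  rw [add_comm]
  exact hn x hx

/-- A fact is tested against its orthogonal. If every `x + y` passes the test `n`, then `y + n` is
orthogonal to `X`, hence to every element of the closure of `X`. All left rules below are reduced to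
generators in this way, with `y` in the role of the context. -/
theorem cl_induction {X F : Set M} (hF : 𝓜.IsFact F) {m y : M} (hm : m ∈ 𝓜.cl X)
    (h : ∀ x ∈ X, x + y ∈ F) : m + y ∈ F := by
  refine hF fun n hn => ?_
  rw [add_assoc]
  refine hm _ fun x hx => ?_
  convert hn _ (h x hx) using 1
  abel

theorem cl_subset {X F : Set M} (hF : 𝓜.IsFact F) (h : X ⊆ F) : 𝓜.cl X ⊆ F := fun m hm => by
  have := cl_induction hF hm (y := 0) fun x hx => by simpa using h hx
  rwa [add_zero] at this

theorem isFact_neg (X : Set M) : 𝓜.IsFact (𝓜.neg X) := fun m hm x hx => by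
  refine hm x fun n hn => ?_
  rw [add_comm]
  exact hn x hx

theorem isFact_cl (X : Set M) : 𝓜.IsFact (𝓜.cl X) := isFact_neg _

theorem isFact_pole : 𝓜.IsFact 𝓜.pole := fun m hm => by
  have := hm 0 (fun n hn => by simpa using hn)
  rwa [add_zero] at this

theorem isFact_univ : 𝓜.IsFact Set.univ := fun _ _ => trivial

theorem IsFact.inter {X Y : Set M} (hX : 𝓜.IsFact X) (hY : 𝓜.IsFact Y) : 𝓜.IsFact (X ∩ Y) :=
  fun _ hm => ⟨cl_subset hX Set.inter_subset_left hm, cl_subset hY Set.inter_subset_right hm⟩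

theorem isFact_iInter {ι : Sort*} {X : ι → Set M} (hX : ∀ i, 𝓜.IsFact (X i)) :
    𝓜.IsFact (⋂ i, X i) := fun _ hm =>
  Set.mem_iInter.2 fun i => cl_subset (hX i) (Set.iInter_subset _ i) hm

theorem isFact_lolli {X Y : Set M} (hY : 𝓜.IsFact Y) :
    𝓜.IsFact {m | ∀ x ∈ X, m + x ∈ Y} := fun _ hm x hx =>
  cl_induction hY hm fun _ hn => hn x hx

variable (𝓜)

/-- The elements that may be dropped and duplicated. -/
def free : Set M :=
  {m | (∀ n ∈ 𝓜.pole, m + n ∈ 𝓜.pole) ∧ ∀ n, m + m + n ∈ 𝓜.pole → m + n ∈ 𝓜.pole}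

/-- The interpretation of a formula under a valuation. -/
def sem : LFormula L K → (ℕ → L.Term ℕ) → Set M
  | .user c ts, σ => 𝓜.cl {𝓜.user c fun i => (ts i).subst σ}
  | .eq t s, σ => 𝓜.cl {𝓜.eq (t.subst σ) (s.subst σ)}
  | .rel R ts, σ => 𝓜.cl {𝓜.rel R fun i => (ts i).subst σ}
  | .one, _ => 𝓜.cl {0}
  | .zero, _ => 𝓜.cl ∅
  | .top, _ => Set.univ
  | .tensor α β, σ => 𝓜.cl (sem α σ + sem β σ)
  | .plus α β, σ => 𝓜.cl (sem α σ ∪ sem β σ)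
  | .with α β, σ => sem α σ ∩ sem β σ
  | .lolli α β, σ => {m | ∀ x ∈ sem α σ, m + x ∈ sem β σ}
  -- Elements of `free` satisfy weakening and contraction only as seen by the pole, not as
  -- identities in the monoid. This suffices, since facts are determined by the pole.
  | .bang α, σ => 𝓜.cl (sem α σ ∩ 𝓜.free)
  | .all α, σ => ⋂ t, sem α (consVal t σ)
  | .ex α, σ => 𝓜.cl (⋃ t, sem α (consVal t σ))

variable {𝓜}

theorem zero_mem_free : (0 : M) ∈ 𝓜.free := ⟨fun n hn => by rwa [zero_add], fun n hn => by
  simpa using hn⟩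

theorem add_mem_free {m n : M} (hm : m ∈ 𝓜.free) (hn : n ∈ 𝓜.free) : m + n ∈ 𝓜.free := by
  refine ⟨fun p hp => ?_, fun p hp => ?_⟩
  · rw [add_assoc]
    exact hm.1 _ (hn.1 _ hp)
  · have h1 : m + m + (n + n + p) ∈ 𝓜.pole := by
      convert hp using 1
      abel
    have h2 : n + n + (m + p) ∈ 𝓜.pole := by
      convert hm.2 _ h1 using 1
      abel
    convert hn.2 _ h2 using 1
    abel

/-- A fact is an intersection of translates of the pole, so the property passes from the pole to
every fact. -/
theorem add_mem_of_mem_free {F : Set M} (hF : 𝓜.IsFact F) {m n : M} (hm : m ∈ 𝓜.free)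
    (hn : n ∈ F) : m + n ∈ F := hF fun k hk => by
  rw [add_assoc]
  refine hm.1 _ ?_
  rw [add_comm]
  exact hk n hn

theorem add_mem_of_add_add_mem {F : Set M} (hF : 𝓜.IsFact F) {m n : M} (hm : m ∈ 𝓜.free)
    (hn : m + m + n ∈ F) : m + n ∈ F := hF fun k hk => by
  rw [add_assoc]
  refine hm.2 _ ?_
  rw [← add_assoc, add_comm]
  exact hk _ hn

theorem isFact_sem (α : LFormula L K) (σ : ℕ → L.Term ℕ) : 𝓜.IsFact (𝓜.sem α σ) := by
  induction α generalizing σ with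
  | user | eq | rel | one | zero | tensor | plus | bang | ex => exact isFact_cl _
  | top => exact isFact_univ
  | lolli α β _ h => exact isFact_lolli (h σ)
  | all α h => exact isFact_iInter fun t => h _
  | _ => rename_i h1 h2; exact (h1 σ).inter (h2 σ)

theorem sem_subst (α : LFormula L K) (σ τ : ℕ → L.Term ℕ) :
    𝓜.sem (α.subst τ) σ = 𝓜.sem α fun x => (τ x).subst σ := by
  induction α generalizing σ τ with
  | user | eq | rel => simp only [sem, LFormula.subst, Term.subst_subst]
  | one | zero | top => rfl
  | bang α h => simp only [sem, LFormula.subst, h]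
  | all α h | ex α h => simp only [sem, LFormula.subst, h, subst_up_consVal]
  | _ => rename_i h1 h2; simp only [sem, LFormula.subst, h1, h2]

theorem sem_shift (α : LFormula L K) (σ : ℕ → L.Term ℕ) (t : L.Term ℕ) :
    𝓜.sem α.shift (consVal t σ) = 𝓜.sem α σ := by
  rw [LFormula.shift, sem_subst]
  rfl

theorem sem_inst (α : LFormula L K) (σ : ℕ → L.Term ℕ) (t : L.Term ℕ) :
    𝓜.sem (α.inst t) σ = 𝓜.sem α (consVal (t.subst σ) σ) := by
  rw [LFormula.inst, sem_subst]
  congr 1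
  funext x
  cases x <;> rfl

variable (𝓜)

/-- The interpretation of a multiset of formulas as a tensor product. -/
def semCtx (Γ : Multiset (LFormula L K)) (σ : ℕ → L.Term ℕ) : Set M :=
  (Γ.map fun α => 𝓜.sem α σ).sum

variable {𝓜}

theorem semCtx_cons (α : LFormula L K) (Γ : Multiset (LFormula L K)) (σ : ℕ → L.Term ℕ) :
    𝓜.semCtx (α ::ₘ Γ) σ = 𝓜.sem α σ + 𝓜.semCtx Γ σ := by
  simp [semCtx]

theorem semCtx_add (Γ Δ : Multiset (LFormula L K)) (σ : ℕ → L.Term ℕ) :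
    𝓜.semCtx (Γ + Δ) σ = 𝓜.semCtx Γ σ + 𝓜.semCtx Δ σ := by
  simp [semCtx]

theorem semCtx_map_shift (Γ : Multiset (LFormula L K)) (σ : ℕ → L.Term ℕ) (t : L.Term ℕ) :
    𝓜.semCtx (Γ.map .shift) (consVal t σ) = 𝓜.semCtx Γ σ := by
  simp only [semCtx, Multiset.map_map, Function.comp_def, sem_shift]

theorem semCtx_cons_subset {α : LFormula L K} {Γ : Multiset (LFormula L K)} {σ : ℕ → L.Term ℕ}
    {F : Set M} : 𝓜.semCtx (α ::ₘ Γ) σ ⊆ F ↔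
      ∀ a ∈ 𝓜.sem α σ, ∀ g ∈ 𝓜.semCtx Γ σ, a + g ∈ F := by
  rw [semCtx_cons, Set.add_subset_iff]

/-- Semantic content of promotion. Each `!γ` is generated by free elements, and sums of free
elements are free; `cl_induction` replaces the summands by such generators one at a time. -/
theorem semCtx_map_bang_subset (Γ : Multiset (LFormula L K)) (σ : ℕ → L.Term ℕ) {F : Set M}
    (hF : 𝓜.IsFact F) (h : ∀ m ∈ 𝓜.semCtx (Γ.map .bang) σ, m ∈ 𝓜.free → m ∈ F) :
    𝓜.semCtx (Γ.map .bang) σ ⊆ F := by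
  -- The set `Δ` holds the generators already chosen while the induction runs through the rest of
  -- `Γ`.
  suffices H : ∀ (Δ : Set M), (∀ m ∈ 𝓜.semCtx (Γ.map .bang) σ, ∀ d ∈ Δ, m ∈ 𝓜.free → m + d ∈ F) →
      𝓜.semCtx (Γ.map .bang) σ + Δ ⊆ F by
    simpa using H {0} (by simpa using h)
  clear h
  induction Γ using Multiset.induction with
  | empty =>
    intro Δ h
    simp only [semCtx, Multiset.map_zero, Multiset.sum_zero, zero_add]
    intro d hd
    have := h 0 (by simp [semCtx]) d hd zero_mem_free
    rwa [zero_add] at this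
  | cons γ Γ ih =>
    intro Δ h
    rw [Multiset.map_cons, semCtx_cons, add_assoc, Set.add_subset_iff]
    intro m hm d hd
    refine cl_induction hF hm fun x hx => ?_
    obtain ⟨g, hg, d, hd, rfl⟩ := hd
    change x + (g + d) ∈ F
    rw [add_left_comm]
    refine ih ({x} + Δ) ?_ (Set.add_mem_add hg (Set.add_mem_add rfl hd))
    rintro m' hm' _ ⟨_, rfl, d', hd', rfl⟩ hf
    change m' + (_ + d') ∈ F
    rw [← add_assoc, add_comm m']
    refine h _ ?_ d' hd' (add_mem_free hx.2 hf)
    rw [Multiset.map_cons, semCtx_cons]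
    exact Set.add_mem_add (subset_cl _ hx) hm'

theorem soundness {Γ : Multiset (LFormula L K)} {α : LFormula L K} (h : LFormula.Provable Γ α)
    (σ : ℕ → L.Term ℕ) : 𝓜.semCtx Γ σ ⊆ 𝓜.sem α σ := by
  induction h generalizing σ with
  | identity α => simp [semCtx]
  | cut _ _ h1 h2 =>
    rw [semCtx_add, Set.add_subset_iff]
    intro x hx y hy
    exact semCtx_cons_subset.1 (h2 σ) x (h1 σ hx) y hy
  | tensorL _ ih =>
    rw [semCtx_cons_subset]
    intro a ha g hg
    refine cl_induction (isFact_sem _ σ) ha ?_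
    rintro _ ⟨x, hx, y, hy, rfl⟩
    have := ih σ
    rw [semCtx_cons, semCtx_cons, ← add_assoc] at this
    exact this (Set.add_mem_add (Set.add_mem_add hx hy) hg)
  | tensorR _ _ h1 h2 =>
    rw [semCtx_add, Set.add_subset_iff]
    intro x hx y hy
    exact subset_cl _ (Set.add_mem_add (h1 σ hx) (h2 σ hy))
  | oneL _ ih =>
    rw [semCtx_cons_subset]
    intro a ha g hg
    refine cl_induction (isFact_sem _ σ) ha ?_
    rintro _ rfl
    rw [zero_add]
    exact ih σ hg
  | oneR =>
    intro x hx
    simp only [semCtx, Multiset.map_zero, Multiset.sum_zero] at hx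
    exact subset_cl _ hx
  | lolliL _ _ h1 h2 =>
    rw [semCtx_cons_subset]
    intro f hf g hg
    rw [semCtx_add] at hg
    obtain ⟨x, hx, y, hy, rfl⟩ := hg
    change f + (x + y) ∈ _
    rw [← add_assoc]
    exact semCtx_cons_subset.1 (h2 σ) _ (hf x (h1 σ hx)) y hy
  | lolliR _ ih =>
    intro x hx a ha
    rw [add_comm]
    exact semCtx_cons_subset.1 (ih σ) a ha x hx
  | bangR _ ih =>
    exact semCtx_map_bang_subset _ σ (isFact_sem _ σ) fun m hm hf => subset_cl _ ⟨ih σ hm, hf⟩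
  | dereliction _ ih =>
    rw [semCtx_cons_subset]
    intro a ha g hg
    exact cl_induction (isFact_sem _ σ) ha fun x hx =>
      semCtx_cons_subset.1 (ih σ) x hx.1 g hg
  | contraction _ ih =>
    rw [semCtx_cons_subset]
    intro a ha g hg
    refine cl_induction (isFact_sem _ σ) ha fun x hx => ?_
    refine add_mem_of_add_add_mem (isFact_sem _ σ) hx.2 ?_
    have := ih σ
    rw [semCtx_cons, semCtx_cons, ← add_assoc] at this
    exact this (Set.add_mem_add (Set.add_mem_add (subset_cl _ hx) (subset_cl _ hx)) hg)
  | weakening _ ih =>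
    rw [semCtx_cons_subset]
    intro a ha g hg
    exact cl_induction (isFact_sem _ σ) ha fun x hx =>
      add_mem_of_mem_free (isFact_sem _ σ) hx.2 (ih σ hg)
  | withL₁ _ ih =>
    rw [semCtx_cons_subset]
    intro a ha g hg
    exact semCtx_cons_subset.1 (ih σ) a ha.1 g hg
  | withL₂ _ ih =>
    rw [semCtx_cons_subset]
    intro a ha g hg
    exact semCtx_cons_subset.1 (ih σ) a ha.2 g hg
  | withR _ _ h1 h2 => exact Set.subset_inter (h1 σ) (h2 σ)
  | topR => exact Set.subset_univ _
  | plusL _ _ h1 h2 =>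
    rw [semCtx_cons_subset]
    intro a ha g hg
    refine cl_induction (isFact_sem _ σ) ha ?_
    rintro x (hx | hx)
    · exact semCtx_cons_subset.1 (h1 σ) x hx g hg
    · exact semCtx_cons_subset.1 (h2 σ) x hx g hg
  | plusR₁ _ ih => exact (ih σ).trans (Set.subset_union_left.trans (subset_cl _))
  | plusR₂ _ ih => exact (ih σ).trans (Set.subset_union_right.trans (subset_cl _))
  | zeroL =>
    rw [← Multiset.cons_zero, semCtx_cons_subset]
    intro a ha g _
    exact cl_induction (isFact_sem _ σ) ha fun x hx => hx.elim
  | allL t _ ih =>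
    rw [semCtx_cons_subset]
    intro a ha g hg
    refine semCtx_cons_subset.1 (ih σ) a ?_ g hg
    rw [sem_inst]
    exact Set.mem_iInter.1 ha _
  | allR _ ih =>
    refine Set.subset_iInter fun t => ?_
    rw [← semCtx_map_shift _ σ t]
    exact ih _
  | exL _ ih =>
    rw [semCtx_cons_subset]
    intro a ha g hg
    refine cl_induction (isFact_sem _ σ) ha fun x hx => ?_
    obtain ⟨t, hx⟩ := Set.mem_iUnion.1 hx
    rw [← sem_shift _ σ t]
    refine semCtx_cons_subset.1 (ih _) x hx g ?_
    rwa [semCtx_map_shift]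
  | exR t _ ih =>
    intro x hx
    have := ih σ hx
    rw [sem_inst] at this
    exact subset_cl _ (Set.mem_iUnion.2 ⟨_, this⟩)

theorem sem_bind (α : LFormula L K) (σ : ℕ → L.Term ℕ) (t : L.Term ℕ) (x : ℕ) :
    𝓜.sem (α.subst (bindSubst x)) (consVal t σ) = 𝓜.sem α (Function.update σ x t) := by
  rw [sem_subst]
  congr 1
  funext y
  by_cases h : y = x
  · subst h
    simp [bindSubst, FirstOrder.Language.Term.subst, consVal]
  · simp [bindSubst, h, FirstOrder.Language.Term.subst, consVal]

theorem sem_subset_exVars {X : Finset ℕ} {α : LFormula L K} {σ τ : ℕ → L.Term ℕ}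
    (h : ∀ x ∉ X, τ x = σ x) : 𝓜.sem α τ ⊆ 𝓜.sem (.exVars X α) σ := by
  suffices H : ∀ (xs : List ℕ) (σ : ℕ → L.Term ℕ), (∀ x ∉ xs, τ x = σ x) →
      𝓜.sem α τ ⊆ 𝓜.sem (xs.foldr (fun x β => .ex (β.subst (bindSubst x))) α) σ from
    H _ σ (by simpa using h)
  intro xs
  induction xs with
  | nil =>
    intro σ h
    rw [show τ = σ from funext fun x => h x (by simp)]
    exact subset_rfl
  | cons x xs ih =>
    intro σ h m hm
    refine subset_cl _ (Set.mem_iUnion.2 ⟨τ x, ?_⟩)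
    rw [sem_bind]
    refine ih _ (fun y hy => ?_) hm
    by_cases hx : y = x
    · subst hx; simp
    · rw [Function.update_of_ne hx]
      exact h y (by simp [hx, hy])

/-- Quantifying a set of names amounts to ranging over the valuations that agree with `σ` off that
set; the nested closures are absorbed because `F` is a fact. -/
theorem sem_exVars_subset {X : Finset ℕ} {α : LFormula L K} {σ : ℕ → L.Term ℕ} {F : Set M}
    (hF : 𝓜.IsFact F) (h : ∀ τ : ℕ → L.Term ℕ, (∀ x ∉ X, τ x = σ x) → 𝓜.sem α τ ⊆ F) :
    𝓜.sem (.exVars X α) σ ⊆ F := by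
  suffices H : ∀ (xs : List ℕ) (σ : ℕ → L.Term ℕ),
      (∀ τ : ℕ → L.Term ℕ, (∀ x ∉ xs, τ x = σ x) → 𝓜.sem α τ ⊆ F) →
      𝓜.sem (xs.foldr (fun x β => .ex (β.subst (bindSubst x))) α) σ ⊆ F from
    H _ σ (by simpa using h)
  intro xs
  induction xs with
  | nil => exact fun σ h => h σ fun _ _ => rfl
  | cons x xs ih =>
    intro σ h
    refine cl_subset hF (Set.iUnion_subset fun t => ?_)
    rw [sem_bind]
    refine ih _ fun τ hτ => h τ fun y hy => ?_
    rw [List.mem_cons, not_or] at hy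
    rw [hτ y hy.2, Function.update_of_ne hy.1]

theorem mem_sem_allVars {X : Finset ℕ} {α : LFormula L K} {σ : ℕ → L.Term ℕ} {m : M} :
    m ∈ 𝓜.sem (.allVars X α) σ ↔
      ∀ τ : ℕ → L.Term ℕ, (∀ x ∉ X, τ x = σ x) → m ∈ 𝓜.sem α τ := by
  suffices H : ∀ (xs : List ℕ) (σ : ℕ → L.Term ℕ),
      m ∈ 𝓜.sem (xs.foldr (fun x β => .all (β.subst (bindSubst x))) α) σ ↔
      ∀ τ : ℕ → L.Term ℕ, (∀ x ∉ xs, τ x = σ x) → m ∈ 𝓜.sem α τ by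
    have := H (X.sort (· ≤ ·)) σ
    simp only [Finset.mem_sort] at this
    exact this
  intro xs
  induction xs with
  | nil =>
    intro σ
    refine ⟨fun h τ hτ => ?_, fun h => h σ fun _ _ => rfl⟩
    rw [show τ = σ from funext fun x => hτ x (by simp)]
    exact h
  | cons x xs ih =>
    intro σ
    change m ∈ ⋂ t, _ ↔ _
    rw [Set.mem_iInter]
    simp only [sem_bind]
    refine ⟨fun h τ hτ => (ih _).1 (h (τ x)) τ fun y hy => ?_, fun h t => (ih _).2 fun τ hτ => ?_⟩
    · by_cases hx : y = x
      · subst hx; simp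
      · rw [Function.update_of_ne hx]
        exact hτ y (by simp [hx, hy])
    · refine h τ fun y hy => ?_
      rw [List.mem_cons, not_or] at hy
      rw [hτ y hy.2, Function.update_of_ne hy.1]

end PhaseModel

/-! ### Goals modulo equivalence and multisets of constraints -/

section GoalMonoid

variable {L : FirstOrder.Language.{u, v}} {K : ℕ → Type w}

def goalSetoid (L : FirstOrder.Language.{u, v}) (K : ℕ → Type w) : Setoid (Goal L K) where
  r := GoalEquiv
  iseqv := ⟨.refl, .symm, .trans⟩

/-- Goals modulo goal equivalence. -/
def GoalClass (L : FirstOrder.Language.{u, v}) (K : ℕ → Type w) : Type (max u v w) :=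
  Quotient (goalSetoid L K)

/-- The class of a goal. -/
def Goal.cls (G : Goal L K) : GoalClass L K := Quotient.mk (goalSetoid L K) G

/-- Goals modulo equivalence form a commutative monoid under `∧`, so that rearrangements of
conjunctions can be left to `abel`. -/
instance : AddCommMonoid (GoalClass L K) where
  zero := Goal.cls .top
  add := Quotient.map₂ .and fun _ _ h _ _ h' => GoalEquiv.andCongr h h'
  add_assoc := by
    rintro ⟨a⟩ ⟨b⟩ ⟨c⟩
    exact Quotient.sound (.andAssoc a b c)
  add_comm := by
    rintro ⟨a⟩ ⟨b⟩
    exact Quotient.sound (.andComm a b)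
  zero_add := by
    rintro ⟨a⟩
    exact Quotient.sound (.topAnd a)
  add_zero := by
    rintro ⟨a⟩
    exact Quotient.sound (.trans (.andComm _ _) (.topAnd a))
  nsmul := @nsmulRec _ ⟨Goal.cls .top⟩
    ⟨Quotient.map₂ .and fun _ _ h _ _ h' => GoalEquiv.andCongr h h'⟩

theorem Goal.cls_and (G H : Goal L K) : (Goal.and G H).cls = G.cls + H.cls := rfl

theorem Goal.cls_top : (Goal.top : Goal L K).cls = 0 := rfl

theorem Goal.cls_eq_iff {G H : Goal L K} : G.cls = H.cls ↔ GoalEquiv G H := Quotient.eq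

end GoalMonoid

namespace Conj

variable {A : Type u}

/-- The atoms of a conjunction. -/
def atoms : Conj A → Multiset A
  | .top => 0
  | .atom a => {a}
  | .and C D => C.atoms + D.atoms

/-- The conjunction of a list of atoms. -/
def ofList : List A → Conj A
  | [] => .top
  | a :: l => .and (.atom a) (ofList l)

theorem atoms_ofList (l : List A) : (ofList l).atoms = l := by
  induction l with
  | nil => rfl
  | cons a l ih =>
    simp only [ofList, atoms, ih]
    rfl

/-- The conjunction of a multiset of atoms. -/
noncomputable def ofMultiset (m : Multiset A) : Conj A := ofList m.toList

@[simp]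
theorem atoms_ofMultiset (m : Multiset A) : (ofMultiset m).atoms = m := by
  rw [ofMultiset, atoms_ofList, Multiset.coe_toList]

theorem atoms_map {A' : Type v} (f : A → A') (C : Conj A) : (C.map f).atoms = C.atoms.map f := by
  induction C with
  | top => rfl
  | atom a => rfl
  | and C D h1 h2 => simp only [map, atoms, h1, h2, Multiset.map_add]

end Conj

section Atoms

variable {L : FirstOrder.Language.{u, v}} {K : ℕ → Type w}

theorem User.cls_toGoal (U : User L K) :
    (User.toGoal U).cls = (U.atoms.map fun a => (Goal.user a : Goal L K).cls).sum := by
  induction U with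
  | top => rfl
  | atom a => simp [User.toGoal, Conj.atoms]
  | and U U' h1 h2 => simp [User.toGoal, Conj.atoms, Goal.cls_and, h1, h2]

theorem BuiltIn.cls_toGoal (B : BuiltIn L) :
    (BuiltIn.toGoal K B).cls = (B.atoms.map fun b => (Goal.builtIn b : Goal L K).cls).sum := by
  induction B with
  | top => rfl
  | atom a => simp [BuiltIn.toGoal, Conj.atoms]
  | and U U' h1 h2 => simp [BuiltIn.toGoal, Conj.atoms, Goal.cls_and, h1, h2]

theorem User.mem_vars {U : User L K} {x : ℕ} : x ∈ User.vars U ↔ ∃ a ∈ U.atoms, x ∈ a.vars := by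
  induction U with
  | top => simp [User.vars, Conj.atoms]
  | atom a => simp [User.vars, Conj.atoms]
  | and U U' h1 h2 =>
    simp only [User.vars, Conj.atoms, Finset.mem_union, h1, h2, Multiset.mem_add, or_and_right,
      exists_or]

theorem BuiltIn.mem_vars {B : BuiltIn L} {x : ℕ} :
    x ∈ BuiltIn.vars B ↔ ∃ a ∈ B.atoms, x ∈ a.vars := by
  induction B with
  | top => simp [BuiltIn.vars, Conj.atoms]
  | atom a => simp [BuiltIn.vars, Conj.atoms]
  | and U U' h1 h2 =>
    simp only [BuiltIn.vars, Conj.atoms, Finset.mem_union, h1, h2, Multiset.mem_add, or_and_right,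
      exists_or]

theorem BuiltInAtom.subst_congr {σ τ : ℕ → L.Term ℕ} (b : BuiltInAtom L)
    (h : ∀ x ∈ b.vars, σ x = τ x) : b.subst σ = b.subst τ := by
  cases b with
  | bot => rfl
  | eq t s =>
    simp only [subst]
    rw [Term.subst_congr t fun x hx => h x (by simp [vars, hx]),
      Term.subst_congr s fun x hx => h x (by simp [vars, hx])]
  | rel R ts =>
    simp only [subst]
    congr 1
    funext i
    exact Term.subst_congr _ fun x hx => h x (by
      simp only [vars, Finset.mem_biUnion]; exact ⟨i, Finset.mem_univ _, hx⟩)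

theorem BuiltInAtom.subst_subst (σ τ : ℕ → L.Term ℕ) (b : BuiltInAtom L) :
    (b.subst σ).subst τ = b.subst fun x => (σ x).subst τ := by
  cases b <;> simp only [subst, Term.subst_subst]

theorem BuiltInAtom.subst_var (b : BuiltInAtom L) : b.subst FirstOrder.Language.Term.var = b := by
  cases b <;> simp only [subst, Term.subst_var]

theorem BuiltInAtom.mem_vars_subst {σ : ℕ → L.Term ℕ} {b : BuiltInAtom L} {y : ℕ} :
    y ∈ (b.subst σ).vars ↔ ∃ x ∈ b.vars, y ∈ (σ x).varFinset := by
  cases b with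
  | bot => simp [vars, subst]
  | eq t s =>
    simp only [vars, subst, Finset.mem_union, Term.mem_varFinset_subst, or_and_right, exists_or]
  | rel R ts =>
    simp only [vars, subst, Finset.mem_biUnion, Term.mem_varFinset_subst]
    exact ⟨fun ⟨i, hi, x, h⟩ => ⟨x, ⟨i, hi, h.1⟩, h.2⟩,
      fun ⟨x, ⟨i, hi, h⟩, h'⟩ => ⟨i, hi, x, h, h'⟩⟩

theorem UserAtom.subst_congr {σ τ : ℕ → L.Term ℕ} (a : UserAtom L K)
    (h : ∀ x ∈ a.vars, σ x = τ x) : a.subst σ = a.subst τ := by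
  cases a with
  | mk c ts =>
    simp only [subst]
    congr 1
    funext i
    exact Term.subst_congr _ fun x hx => h x (by
      simp only [vars, Finset.mem_biUnion]; exact ⟨i, Finset.mem_univ _, hx⟩)

theorem UserAtom.subst_subst (σ τ : ℕ → L.Term ℕ) (a : UserAtom L K) :
    (a.subst σ).subst τ = a.subst fun x => (σ x).subst τ := by
  cases a; simp only [subst, Term.subst_subst]

theorem UserAtom.subst_var (a : UserAtom L K) : a.subst FirstOrder.Language.Term.var = a := by
  cases a; simp only [subst, Term.subst_var]

theorem UserAtom.mem_vars_subst {σ : ℕ → L.Term ℕ} {a : UserAtom L K} {y : ℕ} :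
    y ∈ (a.subst σ).vars ↔ ∃ x ∈ a.vars, y ∈ (σ x).varFinset := by
  cases a with
  | mk c ts =>
    simp only [vars, subst, Finset.mem_biUnion, Term.mem_varFinset_subst]
    exact ⟨fun ⟨i, hi, x, h⟩ => ⟨x, ⟨i, hi, h.1⟩, h.2⟩,
      fun ⟨x, ⟨i, hi, h⟩, h'⟩ => ⟨i, hi, x, h, h'⟩⟩

theorem BuiltInAtom.toFormula_subst (σ : ℕ → L.Term ℕ) (b : BuiltInAtom L) :
    (b.subst σ).toFormula = b.toFormula.subst σ := by
  cases b <;> rfl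

theorem BuiltInAtom.fv_toFormula (b : BuiltInAtom L) : b.toFormula.fv = b.vars := by
  cases b <;> rfl

theorem BuiltIn.fv_toFormula (B : BuiltIn L) : (BuiltIn.toFormula B).fv = BuiltIn.vars B := by
  induction B with
  | top => rfl
  | atom b => exact b.fv_toFormula
  | and B C h1 h2 => simp only [BuiltIn.toFormula, Formula.fv, BuiltIn.vars, h1, h2]

theorem BuiltIn.toFormula_subst (σ : ℕ → L.Term ℕ) (B : BuiltIn L) :
    BuiltIn.toFormula (BuiltIn.subst σ B) = (BuiltIn.toFormula B).subst σ := by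
  induction B with
  | top => rfl
  | atom b => exact b.toFormula_subst σ
  | and B C h1 h2 =>
    simp only [BuiltIn.subst, Conj.map, BuiltIn.toFormula, Formula.subst] at h1 h2 ⊢
    rw [h1, h2]

theorem BuiltIn.atoms_subst (σ : ℕ → L.Term ℕ) (B : BuiltIn L) :
    (BuiltIn.subst σ B).atoms = B.atoms.map (BuiltInAtom.subst σ) := Conj.atoms_map _ _

theorem User.atoms_subst (σ : ℕ → L.Term ℕ) (U : User L K) :
    (User.subst σ U).atoms = U.atoms.map (UserAtom.subst σ) := Conj.atoms_map _ _

end Atoms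

/-! ### Entailment of built-in constraints modulo the constraint theory -/

section Theory

variable {L : FirstOrder.Language.{u, v}} {K : ℕ → Type w}

/-- Entailment between formulas modulo the constraint theory. -/
abbrev CTEntails (CT : Set (CTAxiom L)) : Formula L → Formula L → Prop :=
  Formula.Entails (CTAxiom.toFormula '' CT)

variable {CT : Set (CTAxiom L)}

theorem BuiltIn.le_atom {B : BuiltIn L} {b : BuiltInAtom L} (h : b ∈ B.atoms) :
    CTEntails CT (BuiltIn.toFormula B) b.toFormula := by
  induction B with
  | top => simp [Conj.atoms] at h
  | atom a =>
    simp only [Conj.atoms, Multiset.mem_singleton] at h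
    subst h
    exact .refl _
  | and B C h1 h2 =>
    rcases Multiset.mem_add.1 h with h | h
    · exact .trans .and_left (h1 h)
    · exact .trans .and_right (h2 h)

theorem BuiltIn.le_toFormula {B : BuiltIn L} {φ : Formula L}
    (h : ∀ b ∈ B.atoms, CTEntails CT φ b.toFormula) : CTEntails CT φ (BuiltIn.toFormula B) := by
  induction B with
  | top => exact .le_top
  | atom a => exact h a (by simp [Conj.atoms])
  | and B C h1 h2 =>
    exact .le_and (h1 fun b hb => h b (Multiset.mem_add.2 (.inl hb)))
      (h2 fun b hb => h b (Multiset.mem_add.2 (.inr hb)))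

/-- The formula that is the conjunction of a multiset of atomic built-in constraints. -/
noncomputable def conjFormula (B : Multiset (BuiltInAtom L)) : Formula L :=
  BuiltIn.toFormula (Conj.ofMultiset B)

theorem conjFormula_le {B : Multiset (BuiltInAtom L)} {b : BuiltInAtom L} (h : b ∈ B) :
    CTEntails CT (conjFormula B) b.toFormula :=
  BuiltIn.le_atom (by simpa using h)

theorem le_conjFormula {B : Multiset (BuiltInAtom L)} {φ : Formula L}
    (h : ∀ b ∈ B, CTEntails CT φ b.toFormula) : CTEntails CT φ (conjFormula B) :=
  BuiltIn.le_toFormula (by simpa using h)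

theorem conjFormula_mono {B C : Multiset (BuiltInAtom L)} (h : C ≤ B) :
    CTEntails CT (conjFormula B) (conjFormula C) :=
  le_conjFormula fun _ hb => conjFormula_le (Multiset.mem_of_le h hb)

theorem mem_fv_conjFormula {B : Multiset (BuiltInAtom L)} {x : ℕ} :
    x ∈ (conjFormula B).fv ↔ ∃ b ∈ B, x ∈ b.vars := by
  rw [conjFormula, BuiltIn.fv_toFormula, BuiltIn.mem_vars, Conj.atoms_ofMultiset]

theorem conjFormula_subst_le {B : Multiset (BuiltInAtom L)} (σ : ℕ → L.Term ℕ) :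
    CTEntails CT (conjFormula (B.map (BuiltInAtom.subst σ))) ((conjFormula B).subst σ) := by
  rw [conjFormula, conjFormula, ← BuiltIn.toFormula_subst]
  refine BuiltIn.le_toFormula fun b hb => conjFormula_le ?_
  rwa [BuiltIn.atoms_subst, Conj.atoms_ofMultiset] at hb

/-- The multiset of equations `x ≐ σ x` for `x ∈ X`. -/
def eqs (X : Finset ℕ) (σ : ℕ → L.Term ℕ) : Multiset (BuiltInAtom L) :=
  X.val.map fun x => .eq (.var x) (σ x)

theorem mem_eqs {X : Finset ℕ} {σ : ℕ → L.Term ℕ} {b : BuiltInAtom L} :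
    b ∈ eqs X σ ↔ ∃ x ∈ X, .eq (.var x) (σ x) = b := by
  simp [eqs]

/-- Equations in solved form, whose right-hand sides avoid the variables being replaced, can be
applied one after the other: the first replacement creates no new occurrence of a variable that is
still to be treated. -/
theorem single_comp {X : Finset ℕ} {σ : ℕ → L.Term ℕ} {x : ℕ} (hxX : x ∉ X)
    (hσ : ∀ y ∉ insert x X, σ y = .var y)
    (hX : ∀ y ∈ insert x X, ∀ z ∈ (σ y).varFinset, z ∉ insert x X) :
    (fun y => (single x (σ x) y).subst (Function.update σ x (.var x))) = σ := by
  funext y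
  by_cases h : y = x
  · subst h
    simp only [single, Function.update_self]
    refine Term.subst_eq_self _ fun z hz => ?_
    have hz := hX y (by simp) z hz
    rw [Function.update_of_ne (by rintro rfl; simp at hz), hσ z hz]
  · simp [single, Function.update_of_ne h, FirstOrder.Language.Term.subst]

/-- The equality axiom replaces one variable at a time. `single_comp` splits the simultaneous
substitution accordingly, and the induction runs over the variables. -/
theorem HasEquality.subst_le (hEq : HasEquality CT) {X : Finset ℕ} {σ : ℕ → L.Term ℕ}
    (hσ : ∀ y ∉ X, σ y = .var y) (hX : ∀ y ∈ X, ∀ z ∈ (σ y).varFinset, z ∉ X) {φ : Formula L}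
    (h : ∀ x ∈ X, CTEntails CT φ (.eq (.var x) (σ x))) {b : BuiltInAtom L}
    (hb : CTEntails CT φ b.toFormula) : CTEntails CT φ (b.subst σ).toFormula := by
  induction X using Finset.induction generalizing σ b with
  | empty =>
    rw [show σ = .var from funext fun x => hσ x (by simp), BuiltInAtom.subst_var]
    exact hb
  | insert x X hxX ih =>
    have e : b.subst σ = (b.subst (single x (σ x))).subst (Function.update σ x (.var x)) := by
      rw [BuiltInAtom.subst_subst, single_comp hxX hσ hX]
    rw [e]
    have hu : ∀ y, y ≠ x → Function.update σ x (.var x) y = σ y := fun y hy =>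
      Function.update_of_ne hy _ _
    have hne : ∀ y ∈ X, y ≠ x := fun y hy => by rintro rfl; exact hxX hy
    refine ih (fun y hy => ?_) (fun y hy z hz => ?_) (fun y hy => ?_) ?_
    · by_cases hyx : y = x
      · subst hyx; simp
      · rw [hu y hyx]
        exact hσ y (by simp [hyx, hy])
    · rw [hu y (hne y hy)] at hz
      exact fun hzX => hX y (by simp [hy]) z hz (by simp [hzX])
    · rw [hu y (hne y hy)]
      exact h y (by simp [hy])
    -- With `.var x` as the term being replaced, the premise of the equality axiom is `b` itself.
    · have h1 := hEq.2 b x (.var x) (σ x)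
      have e1 : b.subst (single x (.var x)) = b := by
        rw [show (single x (.var x) : ℕ → L.Term ℕ) = .var from Function.update_eq_self _ _,
          BuiltInAtom.subst_var]
      rw [e1] at h1
      exact (Formula.Entails.le_and (h x (by simp)) hb).trans h1

end Theory

/-! ### Equivalence of states -/

section States

variable {L : FirstOrder.Language.{u, v}} {K : ℕ → Type w} {CT : Set (CTAxiom L)}

theorem StateEquiv.of_cls_eq {G G' : Goal L K} (V : Finset ℕ) (h : G.cls = G'.cls) :
    StateEquiv CT ⟨G, V⟩ ⟨G', V⟩ := .goal V (Goal.cls_eq_iff.1 h)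

/-- The state `⟨𝕌 ∧ 𝔹; 𝕍⟩` for multisets of constraints. -/
noncomputable def storeState (U : Multiset (UserAtom L K)) (B : Multiset (BuiltInAtom L))
    (V : Finset ℕ) : State L K :=
  State.ofStores (Conj.ofMultiset U) (Conj.ofMultiset B) V

theorem cls_storeState (U : Multiset (UserAtom L K)) (B : Multiset (BuiltInAtom L))
    (V : Finset ℕ) : (storeState U B V).goal.cls =
      (U.map fun a => (Goal.user a : Goal L K).cls).sum +
        (B.map fun b => (Goal.builtIn b : Goal L K).cls).sum := by
  simp only [storeState, State.ofStores, Goal.cls_and, User.cls_toGoal, BuiltIn.cls_toGoal,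
    Conj.atoms_ofMultiset]

theorem cls_ofStores (U : User L K) (B : BuiltIn L) (V : Finset ℕ) :
    (State.ofStores U B V).goal.cls = (storeState U.atoms B.atoms V).goal.cls := by
  rw [cls_storeState]
  simp only [State.ofStores, Goal.cls_and, User.cls_toGoal, BuiltIn.cls_toGoal]

theorem StateEquiv.ofStores_storeState (U : User L K) (B : BuiltIn L) (V : Finset ℕ) :
    StateEquiv CT (State.ofStores U B V) (storeState U.atoms B.atoms V) :=
  .of_cls_eq V (cls_ofStores U B V)

theorem not_mem_vars_exFormula {U : User L K} {B : BuiltIn L} {V : Finset ℕ} {x : ℕ}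
    (h : x ∈ (BuiltIn.exFormula (strictlyLocal U B V) B).fv) : x ∈ V ∨ x ∈ User.vars U := by
  obtain ⟨h1, h2⟩ := Formula.mem_fv_exVars h
  rw [BuiltIn.fv_toFormula] at h1
  by_contra hc
  rw [not_or] at hc
  exact h2 (by simp [strictlyLocal, hc, h1])

theorem mem_strictlyLocal {U : User L K} {B : BuiltIn L} {V : Finset ℕ} {x : ℕ}
    (h : x ∈ strictlyLocal U B V) : x ∉ V ∧ x ∉ User.vars U := by
  simp only [strictlyLocal, Finset.mem_sdiff] at h
  exact ⟨h.1.2, h.2⟩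

/-- The variables quantified on the left occur neither in `V` nor in `U`, while those free on the
right do; so the left quantifier may be dropped. -/
theorem exFormula_le {U : User L K} {B B' : BuiltIn L} {V : Finset ℕ}
    (h : CTEntails CT (BuiltIn.toFormula B) (BuiltIn.exFormula (strictlyLocal U B' V) B')) :
    CTEntails CT (BuiltIn.exFormula (strictlyLocal U B V) B)
      (BuiltIn.exFormula (strictlyLocal U B' V) B') :=
  Formula.Entails.exVars_le (CTAxiom.closed CT) (fun x hx hx' => by
    have h1 := mem_strictlyLocal hx
    have h2 := not_mem_vars_exFormula hx'
    tauto) h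

/-- Constraints that are implied, up to quantification of fresh variables, can be added. -/
theorem StateEquiv.add_ex {U : Multiset (UserAtom L K)} {B B' : Multiset (BuiltInAtom L)}
    {V X : Finset ℕ} (hV : ∀ x ∈ X, x ∉ V) (hU : ∀ x ∈ X, ∀ a ∈ U, x ∉ a.vars)
    (hB : ∀ x ∈ X, ∀ b ∈ B, x ∉ b.vars)
    (h : CTEntails CT (conjFormula B) (.exVars X (conjFormula B'))) :
    StateEquiv CT (storeState U B V) (storeState U (B + B') V) := by
  have hCT := CTAxiom.closed CT
  refine .theory _ _ _ _ (exFormula_le ?_) (exFormula_le ?_)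
  · refine (Formula.Entails.le_and (.refl _) h).trans ?_
    -- `B` is moved to the right by currying, so that only the quantified `B'` remains on the left.
    -- Its variables `X` avoid `B`, `U` and `V`, and the quantifier can be eliminated.
    refine .trans (.le_and .and_right .and_left) ?_
    refine .and_le_of_le_imp (.exVars_le hCT (fun x hx hx' => ?_) (.le_imp ?_))
    · rcases Finset.mem_union.1 hx' with hx' | hx'
      · obtain ⟨b, hb, hx'⟩ := mem_fv_conjFormula.1 hx'
        exact hB x hx b hb hx'
      · rcases not_mem_vars_exFormula hx' with hx' | hx'
        · exact hV x hx hx'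
        · rw [User.mem_vars, Conj.atoms_ofMultiset] at hx'
          obtain ⟨a, ha, hx'⟩ := hx'
          exact hU x hx a ha hx'
    · refine .trans ?_ (Formula.Entails.le_exVars_self hCT _ _)
      refine le_conjFormula fun b hb => ?_
      rcases Multiset.mem_add.1 hb with hb | hb
      · exact .trans .and_right (conjFormula_le hb)
      · exact .trans .and_left (conjFormula_le hb)
  · exact .trans (conjFormula_mono (Multiset.le_add_right _ _))
      (Formula.Entails.le_exVars_self hCT _ _)

/-- Constraints that are implied after instantiation of fresh variables can be added. -/
theorem StateEquiv.add_inst {U : Multiset (UserAtom L K)} {B B' : Multiset (BuiltInAtom L)}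
    {V X : Finset ℕ} (hV : ∀ x ∈ X, x ∉ V) (hU : ∀ x ∈ X, ∀ a ∈ U, x ∉ a.vars)
    (hB : ∀ x ∈ X, ∀ b ∈ B, x ∉ b.vars) (τ : ℕ → L.Term ℕ) (hτ : ∀ x ∉ X, τ x = .var x)
    (h : ∀ b ∈ B', CTEntails CT (conjFormula B) (b.subst τ).toFormula) :
    StateEquiv CT (storeState U B V) (storeState U (B + B') V) := by
  refine .add_ex hV hU hB (.trans ?_ (.le_exVars (CTAxiom.closed CT) τ fun y _ hy => hτ y hy))
  refine .trans (le_conjFormula fun b hb => ?_) (conjFormula_subst_le τ)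
  obtain ⟨b', hb', rfl⟩ := Multiset.mem_map.1 hb
  exact h b' hb'

theorem StateEquiv.add_entailed {U : Multiset (UserAtom L K)} {B B' : Multiset (BuiltInAtom L)}
    {V : Finset ℕ} (h : ∀ b ∈ B', CTEntails CT (conjFormula B) b.toFormula) :
    StateEquiv CT (storeState U B V) (storeState U (B + B') V) :=
  .add_inst (X := ∅) (by simp) (by simp) (by simp) .var (fun _ _ => rfl)
    (by simpa only [BuiltInAtom.subst_var] using h)

theorem StateEquiv.substitute_single (U : Multiset (UserAtom L K)) (B : Multiset (BuiltInAtom L))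
    (V : Finset ℕ) (x : ℕ) (t : L.Term ℕ) :
    StateEquiv CT (storeState U (.eq (.var x) t ::ₘ B) V)
      (storeState (U.map (UserAtom.subst (single x t))) (.eq (.var x) t ::ₘ B) V) := by
  have h := StateEquiv.subst (CT := CT) (Conj.ofMultiset U) x t (Conj.ofMultiset B) V
  have h1 := StateEquiv.ofStores_storeState (CT := CT) (Conj.ofMultiset U)
    (.and (.atom (.eq (.var x) t)) (Conj.ofMultiset B)) V
  have h2 := StateEquiv.ofStores_storeState (CT := CT)
    (User.subst (single x t) (Conj.ofMultiset U))
    (.and (.atom (.eq (.var x) t)) (Conj.ofMultiset B)) V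
  simp only [User.atoms_subst, Conj.atoms, Conj.atoms_ofMultiset, Multiset.singleton_add]
    at h1 h2
  exact (h1.symm.trans h).trans h2

/-- Solved equations can be applied to the user-defined constraints. -/
theorem StateEquiv.substitute (U : Multiset (UserAtom L K)) (B : Multiset (BuiltInAtom L))
    (V : Finset ℕ) {X : Finset ℕ} {σ : ℕ → L.Term ℕ}
    (hσ : ∀ y ∉ X, σ y = .var y) (hX : ∀ y ∈ X, ∀ z ∈ (σ y).varFinset, z ∉ X) :
    StateEquiv CT (storeState U (B + eqs X σ) V)
      (storeState (U.map (UserAtom.subst σ)) (B + eqs X σ) V) := by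
  induction X using Finset.induction generalizing σ U B with
  | empty =>
    rw [show σ = .var from funext fun x => hσ x (by simp),
      Multiset.map_congr rfl fun a _ => a.subst_var, Multiset.map_id']
    exact .refl _
  | insert x X hxX ih =>
    have e : U.map (UserAtom.subst σ) =
        (U.map (UserAtom.subst (single x (σ x)))).map
          (UserAtom.subst (Function.update σ x (.var x))) := by
      rw [Multiset.map_map]
      refine Multiset.map_congr rfl fun a _ => ?_
      rw [Function.comp_apply, UserAtom.subst_subst, single_comp hxX hσ hX]
    have hu : ∀ y, y ≠ x → Function.update σ x (.var x) y = σ y := fun y hy =>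
      Function.update_of_ne hy _ _
    have hne : ∀ y ∈ X, y ≠ x := fun y hy => by rintro rfl; exact hxX hy
    have e' : B + eqs (insert x X) σ =
        .eq (.var x) (σ x) ::ₘ (B + eqs X (Function.update σ x (.var x))) := by
      rw [eqs, eqs, Finset.insert_val_of_notMem hxX, Multiset.map_cons, Multiset.add_cons]
      congr 2
      exact Multiset.map_congr rfl fun y hy => by rw [hu y (hne y hy)]
    rw [e']
    refine (StateEquiv.substitute_single U _ V x (σ x)).trans ?_
    rw [e, ← Multiset.cons_add]
    refine ih _ _ (fun y hy => ?_) (fun y hy z hz => ?_)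
    · by_cases hyx : y = x
      · subst hyx; simp
      · rw [hu y hyx]
        exact hσ y (by simp [hyx, hy])
    · rw [hu y (hne y hy)] at hz
      exact fun hzX => hX y (by simp [hy]) z hz (by simp [hzX])

end States

/-! ### Fresh variables -/

section Fresh

variable {L : FirstOrder.Language.{u, v}} {K : ℕ → Type w} {CT : Set (CTAxiom L)}

/-- `σ`, except that the variables `x ∈ Z` are renamed to `N + x`. -/
def freshen (N : ℕ) (Z : Finset ℕ) (σ : ℕ → L.Term ℕ) : ℕ → L.Term ℕ :=
  fun x => if x ∈ Z then .var (N + x) else σ x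

/-- The substitution that maps `N + x` to `σ x` for `x ∈ E`. -/
def unfreshen (N : ℕ) (E : Finset ℕ) (σ : ℕ → L.Term ℕ) : ℕ → L.Term ℕ :=
  fun z => if N ≤ z ∧ z - N ∈ E then σ (z - N) else .var z

theorem unfreshen_of_lt {N : ℕ} {E : Finset ℕ} {σ : ℕ → L.Term ℕ} {z : ℕ} (h : z < N) :
    unfreshen N E σ z = .var z := if_neg (by omega)

theorem unfreshen_add {N : ℕ} {E : Finset ℕ} {σ : ℕ → L.Term ℕ} {x : ℕ} (h : x ∈ E) :
    unfreshen N E σ (N + x) = σ x := by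
  simp [unfreshen, h]

theorem subst_unfreshen {N : ℕ} {E : Finset ℕ} {σ : ℕ → L.Term ℕ} {t : L.Term ℕ}
    (h : ∀ z ∈ t.varFinset, z < N) : t.subst (unfreshen N E σ) = t :=
  Term.subst_eq_self t fun z hz => unfreshen_of_lt (h z hz)

theorem freshen_unfreshen {N : ℕ} {Z E : Finset ℕ} {σ : ℕ → L.Term ℕ} {x : ℕ}
    (hE : x ∈ Z → x ∈ E) (h : ∀ z ∈ (σ x).varFinset, z < N) :
    (freshen N Z σ x).subst (unfreshen N E σ) = σ x := by
  by_cases hx : x ∈ Z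
  · simp [freshen, hx, FirstOrder.Language.Term.subst, unfreshen_add (hE hx)]
  · simp [freshen, hx, subst_unfreshen h]

/-- The equations `N + x ≐ σ x` for `x ∈ E`. -/
def freshEqs (N : ℕ) (E : Finset ℕ) (σ : ℕ → L.Term ℕ) : Multiset (BuiltInAtom L) :=
  eqs (E.map (addLeftEmbedding N)) (unfreshen N E σ)

theorem mem_freshEqs {N : ℕ} {E : Finset ℕ} {σ : ℕ → L.Term ℕ} {b : BuiltInAtom L} :
    b ∈ freshEqs N E σ ↔ ∃ x ∈ E, .eq (.var (N + x)) (σ x) = b := by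
  simp only [freshEqs, mem_eqs, Finset.mem_map, addLeftEmbedding_apply]
  constructor
  · rintro ⟨_, ⟨x, hx, rfl⟩, rfl⟩
    exact ⟨x, hx, by rw [unfreshen_add hx]⟩
  · rintro ⟨x, hx, rfl⟩
    exact ⟨_, ⟨x, hx, rfl⟩, by rw [unfreshen_add hx]⟩

/-- The left-hand sides are variables from `N` on and the right-hand sides use only variables below
`N`, so these equations are in solved form. -/
theorem StateEquiv.substitute_fresh (U : Multiset (UserAtom L K)) (B : Multiset (BuiltInAtom L))
    (V : Finset ℕ) {N : ℕ} {E : Finset ℕ} {σ : ℕ → L.Term ℕ}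
    (hσ : ∀ x ∈ E, ∀ z ∈ (σ x).varFinset, z < N) :
    StateEquiv CT (storeState U (B + freshEqs N E σ) V)
      (storeState (U.map (UserAtom.subst (unfreshen N E σ))) (B + freshEqs N E σ) V) := by
  refine .substitute U B V (fun y hy => if_neg ?_) (fun y hy z hz => ?_)
  · rintro ⟨h1, h2⟩
    exact hy (Finset.mem_map.2 ⟨_, h2, by simp [h1]⟩)
  · obtain ⟨x, hx, rfl⟩ := Finset.mem_map.1 hy
    rw [addLeftEmbedding_apply, unfreshen_add hx] at hz
    have := hσ x hx z hz
    intro hz'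
    obtain ⟨x', hx', rfl⟩ := Finset.mem_map.1 hz'
    simp at this

theorem HasEquality.unfreshen_le (hEq : HasEquality CT) {N : ℕ} {E : Finset ℕ}
    {σ : ℕ → L.Term ℕ} (hσ : ∀ x ∈ E, ∀ z ∈ (σ x).varFinset, z < N)
    {B : Multiset (BuiltInAtom L)} (hB : freshEqs N E σ ≤ B) {b : BuiltInAtom L} (hb : b ∈ B) :
    CTEntails CT (conjFormula B) (b.subst (unfreshen N E σ)).toFormula := by
  refine hEq.subst_le (X := E.map (addLeftEmbedding N)) (σ := unfreshen N E σ)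
    (fun y hy => if_neg ?_)
    (fun y hy z hz => ?_) (fun y hy => ?_) (conjFormula_le hb)
  · rintro ⟨h1, h2⟩
    exact hy (Finset.mem_map.2 ⟨_, h2, by simp [h1]⟩)
  · obtain ⟨x, hx, rfl⟩ := Finset.mem_map.1 hy
    rw [addLeftEmbedding_apply, unfreshen_add hx] at hz
    have := hσ x hx z hz
    intro hz'
    obtain ⟨x', hx', rfl⟩ := Finset.mem_map.1 hz'
    simp at this
  · exact conjFormula_le (b := .eq (.var y) (unfreshen N E σ y))
      (Multiset.mem_of_le hB (mem_eqs.2 ⟨y, hy, rfl⟩))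

/-- An instance of a pattern can be replaced by the pattern with fresh variables. -/
theorem StateEquiv.expand (hEq : HasEquality CT) {U W : Multiset (UserAtom L K)}
    {B C : Multiset (BuiltInAtom L)} {V Z E : Finset ℕ} {σ : ℕ → L.Term ℕ} {N : ℕ}
    (hV : ∀ x ∈ V, x < N) (hU : ∀ a ∈ U, ∀ x ∈ a.vars, x < N) (hB : ∀ b ∈ B, ∀ x ∈ b.vars, x < N)
    (hEZ : E ⊆ Z) (hW : ∀ a ∈ W, ∀ x ∈ a.vars, x ∈ Z → x ∈ E)
    (hσW : ∀ a ∈ W, ∀ x ∈ a.vars, ∀ z ∈ (σ x).varFinset, z < N)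
    (hσC : ∀ b ∈ C, ∀ x ∈ b.vars, ∀ z ∈ (σ x).varFinset, z < N)
    (hσZ : ∀ x ∈ Z, ∀ z ∈ (σ x).varFinset, z < N) :
    StateEquiv CT (storeState (U + W.map (.subst σ)) (B + C.map (.subst σ)) V)
      (storeState (U + W.map (.subst (freshen N Z σ)))
        (B + C.map (.subst σ) + (C.map (.subst (freshen N Z σ)) + freshEqs N E σ)) V) := by
  -- The instance is recovered from the fresh copy by evaluating `N + x` as `σ x`. Only variables in
  -- `E` are evaluated, which is enough because the variables of `W` that are renamed lie in `E`.
  have e : U + W.map (UserAtom.subst σ) = (U + W.map (UserAtom.subst (freshen N Z σ))).map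
      (UserAtom.subst (unfreshen N E σ)) := by
    rw [Multiset.map_add, Multiset.map_map]
    congr 1
    · conv_lhs => rw [← Multiset.map_id' U]
      refine Multiset.map_congr rfl fun a ha => ?_
      rw [UserAtom.subst_congr a (τ := .var) fun x hx => unfreshen_of_lt (hU a ha x hx),
        UserAtom.subst_var]
    · refine Multiset.map_congr rfl fun a ha => ?_
      rw [Function.comp_apply, UserAtom.subst_subst]
      exact UserAtom.subst_congr a fun x hx =>
        (freshen_unfreshen (hW a ha x hx) (hσW a ha x hx)).symm
  have hfresh : ∀ x ∈ Z.map (addLeftEmbedding N), N ≤ x := by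
    intro x hx
    obtain ⟨y, hy, rfl⟩ := Finset.mem_map.1 hx
    simp
  -- First only the built-in store grows. With `σ x` as witness for `N + x`, the fresh copy of `C`
  -- becomes the instance that is already present, and the equations become reflexive.
  have h1 : StateEquiv CT (storeState (U + W.map (.subst σ)) (B + C.map (.subst σ)) V)
      (storeState (U + W.map (.subst σ))
        (B + C.map (.subst σ) + (C.map (.subst (freshen N Z σ)) + freshEqs N E σ)) V) := by
    refine .add_inst (X := Z.map (addLeftEmbedding N)) (fun x hx hx' => ?_)
      (fun x hx a ha hx' => ?_) (fun x hx b hb hx' => ?_) (unfreshen N Z σ) (fun x hx => ?_)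
      (fun b hb => ?_)
    · have := hfresh x hx
      have := hV x hx'
      omega
    · have := hfresh x hx
      rcases Multiset.mem_add.1 ha with ha | ha
      · have := hU a ha x hx'
        omega
      · obtain ⟨a, haW, rfl⟩ := Multiset.mem_map.1 ha
        obtain ⟨y, hy, hx'⟩ := UserAtom.mem_vars_subst.1 hx'
        have := hσW a haW y hy x hx'
        omega
    · have := hfresh x hx
      rcases Multiset.mem_add.1 hb with hb | hb
      · have := hB b hb x hx'
        omega
      · obtain ⟨b, hbC, rfl⟩ := Multiset.mem_map.1 hb
        obtain ⟨y, hy, hx'⟩ := BuiltInAtom.mem_vars_subst.1 hx'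
        have := hσC b hbC y hy x hx'
        omega
    · refine if_neg ?_
      rintro ⟨h1, h2⟩
      exact hx (Finset.mem_map.2 ⟨_, h2, by simp [h1]⟩)
    · rcases Multiset.mem_add.1 hb with hb | hb
      · obtain ⟨b, hbC, rfl⟩ := Multiset.mem_map.1 hb
        rw [BuiltInAtom.subst_subst, BuiltInAtom.subst_congr b (τ := σ) fun x hx =>
          freshen_unfreshen id (hσC b hbC x hx)]
        exact conjFormula_le (Multiset.mem_add.2 (.inr (Multiset.mem_map_of_mem _ hbC)))
      · obtain ⟨x, hx, rfl⟩ := mem_freshEqs.1 hb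
        have hx := hEZ hx
        simp only [BuiltInAtom.subst, FirstOrder.Language.Term.subst, unfreshen_add hx,
          subst_unfreshen (hσZ x hx)]
        exact .of_provable (hEq.1 _)
  refine h1.trans ?_
  -- The new equations are then used from right to left, turning the instance of `W` into the fresh
  -- copy.
  rw [e, ← add_assoc (B + _)]
  exact (StateEquiv.substitute_fresh _ _ V fun x hx => hσZ x (hEZ hx)).symm

/-- Renaming of local variables. -/
theorem StateEquiv.rename (hEq : HasEquality CT) {W : Multiset (UserAtom L K)}
    {C : Multiset (BuiltInAtom L)} {V Y : Finset ℕ} {N : ℕ} (hV : ∀ x ∈ V, x < N)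
    (hW : ∀ a ∈ W, ∀ x ∈ a.vars, x < N) (hC : ∀ b ∈ C, ∀ x ∈ b.vars, x < N)
    (hY : ∀ x ∈ Y, x < N) (hYV : ∀ x ∈ Y, x ∉ V) :
    StateEquiv CT (storeState W C V)
      (storeState (W.map (.subst (freshen N Y .var))) (C.map (.subst (freshen N Y .var))) V) := by
  have hv : ∀ x, x < N → ∀ z ∈ (FirstOrder.Language.Term.var x : L.Term ℕ).varFinset, z < N :=
    fun x hx z hz => by rwa [Term.mem_varFinset_var.1 hz]
  have h := StateEquiv.expand (CT := CT) hEq (U := (0 : Multiset (UserAtom L K))) (W := W)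
    (B := 0) (C := C) (V := V) (Z := Y) (E := Y) (σ := .var) (N := N) hV (by simp) (by simp)
    subset_rfl (fun _ _ _ _ h => h) (fun a ha x hx => hv x (hW a ha x hx))
    (fun a ha x hx => hv x (hC a ha x hx)) (fun x hx => hv x (hY x hx))
  rw [Multiset.map_congr (g := id) rfl fun (a : UserAtom L K) _ => a.subst_var,
    Multiset.map_congr (g := id) rfl fun (a : BuiltInAtom L) _ => a.subst_var,
    Multiset.map_id, Multiset.map_id, zero_add, zero_add, zero_add] at h
  refine h.trans (.symm ?_)
  rw [add_left_comm]
  have hfr : ∀ x ∈ Y, ∀ y, x ∉ (freshen N Y .var y : L.Term ℕ).varFinset := by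
    intro x hx y
    have := hY x hx
    by_cases hy : y ∈ Y
    · simp only [freshen, hy, if_true, Term.mem_varFinset_var]
      omega
    · simp only [freshen, hy, if_false, Term.mem_varFinset_var]
      rintro rfl
      exact hy hx
  -- `expand` has kept the old store next to its copy. The variables of `Y` no longer occur in the
  -- copy, so the old store can be removed: instantiating `x` by `N + x` turns it into the copy and
  -- makes the equations reflexive.
  refine .add_inst (X := Y) hYV (fun x hx a ha hx' => ?_) (fun x hx b hb hx' => ?_)
    (freshen N Y .var) (fun x hx => if_neg hx) (fun b hb => ?_)
  · obtain ⟨a, ha, rfl⟩ := Multiset.mem_map.1 ha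
    obtain ⟨y, hy, hx'⟩ := UserAtom.mem_vars_subst.1 hx'
    exact hfr x hx y hx'
  · obtain ⟨a, ha, rfl⟩ := Multiset.mem_map.1 hb
    obtain ⟨y, hy, hx'⟩ := BuiltInAtom.mem_vars_subst.1 hx'
    exact hfr x hx y hx'
  · rcases Multiset.mem_add.1 hb with hb | hb
    · exact conjFormula_le (Multiset.mem_map_of_mem _ hb)
    · obtain ⟨x, hx, rfl⟩ := mem_freshEqs.1 hb
      have hN : N + x ∉ Y := fun h => by
        have := hY _ h
        omega
      simp only [BuiltInAtom.subst, FirstOrder.Language.Term.subst, freshen, hx, hN, if_true,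
        if_false]
      exact .of_provable (hEq.1 _)

theorem StateEntails.of_stateEquiv {S T : State L K} (h : StateEquiv CT S T) :
    StateEntails CT (S.cls CT) (T.cls CT) := by
  rw [show S.cls CT = T.cls CT from Quotient.sound h]
  exact .refl _

theorem StateEntails.mono_store {U : Multiset (UserAtom L K)} {B C : Multiset (BuiltInAtom L)}
    (V : Finset ℕ) (h : C ≤ B) :
    StateEntails CT ((storeState U B V).cls CT) ((storeState U C V).cls CT) :=
  .weaken _ _ _ _ (exFormula_le
    ((conjFormula_mono h).trans (Formula.Entails.le_exVars_self (CTAxiom.closed CT) _ _)))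

theorem StateEntails.mono_globals (U : Multiset (UserAtom L K)) (B : Multiset (BuiltInAtom L))
    {V V' : Finset ℕ} (h : V' ⊆ V) :
    StateEntails CT ((storeState U B V).cls CT) ((storeState U B V').cls CT) := by
  rw [← Finset.sdiff_union_of_subset h]
  induction V \ V' using Finset.induction with
  | empty => rw [Finset.empty_union]; exact .refl _
  | insert x X _ ih =>
    rw [Finset.insert_union]
    exact .trans (.omitGlobal _ _ _ _) ih

/-- An instance of a state entails the state. -/
theorem StateEntails.of_instance (hEq : HasEquality CT) {W : Multiset (UserAtom L K)}
    {B C : Multiset (BuiltInAtom L)} {V V' Y : Finset ℕ} {σ : ℕ → L.Term ℕ} (hV : V' ⊆ V)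
    (hY : ∀ x ∈ Y, x ∉ V') (hσ : ∀ x ∉ Y, σ x = .var x) :
    StateEntails CT ((storeState (W.map (.subst σ)) (B + C.map (.subst σ)) V).cls CT)
      ((storeState W C V').cls CT) := by
  obtain ⟨N, hN⟩ : ∃ N, ∀ x ∈ V ∪ User.vars (Conj.ofMultiset W) ∪ BuiltIn.vars (Conj.ofMultiset B) ∪
      BuiltIn.vars (Conj.ofMultiset C) ∪ Y ∪ Y.biUnion fun y => (σ y).varFinset, x < N :=
    ⟨_, fun x hx => Nat.lt_succ_of_le (Finset.le_sup (f := id) hx)⟩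
  simp only [Finset.mem_union, User.mem_vars, BuiltIn.mem_vars, Conj.atoms_ofMultiset,
    Finset.mem_biUnion] at hN
  have hσ' : ∀ x, x < N → ∀ z ∈ (σ x).varFinset, z < N := by
    intro x hx z hz
    by_cases hxY : x ∈ Y
    · exact hN z (.inr ⟨x, hxY, hz⟩)
    · rw [hσ x hxY, Term.mem_varFinset_var] at hz
      rwa [hz]
  have hNW : ∀ a ∈ W, ∀ x ∈ a.vars, x < N := fun a ha x hx => hN x (by grind)
  have hNC : ∀ a ∈ C, ∀ x ∈ a.vars, x < N := fun a ha x hx => hN x (by grind)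
  have hNY : ∀ x ∈ Y, x < N := fun x hx => hN x (by grind)
  have h1 := StateEquiv.expand (CT := CT) hEq (U := (0 : Multiset (UserAtom L K))) (W := W)
    (B := B) (C := C) (V := V) (Z := Y) (E := Y) (σ := σ) (N := N) (fun x hx => hN x (by grind))
    (by simp) (fun b hb x hx => hN x (by grind)) subset_rfl (fun _ _ _ _ h => h)
    (fun a ha x hx => hσ' x (hNW a ha x hx)) (fun a ha x hx => hσ' x (hNC a ha x hx))
    (fun x hx => hσ' x (hNY x hx))
  rw [zero_add, zero_add] at h1
  -- Off `Y` the substitution is the identity, so the fresh pattern is a mere renaming of `W` and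
  -- `C`.
  have e : freshen N Y σ = freshen N Y .var := by
    funext x
    by_cases hx : x ∈ Y
    · simp [freshen, hx]
    · simp [freshen, hx, hσ x hx]
  rw [e] at h1
  -- Forget all built-in constraints except the fresh copy of `C`, forget the extra globals, and
  -- undo the renaming.
  refine (StateEntails.of_stateEquiv h1).trans ((StateEntails.mono_store _
    (C := C.map (.subst (freshen N Y .var))) ?_).trans
    ((StateEntails.mono_globals _ _ hV).trans (.of_stateEquiv (.symm ?_))))
  · exact (Multiset.le_add_right _ _).trans (Multiset.le_add_left _ _)
  · exact .rename hEq (fun x hx => hN x (by have := hV hx; grind)) hNW hNC hNY hY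

end Fresh

/-! ### Disjunctive normal forms -/

section NormalForm

variable {L : FirstOrder.Language.{u, v}} {K : ℕ → Type w}

/-- Pairs of a multiset of user-defined and a multiset of built-in atomic constraints. -/
abbrev Store (L : FirstOrder.Language.{u, v}) (K : ℕ → Type w) : Type (max u v w) :=
  Multiset (UserAtom L K) × Multiset (BuiltInAtom L)

def Store.subst (σ : ℕ → L.Term ℕ) (d : Store L K) : Store L K :=
  (d.1.map (.subst σ), d.2.map (.subst σ))

theorem Store.subst_add (σ : ℕ → L.Term ℕ) (d e : Store L K) :
    Store.subst σ (d + e) = Store.subst σ d + Store.subst σ e := by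
  simp [Store.subst]

/-- The goal without disjunctions that is given by a store. -/
noncomputable def Store.goal (d : Store L K) : Goal L K := (storeState d.1 d.2 ∅).goal

theorem Store.cls_goal (d : Store L K) : d.goal.cls =
      (d.1.map fun a => (Goal.user a : Goal L K).cls).sum +
        (d.2.map fun b => (Goal.builtIn b : Goal L K).cls).sum :=
  cls_storeState _ _ _

theorem Store.cls_goal_add (d e : Store L K) : (d + e).goal.cls = d.goal.cls + e.goal.cls := by
  simp only [Store.cls_goal, Prod.fst_add, Prod.snd_add, Multiset.map_add, Multiset.sum_add]
  abel

theorem User.vars_toGoal (U : User L K) : (User.toGoal U).vars = User.vars U := by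
  induction U with
  | top => rfl
  | atom a => rfl
  | and U U' h1 h2 => simp only [User.toGoal, Goal.vars, User.vars, h1, h2]

theorem BuiltIn.vars_toGoal (B : BuiltIn L) : (BuiltIn.toGoal K B).vars = BuiltIn.vars B := by
  induction B with
  | top => rfl
  | atom a => rfl
  | and U U' h1 h2 => simp only [BuiltIn.toGoal, Goal.vars, BuiltIn.vars, h1, h2]

theorem mem_vars_storeState {U : Multiset (UserAtom L K)} {B : Multiset (BuiltInAtom L)}
    {V : Finset ℕ} {x : ℕ} : x ∈ (storeState U B V).goal.vars ↔
      (∃ a ∈ U, x ∈ a.vars) ∨ ∃ b ∈ B, x ∈ b.vars := by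
  simp only [storeState, State.ofStores, Goal.vars, User.vars_toGoal, BuiltIn.vars_toGoal,
    Finset.mem_union, User.mem_vars, BuiltIn.mem_vars, Conj.atoms_ofMultiset]

theorem User.atoms_store_toGoal (U : User L K) : (User.toGoal U).store.atoms = 0 := by
  induction U with
  | top => rfl
  | atom a => rfl
  | and U U' h1 h2 => simp only [User.toGoal, Goal.store, Conj.atoms, h1, h2, add_zero]

theorem BuiltIn.atoms_store_toGoal (B : BuiltIn L) :
    (BuiltIn.toGoal K B).store.atoms = B.atoms := by
  induction B with
  | top => rfl
  | atom a => rfl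
  | and U U' h1 h2 => simp only [BuiltIn.toGoal, Goal.store, Conj.atoms, h1, h2]

theorem Store.atoms_store_goal (d : Store L K) : d.goal.store.atoms = d.2 := by
  simp only [Store.goal, storeState, State.ofStores, Goal.store, Conj.atoms,
    User.atoms_store_toGoal, BuiltIn.atoms_store_toGoal, Conj.atoms_ofMultiset, zero_add]

/-- The disjunctive normal form of a goal. -/
def Goal.dnf : Goal L K → List (Store L K)
  | .top => [0]
  | .user a => [({a}, 0)]
  | .builtIn b => [(0, {b})]
  | .and G H => G.dnf.flatMap fun d => H.dnf.map fun e => d + e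
  | .or G H => G.dnf ++ H.dnf

theorem Goal.mem_dnf_and {G H : Goal L K} {f : Store L K} :
    f ∈ (Goal.and G H).dnf ↔ ∃ d ∈ G.dnf, ∃ e ∈ H.dnf, d + e = f := by
  simp [Goal.dnf]

theorem User.dnf_toGoal (U : User L K) : (User.toGoal U).dnf = [(U.atoms, 0)] := by
  induction U with
  | top => rfl
  | atom a => rfl
  | and U U' h1 h2 => simp [User.toGoal, Goal.dnf, h1, h2, Conj.atoms]

theorem BuiltIn.dnf_toGoal (B : BuiltIn L) :
    (BuiltIn.toGoal K B).dnf = [((0 : Multiset (UserAtom L K)), B.atoms)] := by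
  induction B with
  | top => rfl
  | atom a => rfl
  | and U U' h1 h2 => simp [BuiltIn.toGoal, Goal.dnf, h1, h2, Conj.atoms]

theorem Goal.dnf_subst (σ : ℕ → L.Term ℕ) (G : Goal L K) :
    (G.subst σ).dnf = G.dnf.map (Store.subst σ) := by
  induction G with
  | top => rfl
  | user a => simp [Goal.dnf, Goal.subst, Store.subst]
  | builtIn b => simp [Goal.dnf, Goal.subst, Store.subst]
  | or G H h1 h2 => simp [Goal.dnf, Goal.subst, h1, h2]
  | and G H h1 h2 =>
    simp only [Goal.dnf, Goal.subst, h1, h2, List.flatMap_map, List.map_flatMap, List.map_map,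
      Function.comp_def, Store.subst_add]

theorem Goal.vars_of_mem_dnf {G : Goal L K} {d : Store L K} (hd : d ∈ G.dnf) :
    (∀ a ∈ d.1, ∀ x ∈ a.vars, x ∈ G.vars) ∧ ∀ b ∈ d.2, ∀ x ∈ b.vars, x ∈ G.vars := by
  induction G generalizing d with
  | top | user a | builtIn b =>
    simp only [Goal.dnf, List.mem_singleton] at hd
    subst hd
    simp [Goal.vars]
  | or G H h1 h2 =>
    rcases List.mem_append.1 hd with hd | hd
    · exact ⟨fun a ha x hx => Finset.mem_union_left _ ((h1 hd).1 a ha x hx),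
        fun a ha x hx => Finset.mem_union_left _ ((h1 hd).2 a ha x hx)⟩
    · exact ⟨fun a ha x hx => Finset.mem_union_right _ ((h2 hd).1 a ha x hx),
        fun a ha x hx => Finset.mem_union_right _ ((h2 hd).2 a ha x hx)⟩
  | and G H h1 h2 =>
    obtain ⟨d, hd', e, he, rfl⟩ := Goal.mem_dnf_and.1 hd
    constructor
    · intro a ha x hx
      rcases Multiset.mem_add.1 ha with ha | ha
      · exact Finset.mem_union_left _ ((h1 hd').1 a ha x hx)
      · exact Finset.mem_union_right _ ((h2 he).1 a ha x hx)
    · intro a ha x hx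
      rcases Multiset.mem_add.1 ha with ha | ha
      · exact Finset.mem_union_left _ ((h1 hd').2 a ha x hx)
      · exact Finset.mem_union_right _ ((h2 he).2 a ha x hx)

theorem Goal.mem_vars_subst {σ : ℕ → L.Term ℕ} {G : Goal L K} {y : ℕ} :
    y ∈ (G.subst σ).vars ↔ ∃ x ∈ G.vars, y ∈ (σ x).varFinset := by
  induction G with
  | top => simp [Goal.vars, Goal.subst]
  | user a => exact UserAtom.mem_vars_subst
  | builtIn b => exact BuiltInAtom.mem_vars_subst
  | and G H h1 h2 | or G H h1 h2 =>
    simp only [Goal.vars, Goal.subst, Finset.mem_union, h1, h2, or_and_right, exists_or]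

end NormalForm

/-! ### Configurations -/

section Configurations

variable {L : FirstOrder.Language.{u, v}} {K : ℕ → Type w} {CT : Set (CTAxiom L)}
  {P : Set (Rule L K)}

theorem Config.cls_eq {C D : Config L K} (h : ConfigEquiv CT C D) : C.cls CT = D.cls CT :=
  Quotient.sound h

namespace ConfigEquiv

theorem orCongr_right (C : Config L K) {D D' : Config L K} (h : ConfigEquiv CT D D') :
    ConfigEquiv CT (.or C D) (.or C D') :=
  .trans (.orComm _ _) (.trans (.orCongr C h) (.orComm _ _))

theorem or_failed (C : Config L K) : ConfigEquiv CT (.or C (.state .failed)) C :=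
  .trans (.orComm _ _) (.failedOr C)

theorem empty_or (C : Config L K) : ConfigEquiv CT (.or .empty C) C :=
  .trans (.orCongr C .empty) (.failedOr C)

theorem of_state {S S' : State L K} (h : StateEquiv CT S S') :
    ConfigEquiv CT (.state S) (.state S') :=
  .trans (.symm (or_failed _)) (.trans (.stateEquiv _ h) (or_failed _))

theorem split_state (G H : Goal L K) (V : Finset ℕ) :
    ConfigEquiv CT (.state ⟨.or G H, V⟩) (.or (.state ⟨G, V⟩) (.state ⟨H, V⟩)) :=
  .trans (.symm (or_failed _))
    (.trans (.split G H V _) (orCongr_right _ (or_failed _)))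

theorem or_or_or_comm (C D E F : Config L K) :
    ConfigEquiv CT (.or (.or C D) (.or E F)) (.or (.or C E) (.or D F)) := by
  refine .trans (.orAssoc _ _ _) (.trans (orCongr_right C ?_) (.symm (.orAssoc _ _ _)))
  exact .trans (.symm (.orAssoc _ _ _)) (.trans (.orCongr _ (.orComm _ _)) (.orAssoc _ _ _))

end ConfigEquiv

/-- The class of `C ∨ D` as a function of the class of `C`. -/
def ConfigClass.orRight (CT : Set (CTAxiom L)) (D : Config L K) :
    ConfigClass K CT → ConfigClass K CT :=
  Quotient.map (fun C => .or C D) fun _ _ h => ConfigEquiv.orCongr D h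

theorem Step.orRight (D : Config L K) {c d : ConfigClass K CT} (h : Step CT P c d) :
    Step CT P (c.orRight CT D) (d.orRight CT D) := by
  cases h with
  | apply r r' G V T hr hv hd hm =>
    have := Step.apply (CT := CT) r r' G V (.or T D) hr hv hd hm
    rwa [← Config.cls_eq (.orAssoc _ _ _), ← Config.cls_eq (.orAssoc _ _ _)] at this

theorem Steps.orRight (D : Config L K) {c d : ConfigClass K CT} (h : Steps CT P c d) :
    Steps CT P (c.orRight CT D) (d.orRight CT D) :=
  Relation.ReflTransGen.lift (ConfigClass.orRight CT D) (fun _ _ h => Step.orRight D h) _ _ h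

namespace ConfigEntails

theorem of_equiv {C D : Config L K} (h : ConfigEquiv CT C D) :
    ConfigEntails CT (C.cls CT) (D.cls CT) := by
  rw [Config.cls_eq h]
  exact .refl _

theorem orRight (D : Config L K) {c d : ConfigClass K CT} (h : ConfigEntails CT c d) :
    ConfigEntails CT (c.orRight CT D) (d.orRight CT D) := by
  induction h with
  | refl c => exact .refl _
  | trans _ _ h1 h2 => exact h1.trans h2
  | weaken S T =>
    refine (ConfigEntails.weaken S (.or T D)).trans (.of_equiv ?_)
    exact .symm (.orAssoc _ _ _)
  | redundant S₁ S₂ T h =>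
    have h' := ConfigEntails.redundant S₁ S₂ (.or T D) h
    refine .trans (.of_equiv ?_) (h'.trans (.of_equiv (.symm (.orAssoc _ _ _))))
    exact .trans (.orAssoc _ _ _) (.orCongr_right _ (.orAssoc _ _ _))

theorem or_left (D C : Config L K) :
    ConfigEntails CT (C.cls CT) ((Config.or D C).cls CT) := by
  induction D generalizing C with
  | empty => exact .of_equiv (.symm (.empty_or _))
  | state S => exact .weaken S C
  | or D D' h1 h2 => exact (h2 C).trans ((h1 _).trans (.of_equiv (.symm (.orAssoc _ _ _))))

theorem or_right (C D : Config L K) :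
    ConfigEntails CT (C.cls CT) ((Config.or C D).cls CT) :=
  (or_left D C).trans (.of_equiv (.orComm _ _))

theorem of_state {S S' : State L K} (h : StateEntails CT (S.cls CT) (S'.cls CT)) :
    ConfigEntails CT ((Config.state S).cls CT) ((Config.state S').cls CT) :=
  (or_right _ (.or (.state S') (.state .failed))).trans
    ((ConfigEntails.redundant S S' (.state .failed) h).trans (.of_equiv (.or_failed _)))

/-- Idempotence of `∨` is not among the generators of configuration equivalence; in this direction
of entailment it comes from `redundant` with twice the same state. -/
theorem or_self (C : Config L K) : ConfigEntails CT ((Config.or C C).cls CT) (C.cls CT) := by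
  induction C with
  | empty => exact .of_equiv (.empty_or _)
  | state S =>
    refine .trans (.of_equiv (.orCongr_right _ (.symm (.or_failed _))))
      ((ConfigEntails.redundant S S (.state .failed) (.refl _)).trans (.of_equiv (.or_failed _)))
  | or C D h1 h2 =>
    refine .trans (.of_equiv (.or_or_or_comm _ _ _ _)) ?_
    have h1' := h1.orRight (.or D D)
    have h2' := h2.orRight C
    refine h1'.trans (.trans (.of_equiv (.orComm C (.or D D))) (h2'.trans ?_))
    exact .of_equiv (.orComm D C)

end ConfigEntails

/-- `C` can reach a configuration that entails `T`. -/
def Reach (CT : Set (CTAxiom L)) (P : Set (Rule L K)) (C T : Config L K) : Prop :=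
  ∃ U : Config L K, Steps CT P (C.cls CT) (U.cls CT) ∧ ConfigEntails CT (U.cls CT) (T.cls CT)

namespace Reach

variable {T : Config L K}

theorem of_entails {C : Config L K} (h : ConfigEntails CT (C.cls CT) (T.cls CT)) :
    Reach CT P C T := ⟨C, .refl, h⟩

theorem of_equiv {C D : Config L K} (h : ConfigEquiv CT C D) (hD : Reach CT P D T) :
    Reach CT P C T := by
  obtain ⟨U, h1, h2⟩ := hD
  exact ⟨U, by rwa [Config.cls_eq h], h2⟩

theorem of_state {S S' : State L K} (h : StateEquiv CT S S')
    (hS : Reach CT P (.state S') T) : Reach CT P (.state S) T :=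
  of_equiv (.of_state h) hS

/-- Run `C` with `D` as a spectator, then `D` with the outcome of `C` as a spectator. The two copies
of `T` that are reached merge by `ConfigEntails.or_self`. -/
theorem or {C D : Config L K} (hC : Reach CT P C T) (hD : Reach CT P D T) :
    Reach CT P (.or C D) T := by
  obtain ⟨U, h1, h2⟩ := hC
  obtain ⟨W, h3, h4⟩ := hD
  refine ⟨.or W U, ?_, ?_⟩
  · have h1' := h1.orRight D
    have h3' := h3.orRight U
    refine Relation.ReflTransGen.trans h1' ?_
    have e : ConfigClass.orRight CT D (U.cls CT) = ConfigClass.orRight CT U (D.cls CT) :=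
      Config.cls_eq (.orComm U D)
    rw [e]
    exact h3'
  · have h2' := h2.orRight T
    have h4' := h4.orRight U
    refine h4'.trans (.trans (.of_equiv (.orComm T U)) (h2'.trans (.or_self T)))

theorem failed : Reach CT P (.state .failed) T :=
  of_entails ((ConfigEntails.or_right _ T).trans (.of_equiv (.failedOr T)))

theorem step {r r' : Rule L K} {G : Goal L K} {V : Finset ℕ} (hr : r ∈ P)
    (hv : r'.IsVariant r)
    (hd : Disjoint r'.localVars (User.vars r'.kept ∪ User.vars r'.removed ∪ G.vars ∪ V))
    (hm : Models CT (BuiltIn.toFormula (.and r'.guard G.store)).exClosure)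
    (h : Reach CT P (.state ⟨.and (User.toGoal r'.kept) (.and (BuiltIn.toGoal K r'.guard)
          (.and r'.body G)), V⟩) T) :
    Reach CT P (.state ⟨.and (User.toGoal r'.kept) (.and (User.toGoal r'.removed)
          (.and (BuiltIn.toGoal K r'.guard) G)), V⟩) T := by
  obtain ⟨U, h1, h2⟩ := h
  refine ⟨U, .head ?_ h1, h2⟩
  have := Step.apply (CT := CT) r r' G V (.state .failed) hr hv hd hm
  rwa [Config.cls_eq (.or_failed _), Config.cls_eq (.or_failed _)] at this

theorem of_cls_eq {G G' : Goal L K} {V : Finset ℕ} (h : G.cls = G'.cls)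
    (hG : Reach CT P (.state ⟨G', V⟩) T) : Reach CT P (.state ⟨G, V⟩) T :=
  of_state (.of_cls_eq V h) hG

/-- A store with `⊥` is equivalent to the failed state, which is neutral for `∨` and therefore
entails every configuration. -/
theorem of_bot_mem {U : Multiset (UserAtom L K)} {B : Multiset (BuiltInAtom L)} {V : Finset ℕ}
    (h : .bot ∈ B) : Reach CT P (.state (storeState U B V)) T := by
  obtain ⟨B, rfl⟩ := Multiset.exists_cons_of_mem h
  have e : (storeState U (.bot ::ₘ B) V).goal.cls =
      (Goal.and (storeState U B V).goal (.builtIn .bot)).cls := by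
    rw [Goal.cls_and, cls_storeState, cls_storeState, Multiset.map_cons, Multiset.sum_cons]
    abel
  refine of_cls_eq (G := (storeState U (.bot ::ₘ B) V).goal) e ?_
  refine of_state (.trans (.failed _ .top V ∅) (.of_cls_eq ∅ ?_)) failed
  rw [Goal.cls_and, Goal.cls_top, zero_add]

theorem of_unsat {U : Multiset (UserAtom L K)} {B : Multiset (BuiltInAtom L)} {V : Finset ℕ}
    (h : CTEntails CT (conjFormula B) .bot) : Reach CT P (.state (storeState U B V)) T :=
  of_state (.add_entailed (B' := {.bot}) fun b hb => by rwa [Multiset.mem_singleton.1 hb]) (of_bot_mem (by simp))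

/-- The disjuncts can be treated separately because `∨` in a goal splits the state. The context `H`
is general because distributivity needs a conjunct next to the disjunction, and because one factor
of a conjunction becomes context while the other is expanded. -/
theorem of_dnf {H G : Goal L K} {V : Finset ℕ}
    (h : ∀ d ∈ G.dnf, Reach CT P (.state ⟨.and H d.goal, V⟩) T) :
    Reach CT P (.state ⟨.and H G, V⟩) T := by
  induction G generalizing H with
  | top | user a | builtIn b =>
    refine of_cls_eq ?_ (h _ (List.mem_singleton_self _))
    simp [Goal.cls_and, Store.cls_goal, Goal.cls_top]
  | or G G' h1 h2 =>
    refine of_state (.goal V (.distrib _ _ _)) (of_equiv (.split_state _ _ _) (.or ?_ ?_))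
    · exact h1 fun d hd => h d (List.mem_append_left _ hd)
    · exact h2 fun d hd => h d (List.mem_append_right _ hd)
  | and G G' h1 h2 =>
    refine of_state (.goal V (.symm (.andAssoc _ _ _))) (h2 fun e he => ?_)
    refine of_cls_eq (G' := .and (.and H e.goal) G) ?_ (h1 fun d hd => ?_)
    · simp only [Goal.cls_and]
      abel
    · refine of_cls_eq ?_ (h (d + e) (Goal.mem_dnf_and.2 ⟨d, hd, e, he, rfl⟩))
      simp only [Goal.cls_and, Store.cls_goal_add]
      abel

end Reach

theorem ConfigEntails.of_mem_dnf {H G : Goal L K} {V : Finset ℕ} {d : Store L K}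
    (hd : d ∈ G.dnf) : ConfigEntails CT ((Config.state ⟨.and H d.goal, V⟩).cls CT)
      ((Config.state ⟨.and H G, V⟩).cls CT) := by
  induction G generalizing H d with
  | top | user a | builtIn b =>
    obtain rfl := List.mem_singleton.1 hd
    refine .of_equiv (.of_state (.of_cls_eq V ?_))
    simp [Goal.cls_and, Store.cls_goal, Goal.cls_top]
  | or G G' h1 h2 =>
    have e : ConfigEquiv CT (.or (.state ⟨.and H G, V⟩) (.state ⟨.and H G', V⟩))
        (.state ⟨.and H (.or G G'), V⟩) :=
      .trans (.symm (.split_state _ _ _)) (.of_state (.goal V (.symm (.distrib _ _ _))))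
    rcases List.mem_append.1 hd with hd | hd
    · exact (h1 hd).trans ((ConfigEntails.or_right _ _).trans (.of_equiv e))
    · exact (h2 hd).trans ((ConfigEntails.or_left _ _).trans (.of_equiv e))
  | and G G' h1 h2 =>
    obtain ⟨d, hd', e, he, rfl⟩ := Goal.mem_dnf_and.1 hd
    refine .trans (.of_equiv (.of_state (.of_cls_eq V (G' := .and (.and H e.goal) d.goal) ?_)))
      ((h1 hd').trans (.trans (.of_equiv (.of_state (.of_cls_eq V
        (G' := .and (.and H G) e.goal) ?_))) ((h2 he).trans
          (.of_equiv (.of_state (.goal V (.andAssoc _ _ _)))))))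
    · simp only [Goal.cls_and, Store.cls_goal_add]
      abel
    · simp only [Goal.cls_and]
      abel

end Configurations

/-! ### Translations and substitution -/

section Translations

variable {L : FirstOrder.Language.{u, v}} {K : ℕ → Type w}

theorem Formula.star_subst (σ : ℕ → L.Term ℕ) (φ : Formula L) :
    (φ.subst σ).star K = (φ.star K).subst σ := by
  induction φ generalizing σ with
  | top | bot | eq | rel => rfl
  | and φ ψ h1 h2 | or φ ψ h1 h2 | imp φ ψ h1 h2 =>
    simp only [Formula.subst, Formula.star, LFormula.subst, h1, h2]
  | all φ h | ex φ h => simp only [Formula.subst, Formula.star, LFormula.subst, h]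

theorem Formula.star_exVars (X : Finset ℕ) (φ : Formula L) :
    (exVars X φ).star K = LFormula.exVars X (φ.star K) := by
  rw [exVars, LFormula.exVars]
  induction X.sort (· ≤ ·) with
  | nil => rfl
  | cons x xs ih => simp only [List.foldr_cons, Formula.star, Formula.star_subst, ih]

theorem BuiltIn.star_toFormula (B : BuiltIn L) :
    (BuiltIn.toFormula B).star K = (BuiltIn.toGoal K B).toL := by
  induction B with
  | top => rfl
  | atom b => cases b <;> rfl
  | and B C h1 h2 => simp only [BuiltIn.toFormula, Formula.star, BuiltIn.toGoal, Goal.toL, h1, h2]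

theorem Goal.fv_toL (G : Goal L K) : G.toL.fv = G.vars := by
  induction G with
  | top => rfl
  | user a => cases a; rfl
  | builtIn b => cases b <;> rfl
  | and G H h1 h2 | or G H h1 h2 => simp only [Goal.toL, LFormula.fv, Goal.vars, h1, h2]

theorem Goal.toL_subst (σ : ℕ → L.Term ℕ) (G : Goal L K) :
    (G.subst σ).toL = G.toL.subst σ := by
  induction G with
  | top => rfl
  | user a => cases a; rfl
  | builtIn b => cases b <;> rfl
  | and G H h1 h2 | or G H h1 h2 => simp only [Goal.subst, Goal.toL, LFormula.subst, h1, h2]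

end Translations

/-! ### The canonical phase model -/

section Canonical

variable {L : FirstOrder.Language.{u, v}} {K : ℕ → Type w} {CT : Set (CTAxiom L)}
  {P : Set (Rule L K)} {V : Finset ℕ} {T : Config L K}

/-- The phase model of stores whose pole consists of the stores that reach `T` together with
arbitrary additional built-in constraints. -/
def canonicalModel (CT : Set (CTAxiom L)) (P : Set (Rule L K)) (V : Finset ℕ) (T : Config L K) :
    PhaseModel L K (Store L K) where
  -- Quantifying over the extra constraints `c` makes the pole stable under adding built-in
  -- constraints, which is what weakening of banged atoms requires.
  pole := {d | ∀ c : Multiset (BuiltInAtom L), Reach CT P (.state (storeState d.1 (d.2 + c) V)) T}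
  user c ts := ({.mk c ts}, 0)
  eq t s := (0, {.eq t s})
  rel R ts := (0, {.rel R ts})

local notation "𝓒" => canonicalModel CT P V T

open PhaseModel

/-- Weakening holds by the choice of the pole. Contraction holds because repeating built-in
constraints yields an equivalent state. -/
theorem builtIn_mem_free (B : Multiset (BuiltInAtom L)) :
    ((0, B) : Store L K) ∈ (𝓒).free := by
  refine ⟨fun n hn c => ?_, fun n hn c => ?_⟩
  · have := hn (B + c)
    rw [← add_assoc, add_comm n.2] at this
    simpa only [Prod.fst_add, Prod.snd_add, zero_add] using this
  · refine .of_state (.add_entailed (B' := B) fun b hb => conjFormula_le ?_) ?_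
    · simp [hb]
    · have := hn c
      simp only [Prod.fst_add, Prod.snd_add, zero_add] at this ⊢
      convert this using 3
      abel

theorem mem_of_mem_cl_of_forall {F : Set (Store L K)} (hF : (𝓒).IsFact F) {d : Store L K}
    (h : ∀ n ∈ (𝓒).neg F, ∀ c : Multiset (BuiltInAtom L),
      Reach CT P (.state (storeState (d.1 + n.1) (d.2 + n.2 + c) V)) T) : d ∈ F :=
  hF fun n hn c => h n hn c

theorem mem_sem_bot (d : Store L K) (h : .bot ∈ d.2) : d ∈ (𝓒).cl ∅ := fun n _ c =>
  .of_bot_mem (by simp [h])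

/-- Together with `sem_subset_of_dnf` this says that the fact of a goal is the least fact containing
the instances of its disjuncts. A store with `⊥` lies in every fact, since it reaches everything in
any context. -/
theorem mem_sem_of_mem_dnf {G : Goal L K} {d : Store L K} (hd : d ∈ G.dnf) (σ : ℕ → L.Term ℕ) :
    Store.subst σ d ∈ (𝓒).sem G.toL σ := by
  induction G generalizing d with
  | top =>
    obtain rfl := List.mem_singleton.1 hd
    exact subset_cl _ rfl
  | user a =>
    obtain rfl := List.mem_singleton.1 hd
    cases a
    exact subset_cl _ (by simp [Store.subst, canonicalModel, UserAtom.subst])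
  | builtIn b =>
    obtain rfl := List.mem_singleton.1 hd
    cases b with
    | bot => exact mem_sem_bot _ (by simp [Store.subst, BuiltInAtom.subst])
    | eq t s =>
      refine subset_cl _ ⟨subset_cl _ ?_, ?_⟩
      · simp [Store.subst, canonicalModel, BuiltInAtom.subst]
      · exact builtIn_mem_free _
    | rel R ts =>
      refine subset_cl _ ⟨subset_cl _ ?_, ?_⟩
      · simp [Store.subst, canonicalModel, BuiltInAtom.subst]
      · exact builtIn_mem_free _
  | and G H h1 h2 =>
    obtain ⟨d, hd', e, he, rfl⟩ := Goal.mem_dnf_and.1 hd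
    rw [Store.subst_add]
    exact subset_cl _ (Set.add_mem_add (h1 hd') (h2 he))
  | or G H h1 h2 =>
    rcases List.mem_append.1 hd with hd | hd
    · exact subset_cl _ (.inl (h1 hd))
    · exact subset_cl _ (.inr (h2 hd))

/-- For `∧` the bound is curried: the elements that send the fact of one factor into `F` again form
a fact, so the two induction hypotheses apply one after the other. -/
theorem sem_subset_of_dnf {G : Goal L K} {σ : ℕ → L.Term ℕ} {F : Set (Store L K)}
    (hF : (𝓒).IsFact F) (h : ∀ d ∈ G.dnf, Store.subst σ d ∈ F) : (𝓒).sem G.toL σ ⊆ F := by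
  induction G generalizing F with
  | top =>
    refine cl_subset hF ?_
    rintro _ rfl
    exact h 0 (List.mem_singleton_self _)
  | user a =>
    have h := h _ (List.mem_singleton_self _)
    cases a
    refine cl_subset hF ?_
    rintro _ rfl
    simpa [Store.subst, canonicalModel, UserAtom.subst] using h
  | builtIn b =>
    have h := h _ (List.mem_singleton_self _)
    cases b with
    | bot => exact cl_subset hF (Set.empty_subset _)
    | eq | rel =>
      refine cl_subset hF (Set.inter_subset_left.trans (cl_subset hF ?_))
      rintro _ rfl
      simpa [Store.subst, canonicalModel, BuiltInAtom.subst] using h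
  | and G H h1 h2 =>
    refine cl_subset hF ?_
    rintro _ ⟨x, hx, y, hy, rfl⟩
    refine h1 (isFact_lolli (X := (𝓒).sem H.toL σ) hF) (fun d hd y hy => ?_) hx y hy
    have := h2 (isFact_lolli (X := {Store.subst σ d}) hF) (fun e he z hz => ?_) hy
    · rw [add_comm]
      exact this _ rfl
    · obtain rfl := hz
      rw [add_comm, ← Store.subst_add]
      exact h _ (Goal.mem_dnf_and.2 ⟨d, hd, e, he, rfl⟩)
  | or G H h1 h2 =>
    refine cl_subset hF (Set.union_subset (h1 hF fun d hd => ?_) (h2 hF fun d hd => ?_))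
    · exact h d (List.mem_append_left _ hd)
    · exact h d (List.mem_append_right _ hd)

theorem zero_mem_bang {α : LFormula L K} {σ : ℕ → L.Term ℕ} (h : 0 ∈ (𝓒).sem α σ) :
    0 ∈ (𝓒).sem (.bang α) σ :=
  subset_cl _ ⟨h, zero_mem_free⟩

theorem zero_mem_lolli {α β : LFormula L K} {σ : ℕ → L.Term ℕ}
    (h : (𝓒).sem α σ ⊆ (𝓒).sem β σ) : 0 ∈ (𝓒).sem (.lolli α β) σ := fun x hx => by
  rw [zero_add]
  exact h hx

theorem zero_mem_star_allVars {X : Finset ℕ} {φ : Formula L}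
    (h : ∀ τ, 0 ∈ (𝓒).sem (φ.star K) τ) (σ : ℕ → L.Term ℕ) :
    0 ∈ (𝓒).sem ((Formula.allVars X φ).star K) σ := by
  rw [Formula.allVars]
  induction X.sort (· ≤ ·) generalizing σ with
  | nil => exact h σ
  | cons x xs ih =>
    refine zero_mem_bang (Set.mem_iInter.2 fun t => ?_)
    rw [Formula.star_subst, sem_bind]
    exact ih _

theorem exists_bound (X : Finset ℕ) : ∃ N, ∀ x ∈ X, x < N :=
  ⟨_, fun _ hx => Nat.lt_succ_of_le (Finset.le_sup (f := id) hx)⟩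

theorem exists_bound_subst (X : Finset ℕ) (σ : ℕ → L.Term ℕ) :
    ∃ N, ∀ x ∈ X, ∀ z ∈ (σ x).varFinset, z < N := by
  obtain ⟨N, hN⟩ := exists_bound (X.biUnion fun x => (σ x).varFinset)
  exact ⟨N, fun x hx z hz => hN z (Finset.mem_biUnion.2 ⟨x, hx, hz⟩)⟩

theorem exists_bound_store (d : Store L K) :
    ∃ N, (∀ a ∈ d.1, ∀ x ∈ a.vars, x < N) ∧ ∀ a ∈ d.2, ∀ x ∈ a.vars, x < N := by
  obtain ⟨N, hN⟩ := exists_bound (storeState d.1 d.2 ∅).goal.vars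
  exact ⟨N, fun a ha x hx => hN x (mem_vars_storeState.2 (.inl ⟨a, ha, hx⟩)),
    fun a ha x hx => hN x (mem_vars_storeState.2 (.inr ⟨a, ha, hx⟩))⟩

/-- A store with an instance of the left-hand side entails the quantified right-hand side. By
`StateEquiv.add_ex` the latter can be added under fresh names without changing the state, and those
added atoms lie in the fact of the right-hand side. -/
theorem zero_mem_ctAxiom {α : CTAxiom L} (hα : α ∈ CT) (σ : ℕ → L.Term ℕ) :
    0 ∈ (𝓒).sem (α.toFormula.star K) σ := by
  have hCT := CTAxiom.closed CT
  refine zero_mem_star_allVars (fun σ => zero_mem_bang (zero_mem_lolli ?_)) σ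
  have hF := isFact_sem (𝓜 := 𝓒) ((BuiltIn.exFormula α.rhsVars α.rhs).star K) σ
  rw [BuiltIn.exFormula, Formula.star_exVars, BuiltIn.star_toFormula]
  refine sem_exVars_subset hF fun τ hτ => sem_subset_of_dnf hF fun d hd => ?_
  rw [BuiltIn.dnf_toGoal] at hd
  obtain rfl := List.mem_singleton.1 hd
  refine mem_of_mem_cl_of_forall hF fun n hn c => ?_
  simp only [Store.subst, Multiset.map_zero, zero_add]
  set B := α.lhs.atoms.map (BuiltInAtom.subst τ) + n.2 + c with hB
  obtain ⟨N1, h1⟩ := exists_bound V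
  obtain ⟨N2, h2⟩ := exists_bound_store (n.1, B)
  obtain ⟨N3, h3⟩ := exists_bound_subst (BuiltIn.vars α.rhs) σ
  let N := N1 + N2 + N3
  let ρ := freshen N α.rhsVars σ
  refine .of_state (.add_ex (X := α.rhsVars.map (addLeftEmbedding N))
    (B' := α.rhs.atoms.map (BuiltInAtom.subst ρ)) ?_ ?_ ?_ ?_) ?_
  · intro x hx hxV
    obtain ⟨y, hy, rfl⟩ := Finset.mem_map.1 hx
    have := h1 _ hxV
    simp only [addLeftEmbedding_apply, N] at this
    omega
  · intro x hx a ha hxV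
    obtain ⟨y, hy, rfl⟩ := Finset.mem_map.1 hx
    have := h2.1 a ha _ hxV
    simp only [addLeftEmbedding_apply, N] at this
    omega
  · intro x hx a ha hxV
    obtain ⟨y, hy, rfl⟩ := Finset.mem_map.1 hx
    have := h2.2 a ha _ hxV
    simp only [addLeftEmbedding_apply, N] at this
    omega
  · have e1 : CTEntails CT (conjFormula B) ((BuiltIn.toFormula α.lhs).subst τ) := by
      rw [← BuiltIn.toFormula_subst]
      refine BuiltIn.le_toFormula fun b hb => conjFormula_le ?_
      rw [BuiltIn.atoms_subst] at hb
      simp [hB, hb]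
    -- `τ` differs from `σ` only on the quantified variables, so its values there are witnesses.
    have e2 : CTEntails CT ((BuiltIn.toFormula α.lhs).subst τ)
        ((Formula.exVars α.lhsVars (BuiltIn.toFormula α.lhs)).subst σ) :=
      .le_exVars_subst hCT fun y _ hy => hτ y hy
    have e3 : CTEntails CT ((Formula.exVars α.lhsVars (BuiltIn.toFormula α.lhs)).subst σ)
        ((Formula.exVars α.rhsVars (BuiltIn.toFormula α.rhs)).subst σ) :=
      Formula.Provable.impE (Formula.Entails.univClosure_le hCT (.imp
        (BuiltIn.exFormula α.lhsVars α.lhs) (BuiltIn.exFormula α.rhsVars α.rhs)) σ) (.hyp ⟨α, hα, rfl⟩)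
    refine e1.trans (e2.trans (e3.trans ?_))
    refine .exVars_subst_le hCT (ρ := fun x => N + x) (τ := ρ) (fun x _ y _ h => by simpa using h)
      (fun x hx => if_pos hx) (fun y _ hy => if_neg hy) (fun x hx hx' => ?_)
      (fun x hx y hy _ hx' => ?_) ?_
    · exact (Formula.mem_fv_exVars hx').2 (Finset.mem_map.2 ⟨x, hx, rfl⟩)
    · rw [BuiltIn.fv_toFormula] at hy
      have := h3 y hy _ hx'
      simp only [N] at this
      omega
    · refine .trans ?_ (Formula.Entails.le_exVars_self hCT _ _)
      refine le_conjFormula fun b hb => ?_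
      rw [← BuiltIn.toFormula_subst]
      refine BuiltIn.le_atom ?_
      rwa [BuiltIn.atoms_subst]
  · have hmem : ((0, α.rhs.atoms.map (BuiltInAtom.subst ρ)) : Store L K) ∈
        (𝓒).sem ((BuiltIn.exFormula α.rhsVars α.rhs).star K) σ := by
      rw [BuiltIn.exFormula, Formula.star_exVars, BuiltIn.star_toFormula]
      refine sem_subset_exVars (fun x hx => ?_) (mem_sem_of_mem_dnf (G := BuiltIn.toGoal K α.rhs)
        (d := (0, α.rhs.atoms)) ?_ ρ)
      · exact if_neg hx
      · rw [BuiltIn.dnf_toGoal]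
        exact List.mem_singleton_self _
    -- The orthogonality of `n` concerns only the right-hand side; the left-hand instance, still in
    -- the store, is passed as part of the arbitrary extra constraints.
    have := hn _ hmem (α.lhs.atoms.map (BuiltInAtom.subst τ) + c)
    simp only [Prod.fst_add, Prod.snd_add, add_zero] at this
    convert this using 3
    rw [hB]
    abel

/-- The `j`-th argument is abstracted to a fresh variable `N + j`. Given `σ j ≐ σ n`, its defining
equation with `σ j` may be exchanged for the one with `σ n`, and folding back gives the constraint
with the argument replaced. -/
theorem zero_mem_equalityL (hEq : HasEquality CT) {n : ℕ} (c : K n) (j : Fin n)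
    (σ : ℕ → L.Term ℕ) : 0 ∈ (𝓒).sem (equalityL c j) σ := by
  refine zero_mem_bang (mem_sem_allVars.2 fun σ _ => zero_mem_lolli ?_)
  let x : Fin n → L.Term ℕ := fun i => .var i
  let y : L.Term ℕ := .var n
  change (𝓒).sem (Goal.and (.user (.mk c x)) (.builtIn (.eq (x j) y))).toL σ ⊆
    (𝓒).sem (Goal.and (.user (.mk c (Function.update x j y))) (.builtIn (.eq (x j) y))).toL σ
  refine sem_subset_of_dnf (isFact_sem _ σ) fun d hd => ?_
  have hd' : d = ({.mk c x}, {.eq (x j) y}) := by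
    simpa [Goal.dnf] using hd
  subst hd'
  refine mem_of_mem_cl_of_forall (isFact_sem _ σ) fun m hm e => ?_
  have hmem := mem_sem_of_mem_dnf (CT := CT) (P := P) (V := V) (T := T)
    (G := .and (.user (.mk c (Function.update x j y))) (.builtIn (.eq (x j) y)))
    (d := ({.mk c (Function.update x j y)}, {.eq (x j) y})) (by simp [Goal.dnf]) σ
  have hr := hm _ hmem e
  simp only [Store.subst, Multiset.map_singleton, Prod.fst_add, Prod.snd_add] at hr ⊢
  set b : BuiltInAtom L := BuiltInAtom.subst σ (.eq (x j) y) with hb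
  have hb' : b = .eq (σ j) (σ n) := rfl
  let σ' := Function.update σ j (σ n)
  obtain ⟨N1, h1⟩ := exists_bound V
  obtain ⟨N2, h2⟩ := exists_bound_store (m.1, m.2 + {b} + e)
  obtain ⟨N3, h3⟩ := exists_bound_subst (Finset.range (n + 1)) σ
  let N := N1 + N2 + N3
  -- Abstraction of the `j`-th argument, stated for a general valuation because it is used for `σ`
  -- and for its update `σ'` at `j`.
  have hexp := fun (σ'' : ℕ → L.Term ℕ) (hσ : ∀ x < n, ∀ z ∈ (σ'' x).varFinset, z < N3) =>
    StateEquiv.expand (CT := CT) hEq (U := m.1) (W := {UserAtom.mk c x}) (B := m.2 + {b} + e)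
      (C := 0) (V := V) (Z := {j.val}) (E := {j.val}) (σ := σ'') (N := N)
      (fun x hx => (h1 x hx).trans_le (by omega))
      (fun a ha x hx => (h2.1 a ha x hx).trans_le (by omega))
      (fun a ha x hx => (h2.2 a ha x hx).trans_le (by omega)) subset_rfl (fun _ _ _ _ h => h)
      (fun a ha z hz z' hz' => by
        obtain rfl := Multiset.mem_singleton.1 ha
        simp only [UserAtom.vars, x, Finset.mem_biUnion, Term.mem_varFinset_var] at hz
        obtain ⟨i, -, rfl⟩ := hz
        exact (hσ i i.2 z' hz').trans_le (by omega))
      (by simp) (fun z hz z' hz' => by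
        obtain rfl := Finset.mem_singleton.1 hz
        exact (hσ j j.2 z' hz').trans_le (by omega))
  have ha := hexp σ fun z hz => h3 z (by simp; omega)
  have hc := hexp σ' fun z hz z' hz' => by
    by_cases hzj : z = j
    · subst hzj
      simp only [σ', Function.update_self] at hz'
      exact h3 n (by simp) z' hz'
    · simp only [σ', Function.update_of_ne hzj] at hz'
      exact h3 z (by simp; omega) z' hz'
  -- The valuations differ only at `j`, where the pattern carries the fresh variable; both
  -- expansions have the same pattern.
  have ef : freshen N {j.val} σ' = freshen N {j.val} σ := by
    funext z
    by_cases hzj : z = j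
    · simp [freshen, hzj]
    · simp [freshen, hzj, σ']
  rw [ef] at hc
  simp only [Multiset.map_singleton, Multiset.map_zero, add_zero, zero_add] at ha hc
  have e1 : UserAtom.subst σ' (.mk c x) = UserAtom.subst σ (.mk c (Function.update x j y)) := by
    simp only [UserAtom.subst]
    congr 1
    funext i
    by_cases hij : i = j
    · subst hij
      simp [x, y, σ', FirstOrder.Language.Term.subst]
    · have : (i : ℕ) ≠ j := fun h => hij (Fin.ext h)
      simp [x, σ', FirstOrder.Language.Term.subst, hij, this]
  rw [e1] at hc
  have hfe : ∀ σ'' : ℕ → L.Term ℕ, freshEqs N {j.val} σ'' = {.eq (.var (N + j)) (σ'' j)} := by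
    intro σ''
    simp [freshEqs, eqs, unfreshen_add]
  rw [hfe] at ha hc
  have hj' : σ' j = σ n := by simp [σ']
  rw [hj'] at hc
  -- The equality axiom applied to `z ≐ r`, with `z` not in `r`; symmetry then follows by
  -- reflexivity.
  have symm_trans : ∀ {φ : Formula L} {t s r : L.Term ℕ}, CTEntails CT φ (.eq s t) →
      CTEntails CT φ (.eq s r) → CTEntails CT φ (.eq t r) := by
    intro φ t s r hst hsr
    obtain ⟨z, hz⟩ := exists_bound r.varFinset
    have h := hEq.2 (.eq (.var z) r) z s t
    have er : ∀ q, r.subst (single z q) = r := fun q => Term.subst_eq_self _ fun i hi =>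
      Function.update_of_ne (hz i hi).ne _ _
    simp only [BuiltInAtom.subst, BuiltInAtom.toFormula, FirstOrder.Language.Term.subst, er] at h
    simp only [single, Function.update_self] at h
    exact (Formula.Entails.le_and hst hsr).trans h
  have symm : ∀ {φ : Formula L} {t s : L.Term ℕ}, CTEntails CT φ (.eq s t) →
      CTEntails CT φ (.eq t s) := fun h => symm_trans h (.of_provable (hEq.1 _))
  have hz1 : StateEquiv CT
      (storeState (m.1 + {UserAtom.subst (freshen N {j.val} σ) (.mk c x)})
        (m.2 + {b} + e + {.eq (.var (N + j)) (σ j)}) V)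
      (storeState (m.1 + {UserAtom.subst (freshen N {j.val} σ) (.mk c x)})
        (m.2 + {b} + e + {.eq (.var (N + j)) (σ n)}) V) := by
    have a1 := StateEquiv.add_entailed (CT := CT) (V := V)
      (U := m.1 + {UserAtom.subst (freshen N {j.val} σ) (.mk c x)})
      (B := m.2 + {b} + e + {.eq (.var (N + j)) (σ j)}) (B' := {.eq (.var (N + j)) (σ n)})
      (fun a ha => by
        obtain rfl := Multiset.mem_singleton.1 ha
        refine symm_trans (s := σ j) (symm ?_) ?_
        · exact conjFormula_le (b := .eq (.var (N + j)) (σ j)) (by simp)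
        · exact conjFormula_le (b := .eq (σ j) (σ n)) (by simp [hb']))
    have a2 := StateEquiv.add_entailed (CT := CT) (V := V)
      (U := m.1 + {UserAtom.subst (freshen N {j.val} σ) (.mk c x)})
      (B := m.2 + {b} + e + {.eq (.var (N + j)) (σ n)}) (B' := {.eq (.var (N + j)) (σ j)})
      (fun a ha => by
        obtain rfl := Multiset.mem_singleton.1 ha
        refine symm_trans (s := σ n) (symm ?_) (symm ?_)
        · exact conjFormula_le (b := .eq (.var (N + j)) (σ n)) (by simp)
        · exact conjFormula_le (b := .eq (σ j) (σ n)) (by simp [hb']))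
    rw [add_right_comm _ _ ({.eq (.var (N + j)) (σ j)} : Multiset (BuiltInAtom L))] at a2
    exact a1.trans a2.symm
  rw [add_comm {UserAtom.subst σ (.mk c x)} m.1, add_comm {b} m.2]
  exact .of_state (ha.trans (hz1.trans hc.symm)) hr

end Canonical

/-! ### Validity of the program in the canonical model, and completeness -/

section Canonical

variable {L : FirstOrder.Language.{u, v}} {K : ℕ → Type w} {CT : Set (CTAxiom L)}
  {P : Set (Rule L K)} {V : Finset ℕ} {T : Config L K}

local notation "𝓒" => canonicalModel CT P V T

open PhaseModel

theorem UserAtom.subst_comp_eq {σ τ θ : ℕ → L.Term ℕ} {W : Multiset (UserAtom L K)}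
    (h : ∀ a ∈ W, ∀ x ∈ a.vars, (σ x).subst θ = τ x) :
    (W.map (.subst σ)).map (.subst θ) = W.map (UserAtom.subst τ) := by
  rw [Multiset.map_map]
  refine Multiset.map_congr rfl fun a ha => ?_
  rw [Function.comp_apply, UserAtom.subst_subst]
  exact a.subst_congr (h a ha)

/-- Completeness of the theory enters here. If guard and store are consistent, the transition is
allowed and the body is split into its disjuncts. Otherwise the store entails `⊥`, and a failed
state reaches everything. -/
theorem Reach.of_complete_step (hComplete : IsComplete CT) {r r' : Rule L K} {d : Store L K}
    (hr : r ∈ P) (hv : r'.IsVariant r)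
    (hd : Disjoint r'.localVars (User.vars r'.kept ∪ User.vars r'.removed ∪ d.goal.vars ∪ V))
    (h : ∀ e ∈ r'.body.dnf, Reach CT P (.state (storeState (r'.kept.atoms + d.1 + e.1)
      (r'.guard.atoms + d.2 + e.2) V)) T) :
    Reach CT P (.state (storeState (r'.kept.atoms + r'.removed.atoms + d.1)
      (r'.guard.atoms + d.2) V)) T := by
  rcases hComplete (.and r'.guard d.goal.store) with hm | hm
  · refine .of_cls_eq (G := (storeState (r'.kept.atoms + r'.removed.atoms + d.1)
      (r'.guard.atoms + d.2) V).goal) ?_ (.step hr hv hd hm ?_)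
    · simp only [cls_storeState, Goal.cls_and, User.cls_toGoal, BuiltIn.cls_toGoal,
        Store.cls_goal, Multiset.map_add, Multiset.sum_add]
      abel
    · refine .of_cls_eq (G' := .and (.and (User.toGoal r'.kept)
        (.and (BuiltIn.toGoal K r'.guard) d.goal)) r'.body) ?_ (.of_dnf fun e he => ?_)
      · simp only [Goal.cls_and]
        abel
      · refine .of_cls_eq (G' := (storeState (r'.kept.atoms + d.1 + e.1)
          (r'.guard.atoms + d.2 + e.2) V).goal) ?_ (h e he)
        simp only [cls_storeState, Goal.cls_and, User.cls_toGoal, BuiltIn.cls_toGoal,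
          Store.cls_goal, Multiset.map_add, Multiset.sum_add]
        abel
  · refine .of_unsat (.trans ?_ hm)
    refine .trans (BuiltIn.le_toFormula (B := .and r'.guard d.goal.store) fun b hb => ?_)
      (Formula.Entails.le_exVars_self (CTAxiom.closed CT) _ _)
    refine conjFormula_le ?_
    rwa [Conj.atoms, Store.atoms_store_goal] at hb

/-- A store with the instance `σ` of heads and guard is unfolded into a fresh variant of the heads
plus equations, so that the transition applies. After it, solving the equations exhibits an element
of the fact `F` of the right-hand side for every disjunct of the body, and `m`, being orthogonal to
`F`, leads to `T`. -/
theorem zero_mem_rule (hEq : HasEquality CT) (hComplete : IsComplete CT) {r : Rule L K}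
    (hr : r ∈ P) (σ : ℕ → L.Term ℕ) : 0 ∈ (𝓒).sem r.toL σ := by
  refine zero_mem_bang (mem_sem_allVars.2 fun σ _ => zero_mem_lolli ?_)
  set F := (𝓒).sem (.tensor (User.toGoal r.kept).toL
      (LFormula.exVars r.localVars (.tensor r.body.toL (BuiltIn.toGoal K r.guard).toL))) σ with hFdef
  have hF : (𝓒).IsFact F := isFact_sem _ σ
  change (𝓒).sem (Goal.and (User.toGoal r.kept) (.and (User.toGoal r.removed)
    (BuiltIn.toGoal K r.guard))).toL σ ⊆ F
  refine sem_subset_of_dnf hF fun d hd => ?_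
  have hd' : d = (r.kept.atoms + r.removed.atoms, r.guard.atoms) := by
    simpa [Goal.dnf, User.dnf_toGoal, BuiltIn.dnf_toGoal] using hd
  subst hd'
  refine mem_of_mem_cl_of_forall hF fun m hm c => ?_
  -- all renamed variables are above `N`
  obtain ⟨N1, h1⟩ := exists_bound V
  obtain ⟨N2, h2⟩ := exists_bound_store (m.1, m.2 + c)
  obtain ⟨N3, h3⟩ := exists_bound_subst r.vars σ
  let N := N1 + N2 + N3
  let E := User.vars r.kept ∪ User.vars r.removed
  have hEr : E ⊆ r.vars := fun x hx => by
    simp only [E, Rule.vars, Finset.mem_union] at hx ⊢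
    tauto
  have hkept : ∀ a ∈ r.kept.atoms, ∀ x ∈ a.vars, x ∈ E := fun a ha x hx =>
    Finset.mem_union_left _ (User.mem_vars.2 ⟨a, ha, hx⟩)
  have hremoved : ∀ a ∈ r.removed.atoms, ∀ x ∈ a.vars, x ∈ E := fun a ha x hx =>
    Finset.mem_union_right _ (User.mem_vars.2 ⟨a, ha, hx⟩)
  have hguard : ∀ a ∈ r.guard.atoms, ∀ x ∈ a.vars, x ∈ r.vars := fun a ha x hx => by
    have := BuiltIn.mem_vars.2 ⟨a, ha, hx⟩
    simp only [Rule.vars, Finset.mem_union]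
    tauto
  have hbody : ∀ x ∈ r.body.vars, x ∈ r.vars := fun x hx => by
    simp only [Rule.vars, Finset.mem_union]
    tauto
  have hH : ∀ a ∈ r.kept.atoms + r.removed.atoms, ∀ x ∈ a.vars, x ∈ E := fun a ha =>
    (Multiset.mem_add.1 ha).elim (hkept a) (hremoved a)
  have hσN : ∀ x ∈ r.vars, ∀ z ∈ (σ x).varFinset, z < N := fun x hx z hz =>
    (h3 x hx z hz).trans_le (by omega)
  have hm1 : ∀ a ∈ m.1, ∀ x ∈ a.vars, x < N := fun a ha x hx =>
    (h2.1 a ha x hx).trans_le (by omega)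
  have hm2 : ∀ a ∈ m.2 + c, ∀ x ∈ a.vars, x < N := fun a ha x hx =>
    (h2.2 a ha x hx).trans_le (by omega)
  have hVN : ∀ x ∈ V, x < N := fun x hx => (h1 x hx).trans_le (by omega)
  -- All rule variables are renamed, but equations are recorded only for the head variables `E`: an
  -- equation for a local variable would place it in the rest of the store and violate the freshness
  -- condition of the transition.
  have hexp := StateEquiv.expand (CT := CT) hEq (U := m.1) (W := r.kept.atoms + r.removed.atoms)
    (B := m.2 + c) (C := r.guard.atoms) (V := V) (Z := r.vars) (E := E) (σ := σ) (N := N)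
    hVN hm1 hm2 hEr (fun a ha x hx _ => hH a ha x hx)
    (fun a ha x hx => hσN x (hEr (hH a ha x hx))) (fun a ha x hx => hσN x (hguard a ha x hx)) hσN
  -- the variant of the rule
  let ρ : ℕ → ℕ := fun x => N + x
  have hρ : ∀ x ∈ r.vars, freshen N r.vars σ x = renameSubst ρ x := fun x hx => if_pos hx
  let r' := r.rename ρ
  have hkept' : r'.kept.atoms = r.kept.atoms.map (.subst (freshen N r.vars σ)) := by
    refine (User.atoms_subst _ _).trans (Multiset.map_congr rfl fun a ha => ?_)
    exact a.subst_congr fun x hx => (hρ x (hEr (hkept a ha x hx))).symm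
  have hremoved' : r'.removed.atoms = r.removed.atoms.map (.subst (freshen N r.vars σ)) := by
    refine (User.atoms_subst _ _).trans (Multiset.map_congr rfl fun a ha => ?_)
    exact a.subst_congr fun x hx => (hρ x (hEr (hremoved a ha x hx))).symm
  have hguard' : r'.guard.atoms = r.guard.atoms.map (.subst (freshen N r.vars σ)) := by
    refine (BuiltIn.atoms_subst _ _).trans (Multiset.map_congr rfl fun a ha => ?_)
    exact a.subst_congr fun x hx => (hρ x (hguard a ha x hx)).symm
  let d : Store L K := (m.1, m.2 + c + r.guard.atoms.map (.subst σ) + freshEqs N E σ)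
  have hstep : Reach CT P (.state (storeState (r'.kept.atoms + r'.removed.atoms + d.1)
      (r'.guard.atoms + d.2) V)) T := by
    refine .of_complete_step hComplete hr ⟨ρ, fun x _ y _ h => by simpa [ρ] using h, rfl⟩ ?_
      fun e he => ?_
    · -- freshness of the local variables
      rw [Finset.disjoint_left]
      intro z hz hz'
      simp only [Rule.localVars, Finset.mem_sdiff] at hz
      obtain ⟨hz, hzE⟩ := hz
      have hzN : ∃ x, x ∉ E ∧ z = N + x := by
        have hx : ∃ x, z = N + x := by
          rcases Finset.mem_union.1 hz with hz | hz
          · obtain ⟨x, -, hx⟩ := Goal.mem_vars_subst.1 hz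
            exact ⟨x, Term.mem_varFinset_var.1 hx⟩
          · obtain ⟨b, hb, hz⟩ := BuiltIn.mem_vars.1 hz
            rw [show r'.guard.atoms = r.guard.atoms.map (.subst (renameSubst ρ)) from
              BuiltIn.atoms_subst _ _] at hb
            obtain ⟨b, hb, rfl⟩ := Multiset.mem_map.1 hb
            obtain ⟨x, -, hx⟩ := BuiltInAtom.mem_vars_subst.1 hz
            exact ⟨x, Term.mem_varFinset_var.1 hx⟩
        obtain ⟨x, rfl⟩ := hx
        refine ⟨x, fun hxE => hzE ?_, rfl⟩
        have hren : ∀ U : User L K, x ∈ User.vars U →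
            N + x ∈ User.vars (User.subst (renameSubst ρ) U) := by
          intro U hx
          obtain ⟨a, ha, hx⟩ := User.mem_vars.1 hx
          refine User.mem_vars.2 ⟨a.subst (renameSubst ρ), ?_, UserAtom.mem_vars_subst.2
            ⟨x, hx, Term.mem_varFinset_var.2 rfl⟩⟩
          rw [User.atoms_subst]
          exact Multiset.mem_map_of_mem _ ha
        exact Finset.mem_union.2 ((Finset.mem_union.1 hxE).imp (hren _) (hren _))
      obtain ⟨x, hxE, rfl⟩ := hzN
      simp only [Finset.mem_union, or_assoc] at hz'
      rw [← or_assoc, ← Finset.mem_union] at hz'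
      rcases hz' with hz' | hz' | hz'
      · exact hzE hz'
      · rcases mem_vars_storeState.1 hz' with ⟨a, ha, hz'⟩ | ⟨b, hb, hz'⟩
        · have := hm1 a ha _ hz'
          omega
        · rcases Multiset.mem_add.1 hb with hb | hb
          · rcases Multiset.mem_add.1 hb with hb | hb
            · have := hm2 b hb _ hz'
              omega
            · obtain ⟨b, hb', rfl⟩ := Multiset.mem_map.1 hb
              obtain ⟨y, hy, hz'⟩ := BuiltInAtom.mem_vars_subst.1 hz'
              have := hσN y (hguard b hb' y hy) _ hz'
              omega
          · obtain ⟨y, hy, rfl⟩ := mem_freshEqs.1 hb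
            simp only [BuiltInAtom.vars, Finset.mem_union, Term.mem_varFinset_var] at hz'
            rcases hz' with hz' | hz'
            · obtain rfl : x = y := by omega
              exact hxE hy
            · have := hσN y (hEr hy) _ hz'
              omega
      · have := hVN _ hz'
        omega
    · -- the state after the transition
      rw [show r'.body.dnf = r.body.dnf.map (Store.subst (renameSubst ρ)) from
        Goal.dnf_subst _ _] at he
      obtain ⟨e, he', rfl⟩ := List.mem_map.1 he
      have hev := Goal.vars_of_mem_dnf he'
      -- Solving the equations by `θ` returns the head variables to their values under `σ` and
      -- leaves the local ones renamed. So `τ` agrees with `σ` off the local variables and provides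
      -- the witnesses for their quantifier in the rule formula.
      let τ := freshen N r.localVars σ
      let θ := unfreshen N E σ
      have hρθ : ∀ x ∈ r.vars, (renameSubst ρ x : L.Term ℕ).subst θ = τ x := by
        intro x hx
        by_cases hxE : x ∈ E
        · have hxl : x ∉ r.localVars := fun h => (Finset.mem_sdiff.1 h).2 hxE
          simp [τ, θ, freshen, hxl, renameSubst, ρ, FirstOrder.Language.Term.subst,
            unfreshen_add hxE]
        · have hxl : x ∈ r.localVars := by
            refine Finset.mem_sdiff.2 ⟨?_, hxE⟩
            simp only [E, Rule.vars, Finset.mem_union] at hx hxE ⊢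
            tauto
          simp [τ, θ, freshen, hxl, renameSubst, ρ, FirstOrder.Language.Term.subst, unfreshen, hxE]
      have hτE : ∀ x ∈ E, τ x = σ x := fun x hx =>
        if_neg fun h => (Finset.mem_sdiff.1 h).2 hx
      have hsub := StateEquiv.substitute_fresh (CT := CT)
        (r'.kept.atoms + d.1 + (Store.subst (renameSubst ρ) e).1)
        (r'.guard.atoms + (m.2 + c + r.guard.atoms.map (.subst σ)) +
          (Store.subst (renameSubst ρ) e).2) V (fun x hx => hσN x (hEr hx))
      have hθ1 : (r'.kept.atoms + d.1 + (Store.subst (renameSubst ρ) e).1).map (.subst θ) =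
          r.kept.atoms.map (.subst σ) + m.1 + e.1.map (.subst τ) := by
        rw [Multiset.map_add, Multiset.map_add]
        congr 1
        · congr 1
          · rw [show r'.kept.atoms = r.kept.atoms.map (.subst (renameSubst ρ)) from
              User.atoms_subst _ _]
            refine UserAtom.subst_comp_eq fun a ha x hx => ?_
            rw [hρθ x (hEr (hkept a ha x hx)), hτE x (hkept a ha x hx)]
          · refine (Multiset.map_congr rfl fun a ha => ?_).trans (Multiset.map_id _)
            exact (a.subst_congr fun x hx => unfreshen_of_lt (hm1 a ha x hx)).trans a.subst_var
        · exact UserAtom.subst_comp_eq fun a ha x hx => hρθ x (hbody x (hev.1 a ha x hx))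
      rw [hθ1] at hsub
      have hstore : r'.guard.atoms + d.2 + (Store.subst (renameSubst ρ) e).2 =
          r'.guard.atoms + (m.2 + c + r.guard.atoms.map (.subst σ)) +
          (Store.subst (renameSubst ρ) e).2 + freshEqs N E σ := by
        simp only [d]
        abel
      rw [hstore]
      refine .of_state hsub ?_
      set B := r'.guard.atoms + (m.2 + c + r.guard.atoms.map (.subst σ)) +
          (Store.subst (renameSubst ρ) e).2 + freshEqs N E σ with hB
      have hent : ∀ b ∈ B, CTEntails CT (conjFormula B) (b.subst θ).toFormula := fun b hb =>
        hEq.unfreshen_le (fun x hx => hσN x (hEr hx)) (Multiset.le_add_left _ _) hb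
      -- The renamed guard and body constraints are in the store; applying the equations to them
      -- yields their instances under `τ`.
      refine .of_state (.add_entailed
        (B' := e.2.map (.subst τ) + r.guard.atoms.map (.subst τ)) fun b hb => ?_) ?_
      · rcases Multiset.mem_add.1 hb with hb | hb
        · obtain ⟨b, hbe, rfl⟩ := Multiset.mem_map.1 hb
          rw [← b.subst_congr fun x hx => hρθ x (hbody x (hev.2 b hbe x hx)),
            ← BuiltInAtom.subst_subst]
          refine hent _ ?_
          simp only [hB, Store.subst, Multiset.mem_add, Multiset.mem_map]
          exact .inl (.inr ⟨b, hbe, rfl⟩)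
        · obtain ⟨b, hbg, rfl⟩ := Multiset.mem_map.1 hb
          rw [← b.subst_congr fun x hx => hρθ x (hguard b hbg x hx),
            ← BuiltInAtom.subst_subst]
          refine hent _ ?_
          rw [hB, show r'.guard.atoms = r.guard.atoms.map (.subst (renameSubst ρ)) from
            BuiltIn.atoms_subst _ _]
          simp only [Multiset.mem_add, Multiset.mem_map]
          exact .inl (.inl (.inl ⟨b, hbg, rfl⟩))
      · have hmem : Store.subst σ (r.kept.atoms, 0) + Store.subst τ (e + (0, r.guard.atoms)) ∈
            F := by
          refine subset_cl _ (Set.add_mem_add (mem_sem_of_mem_dnf (by simp [User.dnf_toGoal]) σ)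
            (sem_subset_exVars (τ := τ) (fun x hx => if_neg hx) ?_))
          refine mem_sem_of_mem_dnf (G := .and r.body (BuiltIn.toGoal K r.guard)) ?_ τ
          exact Goal.mem_dnf_and.2 ⟨e, he', _, by simp [BuiltIn.dnf_toGoal], rfl⟩
        -- Everything in the built-in store beyond the right-hand side and `m` is absorbed by the
        -- arbitrary constraints in the pole.
        have := hm _ hmem (r'.guard.atoms + (c + r.guard.atoms.map (.subst σ)) +
          (Store.subst (renameSubst ρ) e).2 + freshEqs N E σ)
        simp only [Store.subst, Multiset.map_zero, Prod.fst_add, Prod.snd_add, Multiset.map_add,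
          add_zero, zero_add] at this
        convert this using 3
        · abel
        · simp only [hB, Store.subst]
          abel
  rw [hkept', hremoved', hguard'] at hstep
  have e1 : (Store.subst σ (r.kept.atoms + r.removed.atoms, r.guard.atoms)).1 + m.1 =
      m.1 + (r.kept.atoms + r.removed.atoms).map (.subst σ) := add_comm _ _
  have e2 : (Store.subst σ (r.kept.atoms + r.removed.atoms, r.guard.atoms)).2 + m.2 + c =
      m.2 + c + r.guard.atoms.map (.subst σ) := by
    simp only [Store.subst]
    abel
  rw [e1, e2]
  refine .of_state hexp ?_
  convert hstep using 3
  · rw [Multiset.map_add, add_comm]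
  · simp only [d]
    abel

theorem zero_mem_axiom (hEq : HasEquality CT) (hComplete : IsComplete CT) {γ : LFormula L K}
    (hγ : γ ∈ programL P ∪ theoryL K CT) (σ : ℕ → L.Term ℕ) : 0 ∈ (𝓒).sem γ σ := by
  rcases hγ with ⟨r, hr, rfl⟩ | ⟨α, hα, rfl⟩ | ⟨n, c, j, rfl⟩
  · exact zero_mem_rule hEq hComplete hr σ
  · exact zero_mem_ctAxiom hα σ
  · exact zero_mem_equalityL hEq c j σ

theorem zero_mem_of_provableFrom (hEq : HasEquality CT) (hComplete : IsComplete CT)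
    {α : LFormula L K} (h : LFormula.ProvableFrom (programL P ∪ theoryL K CT) α)
    (σ : ℕ → L.Term ℕ) : 0 ∈ (𝓒).sem α σ := by
  obtain ⟨Γ, hΓ, h⟩ := h
  refine soundness h σ ?_
  clear h
  induction Γ using Multiset.induction with
  | empty => simp [semCtx]
  | cons γ Γ ih =>
    rw [semCtx_cons, ← add_zero (0 : Store L K)]
    exact Set.add_mem_add (zero_mem_axiom hEq hComplete (hΓ γ (Multiset.mem_cons_self _ _)) σ)
      (ih fun γ' h' => hΓ γ' (Multiset.mem_cons_of_mem h'))

/-- The global variables of a configuration. -/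
def Config.globals : Config L K → Finset ℕ
  | .empty => ∅
  | .state S => S.globals
  | .or C D => C.globals ∪ D.globals

/-- The fact of a state is generated by instances of its disjuncts. Such an instance, even with
extra built-in constraints and more globals, entails the state by `StateEntails.of_instance`, so no
transition is needed. -/
theorem sem_subset_pole (hEq : HasEquality CT) {C : Config L K} (hV : C.globals ⊆ V)
    (hC : ConfigEntails CT (C.cls CT) (T.cls CT)) : (𝓒).sem C.toL .var ⊆ (𝓒).pole := by
  induction C with
  | empty => exact cl_subset isFact_pole (Set.empty_subset _)
  | or C D h1 h2 =>
    exact cl_subset isFact_pole (Set.union_subset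
      (h1 (Finset.union_subset_left hV) ((ConfigEntails.or_right C D).trans hC))
      (h2 (Finset.union_subset_right hV) ((ConfigEntails.or_left C D).trans hC)))
  | state S =>
    refine sem_exVars_subset isFact_pole fun τ hτ => sem_subset_of_dnf isFact_pole fun d hd c =>
      .of_entails ?_
    have h1 := ConfigEntails.of_state (StateEntails.of_instance hEq (W := d.1) (B := c) (C := d.2)
      hV (Y := S.goal.vars \ S.globals) (fun x hx => (Finset.mem_sdiff.1 hx).2) hτ)
    have h2 := ConfigEntails.of_mem_dnf (CT := CT) (H := .top) (V := S.globals) hd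
    rw [add_comm] at h1
    refine h1.trans (.trans (.of_equiv (.of_state (.of_cls_eq
      (G := (storeState d.1 d.2 S.globals).goal) _ ?_))) (h2.trans (.trans
      (.of_equiv (.of_state (.goal S.globals (.topAnd S.goal)))) hC)))
    rw [Goal.cls_and, Goal.cls_top, zero_add]
    exact (cls_storeState _ _ _).trans (Store.cls_goal d).symm

theorem StateEquiv.of_globals {G : Goal L K} {V V' : Finset ℕ} (h : V' ⊆ V)
    (hG : ∀ x ∈ V, x ∈ G.vars → x ∈ V') : StateEquiv CT ⟨G, V'⟩ ⟨G, V⟩ := by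
  have key : ∀ X : Finset ℕ, (∀ x ∈ X, x ∉ G.vars) → StateEquiv CT ⟨G, V'⟩ ⟨G, X ∪ V'⟩ := by
    intro X hX
    induction X using Finset.induction with
    | empty => rw [Finset.empty_union]; exact .refl _
    | insert x X _ ih =>
      rw [Finset.insert_union]
      exact (ih fun y hy => hX y (by simp [hy])).trans
        (.symm (.redundantGlobal G x _ (hX x (by simp))))
  rw [← Finset.sdiff_union_of_subset h]
  exact key _ fun x hx hx' => (Finset.mem_sdiff.1 hx).2 (hG x (Finset.mem_sdiff.1 hx).1 hx')

/-- The pole is evaluated at one generic instance of each disjunct, in which the local variables of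
the state are replaced by fresh ones. -/
theorem reach_of_sem_subset_pole (hEq : HasEquality CT) {C : Config L K} (hV : C.globals ⊆ V)
    (hC : (𝓒).sem C.toL .var ⊆ (𝓒).pole) : Reach CT P C T := by
  induction C with
  | empty => exact .of_equiv .empty .failed
  | or C D h1 h2 =>
    exact .or (h1 (Finset.union_subset_left hV) fun x hx => hC (subset_cl _ (.inl hx)))
      (h2 (Finset.union_subset_right hV) fun x hx => hC (subset_cl _ (.inr hx)))
  | state S =>
    refine .of_state (.symm (.goal S.globals (.topAnd S.goal))) (.of_dnf fun d hd => ?_)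
    have hdv := Goal.vars_of_mem_dnf hd
    obtain ⟨N, hN⟩ := exists_bound (V ∪ S.goal.vars)
    let Y := S.goal.vars \ S.globals
    -- A local variable of `S` may be a global of another state and so belong to `V`. Renaming it
    -- beyond `V` lets the globals be enlarged from `S.globals` to `V`.
    let τ : ℕ → L.Term ℕ := freshen N Y .var
    have hpole : Store.subst τ d ∈ (𝓒).pole :=
      hC (sem_subset_exVars (τ := τ) (fun x hx => if_neg hx) (mem_sem_of_mem_dnf hd τ))
    have hr := hpole 0
    rw [add_zero] at hr
    have hNg : ∀ x ∈ S.goal.vars, x < N := fun x hx => hN x (Finset.mem_union_right _ hx)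
    refine .of_state (.trans (.of_cls_eq (G' := (storeState d.1 d.2 S.globals).goal) _ ?_)
      (.trans (.rename (W := d.1) (C := d.2) (V := S.globals) (Y := Y)
      (N := N) hEq (fun x hx => hN x (Finset.mem_union_left _ (hV hx)))
      (fun a ha x hx => hNg x (hdv.1 a ha x hx)) (fun a ha x hx => hNg x (hdv.2 a ha x hx))
      (fun x hx => hNg x (Finset.mem_sdiff.1 hx).1) fun x hx => (Finset.mem_sdiff.1 hx).2)
      (StateEquiv.of_globals (G := (storeState (d.1.map (.subst τ)) (d.2.map (.subst τ))
        S.globals).goal) (V := V) hV fun x hxV hx => ?_))) hr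
    · rw [Goal.cls_and, Goal.cls_top, zero_add]
      exact (Store.cls_goal d).trans (cls_storeState _ _ S.globals).symm
    · have hy : ∃ y ∈ S.goal.vars, x ∈ (τ y).varFinset := by
        rcases mem_vars_storeState.1 hx with ⟨a, ha, hx⟩ | ⟨a, ha, hx⟩
        · obtain ⟨a, had, rfl⟩ := Multiset.mem_map.1 ha
          obtain ⟨y, hy, hx⟩ := UserAtom.mem_vars_subst.1 hx
          exact ⟨y, hdv.1 a had y hy, hx⟩
        · obtain ⟨a, had, rfl⟩ := Multiset.mem_map.1 ha
          obtain ⟨y, hy, hx⟩ := BuiltInAtom.mem_vars_subst.1 hx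
          exact ⟨y, hdv.2 a had y hy, hx⟩
      obtain ⟨y, hy, hx⟩ := hy
      have hxN := hN x (Finset.mem_union_left _ hxV)
      by_cases hyY : y ∈ Y
      · simp only [τ, freshen, hyY, if_true, Term.mem_varFinset_var] at hx
        omega
      · simp only [τ, freshen, hyY, if_false, Term.mem_varFinset_var] at hx
        subst hx
        by_contra hc
        exact hyY (Finset.mem_sdiff.2 ⟨hy, hc⟩)

/-- Completeness of the operational semantics. -/
theorem reach_of_provableFrom (hEq : HasEquality CT) (hComplete : IsComplete CT)
    {S : Config L K} (h : LFormula.ProvableFrom (programL P ∪ theoryL K CT)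
      (LFormula.univClosure (.lolli S.toL T.toL))) : Reach CT P S T := by
  refine reach_of_sem_subset_pole (V := S.globals ∪ T.globals) hEq Finset.subset_union_left
    fun x hx => ?_
  have h0 := mem_sem_allVars.1 (zero_mem_of_provableFrom (V := S.globals ∪ T.globals) (T := T)
    hEq hComplete h .var) .var fun _ _ => rfl
  have := h0 x hx
  rw [zero_add] at this
  exact sem_subset_pole hEq Finset.subset_union_right (.refl _) this

end Canonical

/-! ### Intuitionistic logic in linear logic -/

section Embedding

variable {L : FirstOrder.Language.{u, v}} {K : ℕ → Type w}

namespace LFormula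

theorem Provable.bang_mono {α β : LFormula L K} (h : Provable {α} β) :
    Provable {.bang α} (.bang β) := by
  have := Provable.bangR (Γ := {α}) (α := β) (by
    rw [Multiset.map_singleton, ← Multiset.cons_zero]
    exact .dereliction h)
  simpa using this

theorem Provable.cut_singleton {Γ : Multiset (LFormula L K)} {α β : LFormula L K}
    (h : Provable Γ α) (h' : Provable {α} β) : Provable Γ β := by
  simpa using Provable.cut (Δ := 0) h h'

end LFormula

/-- Atoms, implications and universal formulas are translated with an outer `!`, and the remaining
connectives preserve the property of proving one's own `!`. Translated formulas therefore obey
weakening and contraction. -/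
theorem Formula.star_dup (φ : Formula L) :
    LFormula.Provable {φ.star K} (.bang (φ.star K)) := by
  induction φ with
  | top =>
    have := LFormula.Provable.bangR (L := L) (K := K) (Γ := 0) (α := .one) .oneR
    exact .oneL this
  | bot => exact .zeroL
  | eq t s | rel R ts | imp φ ψ | all φ =>
    have h := fun α : LFormula L K => LFormula.Provable.bangR (Γ := {α}) (by simpa using .identity (.bang α))
    simpa [star] using h _
  | and φ ψ h1 h2 =>
    refine .tensorL ?_
    have h : LFormula.Provable ({φ.star K, ψ.star K} : Multiset (LFormula L K)) (φ.and ψ |>.star K) :=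
      .tensorR (.identity _) (.identity _)
    have h' : LFormula.Provable (.bang (φ.star K) ::ₘ {.bang (ψ.star K)})
        (.bang ((φ.and ψ).star K)) := by
      have := LFormula.Provable.bangR (Γ := {φ.star K, ψ.star K}) (α := (φ.and ψ).star K) (by
        rw [Multiset.insert_eq_cons, Multiset.map_cons, Multiset.map_singleton]
        refine .dereliction ?_
        rw [← Multiset.cons_zero, Multiset.cons_swap]
        refine .dereliction ?_
        rw [Multiset.cons_swap]
        exact h)
      simpa using this
    have h3 := LFormula.Provable.cut h1 h'
    rw [add_comm] at h3
    have h4 := LFormula.Provable.cut (Δ := {φ.star K}) h2 h3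
    rwa [add_comm] at h4
  | or φ ψ h1 h2 =>
    exact .plusL (h1.cut_singleton (.bang_mono (.plusR₁ (.identity _))))
      (h2.cut_singleton (.bang_mono (.plusR₂ (.identity _))))
  | ex φ h =>
    refine .exL ?_
    refine h.cut_singleton (.bang_mono ?_)
    -- The witness is the eigenvariable; instantiating the shifted body at index `0` gives the body
    -- back.
    refine .exR (.var 0) ?_
    rw [LFormula.inst, LFormula.subst_subst]
    convert LFormula.Provable.identity (φ.star K) using 2
    refine LFormula.subst_eq_self fun x _ => ?_
    cases x <;> simp [up, instSubst, FirstOrder.Language.Term.subst, renameSubst,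
      FirstOrder.Language.Term.relabel]

namespace LFormula

/-- Translated hypotheses under `!`. -/
def hyps (K : ℕ → Type w) (Δ : Multiset (Formula L)) : Multiset (LFormula L K) :=
  (Δ.map (Formula.star K)).map .bang

theorem hyps_cons (φ : Formula L) (Δ : Multiset (Formula L)) :
    hyps K (φ ::ₘ Δ) = .bang (φ.star K) ::ₘ hyps K Δ := by simp [hyps]

theorem hyps_add (Δ Δ' : Multiset (Formula L)) : hyps K (Δ + Δ') = hyps K Δ + hyps K Δ' := by
  simp [hyps]

theorem hyps_map_shift (Δ : Multiset (Formula L)) :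
    hyps K (Δ.map .shift) = (hyps K Δ).map shift := by
  simp only [hyps, Multiset.map_map, Function.comp_def, shift, subst, Formula.shift,
    Formula.star_subst]

theorem Provable.weaken_hyps {Γ : Multiset (LFormula L K)} {α : LFormula L K}
    (h : Provable Γ α) (Δ : Multiset (Formula L)) : Provable (Γ + hyps K Δ) α := by
  induction Δ using Multiset.induction with
  | empty => simpa [hyps] using h
  | cons φ Δ ih =>
    rw [hyps_cons, Multiset.add_cons]
    exact .weakening ih

/-- Intuitionistic hypotheses form a set, linear ones a multiset: all copies of `φ` are contracted
to one, or one is added by weakening. -/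
theorem Provable.discharge_bang {Γ : Set (Formula L)} {φ : Formula L}
    {Δ : Multiset (Formula L)} (hΔ : ∀ δ ∈ Δ, δ ∈ insert φ Γ) :
    ∃ Δ' : Multiset (Formula L), (∀ δ ∈ Δ', δ ∈ Γ) ∧ ∀ (Ω : Multiset (LFormula L K))
      (χ : LFormula L K), Provable (hyps K Δ + Ω) χ →
      Provable (.bang (φ.star K) ::ₘ (hyps K Δ' + Ω)) χ := by
  induction Δ using Multiset.induction with
  | empty => exact ⟨0, by simp, fun Ω χ h => .weakening h⟩
  | cons δ Δ ih =>
    obtain ⟨Δ', h1, h2⟩ := ih fun δ' h => hΔ δ' (Multiset.mem_cons_of_mem h)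
    rcases hΔ δ (Multiset.mem_cons_self _ _) with rfl | hδ
    · refine ⟨Δ', h1, fun Ω χ h => .contraction ?_⟩
      rw [hyps_cons, Multiset.cons_add, ← Multiset.add_cons] at h
      have := h2 _ _ h
      rwa [Multiset.add_cons] at this
    · refine ⟨δ ::ₘ Δ', fun δ' h => ?_, fun Ω χ h => ?_⟩
      · rcases Multiset.mem_cons.1 h with rfl | h
        exacts [hδ, h1 _ h]
      · rw [hyps_cons, Multiset.cons_add, ← Multiset.add_cons] at h ⊢
        exact h2 _ _ h

theorem Provable.discharge {Γ : Set (Formula L)} {φ : Formula L} {χ : LFormula L K}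
    {Δ : Multiset (Formula L)} (hΔ : ∀ δ ∈ Δ, δ ∈ insert φ Γ) (h : Provable (hyps K Δ) χ) :
    ∃ Δ' : Multiset (Formula L), (∀ δ ∈ Δ', δ ∈ Γ) ∧
      Provable (φ.star K ::ₘ hyps K Δ') χ := by
  obtain ⟨Δ', h1, h2⟩ := Provable.discharge_bang (K := K) hΔ
  have := h2 0 χ (by simpa using h)
  rw [add_zero] at this
  have := Provable.cut φ.star_dup this
  rw [Multiset.singleton_add] at this
  exact ⟨Δ', h1, this⟩

theorem exists_map_shift {Γ : Set (Formula L)} {Δ : Multiset (Formula L)}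
    (hΔ : ∀ δ ∈ Δ, δ ∈ Formula.shift '' Γ) :
    ∃ Δ' : Multiset (Formula L), (∀ δ ∈ Δ', δ ∈ Γ) ∧ Δ'.map .shift = Δ := by
  induction Δ using Multiset.induction with
  | empty => exact ⟨0, by simp, rfl⟩
  | cons δ Δ ih =>
    obtain ⟨Δ', h1, h2⟩ := ih fun δ' h => hΔ δ' (Multiset.mem_cons_of_mem h)
    obtain ⟨γ, hγ, rfl⟩ := hΔ δ (Multiset.mem_cons_self _ _)
    refine ⟨γ ::ₘ Δ', fun δ' h => ?_, by rw [Multiset.map_cons, h2]⟩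
    rcases Multiset.mem_cons.1 h with rfl | h
    exacts [hγ, h1 _ h]

theorem forall_mem_add {Γ : Set (Formula L)} {Δ Δ' : Multiset (Formula L)}
    (h : ∀ δ ∈ Δ, δ ∈ Γ) (h' : ∀ δ ∈ Δ', δ ∈ Γ) : ∀ δ ∈ Δ + Δ', δ ∈ Γ := fun δ hδ =>
  (Multiset.mem_add.1 hδ).elim (h δ) (h' δ)

/-- Hypotheses are carried under an additional `!`, so that promotion applies at the introduction of
implications and universal quantifiers. `Formula.star_dup` supplies that `!` when a hypothesis is
discharged. -/
theorem Provable.of_formula {Γ : Set (Formula L)} {φ : Formula L} (h : Formula.Provable Γ φ) :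
    ∃ Δ : Multiset (Formula L), (∀ δ ∈ Δ, δ ∈ Γ) ∧ Provable (hyps K Δ) (φ.star K) := by
  induction h with
  | @hyp Γ φ h => exact ⟨{φ}, by simpa using h, by
      simpa [hyps] using Provable.dereliction (.identity (φ.star K))⟩
  | topI => exact ⟨0, by simp, .oneR⟩
  | botE _ ih =>
    obtain ⟨Δ, hΔ, h⟩ := ih
    exact ⟨Δ, hΔ, h.cut_singleton .zeroL⟩
  | andI _ _ h1 h2 =>
    obtain ⟨Δ, hΔ, h⟩ := h1
    obtain ⟨Δ', hΔ', h'⟩ := h2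
    refine ⟨Δ + Δ', forall_mem_add hΔ hΔ', ?_⟩
    rw [hyps_add]
    exact .tensorR h h'
  | @andE₁ Γ φ ψ _ ih =>
    obtain ⟨Δ, hΔ, h⟩ := ih
    refine ⟨Δ, hΔ, h.cut_singleton (.tensorL ?_)⟩
    have := Provable.cut (ψ.star_dup (K := K)) (.weakening (.identity (φ.star K)))
    rwa [add_comm] at this
  | @andE₂ Γ φ ψ _ ih =>
    obtain ⟨Δ, hΔ, h⟩ := ih
    refine ⟨Δ, hΔ, h.cut_singleton (.tensorL ?_)⟩
    exact Provable.cut (φ.star_dup (K := K)) (.weakening (.identity (ψ.star K)))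
  | orI₁ _ ih =>
    obtain ⟨Δ, hΔ, h⟩ := ih
    exact ⟨Δ, hΔ, .plusR₁ h⟩
  | orI₂ _ ih =>
    obtain ⟨Δ, hΔ, h⟩ := ih
    exact ⟨Δ, hΔ, .plusR₂ h⟩
  | orE _ _ _ h1 h2 h3 =>
    obtain ⟨Δ, hΔ, h⟩ := h1
    obtain ⟨Δ2, hΔ2, h2⟩ := h2
    obtain ⟨Δ3, hΔ3, h3⟩ := h3
    obtain ⟨Δ2, hΔ2, h2⟩ := h2.discharge hΔ2
    obtain ⟨Δ3, hΔ3, h3⟩ := h3.discharge hΔ3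
    refine ⟨Δ + (Δ2 + Δ3), forall_mem_add hΔ (forall_mem_add hΔ2 hΔ3), ?_⟩
    rw [hyps_add]
    refine .cut h (.plusL ?_ ?_)
    · rw [hyps_add, ← Multiset.cons_add]
      exact h2.weaken_hyps _
    · rw [hyps_add, add_comm, ← Multiset.cons_add]
      exact h3.weaken_hyps _
  | impI _ ih =>
    obtain ⟨Δ, hΔ, h⟩ := ih
    obtain ⟨Δ, hΔ, h⟩ := h.discharge hΔ
    exact ⟨Δ, hΔ, .bangR (.lolliR h)⟩
  | @impE Γ φ ψ _ _ h1 h2 =>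
    obtain ⟨Δ, hΔ, h⟩ := h1
    obtain ⟨Δ', hΔ', h'⟩ := h2
    refine ⟨Δ + Δ', forall_mem_add hΔ hΔ', ?_⟩
    rw [hyps_add]
    refine .cut h (.dereliction ?_)
    simpa using Provable.lolliL h' (.identity (ψ.star K))
  | allI _ ih =>
    obtain ⟨Δ, hΔ, h⟩ := ih
    obtain ⟨Δ₀, hΔ₀, rfl⟩ := exists_map_shift hΔ
    rw [hyps_map_shift] at h
    exact ⟨Δ₀, hΔ₀, .bangR (.allR h)⟩
  | @allE Γ φ t _ ih =>
    obtain ⟨Δ, hΔ, h⟩ := ih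
    refine ⟨Δ, hΔ, h.cut_singleton (.dereliction (.allL t ?_))⟩
    rw [Formula.inst, Formula.star_subst]
    exact .identity _
  | exI t _ ih =>
    obtain ⟨Δ, hΔ, h⟩ := ih
    rw [Formula.inst, Formula.star_subst] at h
    exact ⟨Δ, hΔ, .exR t h⟩
  | exE _ _ h1 h2 =>
    obtain ⟨Δ, hΔ, h⟩ := h1
    obtain ⟨Δ', hΔ', h'⟩ := h2
    obtain ⟨Δ₁, hΔ₁, h₁⟩ := h'.discharge hΔ'
    obtain ⟨Δ₀, hΔ₀, rfl⟩ := exists_map_shift hΔ₁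
    rw [hyps_map_shift, Formula.shift, Formula.star_subst] at h₁
    refine ⟨Δ + Δ₀, forall_mem_add hΔ hΔ₀, ?_⟩
    rw [hyps_add]
    exact .cut h (.exL h₁)

theorem Provable.of_hyps {Δ : Multiset (Formula L)} {Ω : Multiset (LFormula L K)}
    {α : LFormula L K} (h : Provable (hyps K Δ + Ω) α) :
    Provable (Δ.map (Formula.star K) + Ω) α := by
  induction Δ using Multiset.induction generalizing Ω with
  | empty => simpa [hyps] using h
  | cons φ Δ ih =>
    rw [hyps_cons, Multiset.cons_add] at h
    have := Provable.cut φ.star_dup h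
    rw [add_left_comm] at this
    have := ih this
    rw [Multiset.map_cons, ← Multiset.singleton_add]
    rwa [add_left_comm, ← add_assoc] at this

theorem Entails.of_formula {CT : Set (CTAxiom L)} {Θ : Set (LFormula L K)}
    (hΘ : theoryL K CT ⊆ Θ) {φ ψ : Formula L} (h : CTEntails CT φ ψ) :
    Entails Θ (φ.star K) (ψ.star K) := by
  obtain ⟨Δ, hΔ, h⟩ := Provable.of_formula (K := K) h
  refine ⟨Δ.map (Formula.star K), fun γ hγ => ?_, ?_⟩
  · obtain ⟨δ, hδ, rfl⟩ := Multiset.mem_map.1 hγ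
    obtain ⟨α, hα, rfl⟩ := hΔ δ hδ
    exact hΘ (.inl ⟨α, hα, rfl⟩)
  · have h' : Provable (φ.star K ::ₘ hyps K Δ) (ψ.star K) := by
      have := Provable.cut (Δ := {φ.star K}) h (.dereliction (by
        simpa using Provable.lolliL (.identity (φ.star K)) (.identity (ψ.star K))))
      rwa [add_comm, Multiset.singleton_add] at this
    have := Provable.of_hyps (Δ := Δ) (Ω := {φ.star K}) (by
      rwa [add_comm, Multiset.singleton_add])
    rwa [add_comm, Multiset.singleton_add] at this

end LFormula

theorem Formula.fv_star (φ : Formula L) : (φ.star K).fv = φ.fv := by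
  induction φ with
  | top | bot | eq | rel => rfl
  | and φ ψ h1 h2 | or φ ψ h1 h2 | imp φ ψ h1 h2 =>
    simp only [Formula.star, Formula.fv, LFormula.fv, h1, h2]
  | all φ h | ex φ h => simp only [Formula.star, Formula.fv, LFormula.fv, h]

/-- The outer `!` comes from the first quantifier or, when there is none, from the implication. -/
theorem Formula.exists_star_allVars_imp (X : Finset ℕ) (φ ψ : Formula L) :
    ∃ β, (Formula.allVars X (.imp φ ψ)).star K = .bang β := by
  rw [Formula.allVars]
  generalize X.sort (· ≤ ·) = xs
  cases xs <;> exact ⟨_, rfl⟩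

theorem isTheory_program_union_theory (P : Set (Rule L K)) (CT : Set (CTAxiom L)) :
    LFormula.IsTheory (programL P ∪ theoryL K CT) := by
  rintro γ (⟨r, hr, rfl⟩ | ⟨α, hα, rfl⟩ | ⟨n, c, j, rfl⟩)
  · exact ⟨LFormula.fv_univClosure _, _, rfl⟩
  · refine ⟨(Formula.fv_star _).trans (CTAxiom.closed CT _ ⟨α, hα, rfl⟩), ?_⟩
    exact Formula.exists_star_allVars_imp _ _ _
  · exact ⟨LFormula.fv_univClosure _, _, rfl⟩

end Embedding

/-! ### Formulas modulo equivalence -/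

section LClass

variable {L : FirstOrder.Language.{u, v}} {K : ℕ → Type w}

def lSetoid (Θ : Set (LFormula L K)) : Setoid (LFormula L K) where
  r α β := LFormula.Entails Θ α β ∧ LFormula.Entails Θ β α
  iseqv := ⟨fun α => ⟨.refl α, .refl α⟩, fun h => ⟨h.2, h.1⟩,
    fun h h' => ⟨h.1.trans h'.1, h'.2.trans h.2⟩⟩

/-- Formulas of linear logic modulo provable equivalence over `Θ`. -/
def LClass (Θ : Set (LFormula L K)) : Type (max u v w) := Quotient (lSetoid Θ)

def LFormula.cls (Θ : Set (LFormula L K)) (α : LFormula L K) : LClass Θ :=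
  Quotient.mk (lSetoid Θ) α

/-- As for goals, this leaves rearrangements of $\otimes$ to `abel`. -/
instance (Θ : Set (LFormula L K)) : AddCommMonoid (LClass Θ) where
  zero := LFormula.cls Θ .one
  add := Quotient.map₂ .tensor fun _ _ h _ _ h' => ⟨h.1.tensor_mono h'.1, h.2.tensor_mono h'.2⟩
  add_assoc := by
    rintro ⟨a⟩ ⟨b⟩ ⟨c⟩
    exact Quotient.sound ⟨.tensor_assoc, .tensor_assoc'⟩
  add_comm := by
    rintro ⟨a⟩ ⟨b⟩
    exact Quotient.sound ⟨.tensor_comm, .tensor_comm⟩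
  zero_add := by
    rintro ⟨a⟩
    exact Quotient.sound ⟨.one_tensor, .one_tensor'⟩
  add_zero := by
    rintro ⟨a⟩
    exact Quotient.sound ⟨.trans .tensor_comm .one_tensor, .trans .one_tensor' .tensor_comm⟩
  nsmul := @nsmulRec _ ⟨LFormula.cls Θ .one⟩ ⟨Quotient.map₂ .tensor fun _ _ h _ _ h' =>
    ⟨h.1.tensor_mono h'.1, h.2.tensor_mono h'.2⟩⟩

theorem LFormula.cls_tensor (Θ : Set (LFormula L K)) (α β : LFormula L K) :
    (LFormula.tensor α β).cls Θ = α.cls Θ + β.cls Θ := rfl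

theorem LFormula.Entails.of_cls_eq {Θ : Set (LFormula L K)} {α β : LFormula L K}
    (h : α.cls Θ = β.cls Θ) : LFormula.Entails Θ α β :=
  (Quotient.exact h).1

end LClass

/-! ### Soundness of the operational semantics -/

section Soundness

variable {L : FirstOrder.Language.{u, v}} {K : ℕ → Type w} {CT : Set (CTAxiom L)}
  {P : Set (Rule L K)} {Θ : Set (LFormula L K)}

open LFormula (IsTheory)

namespace LFormula.Entails

theorem subst_of_mem_theory (hΘ : IsTheory Θ) {α β : LFormula L K}
    (h : .bang (univClosure (.lolli α β)) ∈ Θ) (τ : ℕ → L.Term ℕ) :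
    Entails Θ (α.subst τ) (β.subst τ) := by
  have h1 : Entails Θ .one (univClosure (.lolli α β)) :=
    ⟨{.bang (univClosure (.lolli α β))}, by simpa using h,
      .oneL (.dereliction (.identity _))⟩
  exact one_tensor'.trans (tensor_le (h1.trans (univClosure_le hΘ _ τ)))

theorem tensor_plus_le (hΘ : IsTheory Θ) {α β γ δ : LFormula L K}
    (h : Entails Θ (.tensor α β) δ) (h' : Entails Θ (.tensor α γ) δ) :
    Entails Θ (.tensor α (.plus β γ)) δ :=
  tensor_comm.trans (tensor_le (plus_le hΘ (le_lolli (tensor_comm.trans h))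
    (le_lolli (tensor_comm.trans h'))))

end LFormula.Entails

theorem State.mem_fv_toL {S : State L K} {x : ℕ} (h : x ∈ S.toL.fv) : x ∈ S.globals := by
  obtain ⟨h1, h2⟩ := LFormula.mem_fv_exVars h
  rw [Goal.fv_toL] at h1
  by_contra hc
  exact h2 (Finset.mem_sdiff.2 ⟨h1, hc⟩)

theorem State.le_toL (hΘ : IsTheory Θ) (S : State L K) :
    LFormula.Entails Θ S.goal.toL S.toL := .le_exVars_self hΘ _ _

theorem State.toL_le (hΘ : IsTheory Θ) {S : State L K} {β : LFormula L K}
    (hβ : ∀ x ∈ S.goal.vars, x ∉ S.globals → x ∉ β.fv)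
    (h : LFormula.Entails Θ S.goal.toL β) : LFormula.Entails Θ S.toL β :=
  .exVars_le hΘ (fun x hx => hβ x (Finset.mem_sdiff.1 hx).1 (Finset.mem_sdiff.1 hx).2) h

theorem State.toL_le_toL (hΘ : IsTheory Θ) {S T : State L K} (hV : T.globals ⊆ S.globals)
    (h : LFormula.Entails Θ S.goal.toL T.toL) : LFormula.Entails Θ S.toL T.toL :=
  State.toL_le hΘ (fun _ _ hx hx' => hx (hV (State.mem_fv_toL hx'))) h

theorem GoalEquiv.toL (hΘ : IsTheory Θ) {G H : Goal L K} (h : GoalEquiv G H) :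
    LFormula.Entails Θ G.toL H.toL ∧ LFormula.Entails Θ H.toL G.toL := by
  induction h with
  | refl => exact ⟨.refl _, .refl _⟩
  | symm _ h => exact h.symm
  | trans _ _ h h' => exact ⟨h.1.trans h'.1, h'.2.trans h.2⟩
  | andCongr _ _ h h' => exact ⟨h.1.tensor_mono h'.1, h.2.tensor_mono h'.2⟩
  | orCongr _ _ h h' => exact ⟨.plus_mono hΘ h.1 h'.1, .plus_mono hΘ h.2 h'.2⟩
  | andAssoc => exact ⟨.tensor_assoc, .tensor_assoc'⟩
  | andComm => exact ⟨.tensor_comm, .tensor_comm⟩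
  | topAnd => exact ⟨.one_tensor, .one_tensor'⟩
  | distrib =>
    exact ⟨.tensor_plus_le hΘ .le_plus_left .le_plus_right,
      .plus_le hΘ (.tensor_mono (.refl _) .le_plus_left)
        (.tensor_mono (.refl _) .le_plus_right)⟩

theorem LFormula.Entails.user_update (hΘ : IsTheory Θ) (hCT : theoryL K CT ⊆ Θ) {n : ℕ} (c : K n)
    (ts : Fin n → L.Term ℕ) (j : Fin n) (t : L.Term ℕ) :
    Entails Θ (.tensor (.user c ts) (.bang (.eq (ts j) t)))
      (.tensor (.user c (Function.update ts j t)) (.bang (.eq (ts j) t))) := by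
  have h := subst_of_mem_theory hΘ (hCT (.inr ⟨n, c, j, rfl⟩))
    -- In `equalityL` the arguments are the variables below `n`, and `n` itself is the replacement.
    fun i => if h : i < n then ts ⟨i, h⟩ else t
  simp only [LFormula.subst, FirstOrder.Language.Term.subst, Fin.is_lt, dite_true, Fin.eta,
    lt_irrefl, dite_false] at h
  convert h using 3
  funext i
  by_cases hi : i = j
  · subst hi
    simp [FirstOrder.Language.Term.subst]
  · simp [hi, FirstOrder.Language.Term.subst]

/-- One copy of `!ε` is spent on `!δ`, the other is kept, and `!δ` is dropped afterwards. -/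
theorem LFormula.Entails.tensor_bang_of_le {α β ε δ : LFormula L K}
    (h : Entails Θ (.bang ε) (.bang δ))
    (h' : Entails Θ (.tensor α (.bang δ)) (.tensor β (.bang δ))) :
    Entails Θ (.tensor α (.bang ε)) (.tensor β (.bang ε)) := by
  refine (tensor_mono (.refl α) (bang_dup.trans (tensor_mono h (.refl _)))).trans ?_
  refine tensor_assoc'.trans ((tensor_mono h' (.refl _)).trans (tensor_assoc.trans ?_))
  exact tensor_mono (.refl _) ((tensor_mono bang_le_one (.refl _)).trans one_tensor)

/-- The axioms replace a single argument; the set `X` collects those already replaced. -/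
theorem LFormula.Entails.user_congr (hΘ : IsTheory Θ) (hCT : theoryL K CT ⊆ Θ) {n : ℕ} (c : K n)
    {ts us : Fin n → L.Term ℕ} {ε : LFormula L K}
    (h : ∀ i, Entails Θ (.bang ε) (.bang (.eq (ts i) (us i)))) :
    Entails Θ (.tensor (.user c ts) (.bang ε)) (.tensor (.user c us) (.bang ε)) := by
  classical
  suffices H : ∀ X : Finset (Fin n), Entails Θ (.tensor (.user c ts) (.bang ε))
      (.tensor (.user c (X.piecewise us ts)) (.bang ε)) by
    simpa using H Finset.univ
  intro X
  induction X using Finset.induction with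
  | empty => simpa using refl _
  | insert j X hj ih =>
    refine ih.trans ?_
    rw [Finset.piecewise_insert]
    refine tensor_bang_of_le (h j) ?_
    have := user_update hΘ hCT c (X.piecewise us ts) j (us j)
    rwa [Finset.piecewise_eq_of_notMem _ _ _ hj] at this

theorem LFormula.Entails.userConj_congr (hΘ : IsTheory Θ) (hCT : theoryL K CT ⊆ Θ)
    {σ τ : ℕ → L.Term ℕ} {ε : LFormula L K}
    (h : ∀ t : L.Term ℕ, Entails Θ (.bang ε) (.bang (.eq (t.subst σ) (t.subst τ))))
    (U : User L K) :
    Entails Θ (.tensor (User.toGoal (User.subst σ U)).toL (.bang ε))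
      (.tensor (User.toGoal (User.subst τ U)).toL (.bang ε)) := by
  induction U with
  | top => exact refl _
  | atom a =>
    cases a with
    | mk c ts => exact user_congr hΘ hCT c fun i => h (ts i)
  | and U U' h1 h2 =>
    simp only [User.subst, Conj.map, User.toGoal, Goal.toL] at h1 h2 ⊢
    set α := (User.toGoal (Conj.map (UserAtom.subst σ) U)).toL
    set α' := (User.toGoal (Conj.map (UserAtom.subst σ) U')).toL
    set β := (User.toGoal (Conj.map (UserAtom.subst τ) U)).toL
    set β' := (User.toGoal (Conj.map (UserAtom.subst τ) U')).toL
    refine tensor_assoc.trans ((tensor_mono (.refl _) h2).trans ?_)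
    refine (of_cls_eq (β := (α.tensor (.bang ε)).tensor β') ?_).trans
      ((tensor_mono h1 (.refl _)).trans (of_cls_eq ?_))
    · simp only [cls_tensor]; abel
    · simp only [cls_tensor]; abel

/-- With `z` fresh, the equality axiom is applied to the equation between `s` and `s[x/z]`: only one
side changes, and it starts from reflexivity `s ≐ s`. -/
theorem HasEquality.eq_subst_single (hEq : HasEquality CT) (x : ℕ) (s t : L.Term ℕ) :
    CTEntails CT (.eq (.var x) t) (.eq s (s.subst (single x t))) ∧
      CTEntails CT (.eq (.var x) t) (.eq (s.subst (single x t)) s) := by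
  obtain ⟨z, hz⟩ := Infinite.exists_notMem_finset s.varFinset
  have h : ∀ r : L.Term ℕ, (s.subst (single x (.var z))).subst (single z r) =
      s.subst (single x r) := by
    intro r
    rw [Term.subst_subst]
    refine Term.subst_congr s fun y hy => ?_
    have hyz : y ≠ z := fun e => hz (e ▸ hy)
    by_cases hyx : y = x
    · subst hyx; simp [single, FirstOrder.Language.Term.subst]
    · simp [single, FirstOrder.Language.Term.subst, hyx, hyz]
  have h' : ∀ r : L.Term ℕ, s.subst (single z r) = s := fun r =>
    Term.subst_eq_self s fun y hy => by
      have hyz : y ≠ z := fun e => hz (e ▸ hy)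
      simp [single, hyz]
  have hx : s.subst (single x (.var x)) = s :=
    Term.subst_eq_self s fun y _ => by
      by_cases hyx : y = x
      · subst hyx; simp [single]
      · simp [single, hyx]
  have h1 := hEq.2 (.eq s (s.subst (single x (.var z)))) z (.var x) t
  have h2 := hEq.2 (.eq (s.subst (single x (.var z))) s) z (.var x) t
  simp only [BuiltInAtom.subst, h, h', hx, BuiltInAtom.toFormula] at h1 h2
  exact ⟨Formula.Entails.trans (.le_and (.refl _) (.of_provable (hEq.1 s))) h1,
    Formula.Entails.trans (.le_and (.refl _) (.of_provable (hEq.1 s))) h2⟩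

theorem User.subst_var (U : User L K) : User.subst FirstOrder.Language.Term.var U = U := by
  induction U with
  | top => rfl
  | atom a => exact congrArg _ a.subst_var
  | and U U' h1 h2 => exact congrArg₂ _ h1 h2

theorem State.ofStores_toL_le_of_subst (hΘ : IsTheory Θ) {U U' : User L K} {b : BuiltInAtom L}
    {B : BuiltIn L} {V : Finset ℕ}
    (h : LFormula.Entails Θ (.tensor (User.toGoal U).toL (b.toL K))
      (.tensor (User.toGoal U').toL (b.toL K))) :
    LFormula.Entails Θ (State.ofStores U (.and (.atom b) B) V).toL
      (State.ofStores U' (.and (.atom b) B) V).toL :=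
  State.toL_le_toL hΘ (Finset.Subset.refl _) <| LFormula.Entails.trans
    (.trans .tensor_assoc' (.trans (.tensor_mono h (.refl _)) .tensor_assoc))
    (State.le_toL hΘ (State.ofStores U' (.and (.atom b) B) V))

/-- The user-defined part is curried to the right, leaving the built-in store alone on the left,
where the theory applies. The strictly local variables occur neither in it nor free in the resulting
state, so their quantifier can be eliminated. -/
theorem State.ofStores_toL_le (hΘ : IsTheory Θ) (hCT : theoryL K CT ⊆ Θ) {U : User L K}
    {B B' : BuiltIn L} {V : Finset ℕ}
    (h : Models CT (.imp (BuiltIn.exFormula (strictlyLocal U B V) B)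
      (BuiltIn.exFormula (strictlyLocal U B' V) B'))) :
    LFormula.Entails Θ (State.ofStores U B V).toL (State.ofStores U B' V).toL := by
  have h := LFormula.Entails.of_formula hCT h
  simp only [BuiltIn.exFormula, Formula.star_exVars, BuiltIn.star_toFormula] at h
  refine State.toL_le_toL hΘ (Finset.Subset.refl _) (.trans .tensor_comm (.tensor_le ?_))
  refine .trans (.le_exVars_self hΘ _ _) (h.trans (.exVars_le hΘ (fun x hx hx' => ?_)
    (.le_lolli (.trans .tensor_comm (State.le_toL hΘ (State.ofStores U B' V))))))
  obtain ⟨h1, h2⟩ := mem_strictlyLocal hx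
  rcases Finset.mem_union.1 hx' with hx' | hx'
  · rw [Goal.fv_toL, User.vars_toGoal] at hx'
    exact h2 hx'
  · exact h1 (State.mem_fv_toL hx')

theorem StateEquiv.toL (hEq : HasEquality CT) (hΘ : IsTheory Θ) (hCT : theoryL K CT ⊆ Θ)
    {S T : State L K} (h : StateEquiv CT S T) :
    LFormula.Entails Θ S.toL T.toL ∧ LFormula.Entails Θ T.toL S.toL := by
  induction h with
  | refl => exact ⟨.refl _, .refl _⟩
  | symm _ h => exact h.symm
  | trans _ _ h h' => exact ⟨h.1.trans h'.1, h'.2.trans h.2⟩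
  | goal V h =>
    exact ⟨State.toL_le_toL hΘ (Finset.Subset.refl _) ((h.toL hΘ).1.trans (State.le_toL hΘ ⟨_, V⟩)),
      State.toL_le_toL hΘ (Finset.Subset.refl _) ((h.toL hΘ).2.trans (State.le_toL hΘ ⟨_, V⟩))⟩
  | subst U x t B V =>
    have h1 := LFormula.Entails.userConj_congr hΘ hCT (σ := .var) (τ := single x t)
      (fun s => by
        rw [Term.subst_var]
        exact LFormula.Entails.of_formula hCT (hEq.eq_subst_single x s t).1) U
    have h2 := LFormula.Entails.userConj_congr hΘ hCT (σ := single x t) (τ := .var)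
      (fun s => by
        rw [Term.subst_var]
        exact LFormula.Entails.of_formula hCT (hEq.eq_subst_single x s t).2) U
    rw [User.subst_var] at h1 h2
    exact ⟨State.ofStores_toL_le_of_subst hΘ h1, State.ofStores_toL_le_of_subst hΘ h2⟩
  | theory U B B' V h h' =>
    exact ⟨State.ofStores_toL_le hΘ hCT h, State.ofStores_toL_le hΘ hCT h'⟩
  | redundantGlobal G x V hx =>
    have : G.vars \ insert x V = G.vars \ V := by
      ext y
      have : y ∈ G.vars → y ≠ x := fun hy e => hx (e ▸ hy)
      simp only [Finset.mem_sdiff, Finset.mem_insert]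
      tauto
    simp only [State.toL, this]
    exact ⟨.refl _, .refl _⟩
  | failed G G' V V' =>
    have h (G : Goal L K) (V) (β : LFormula L K) :
        LFormula.Entails Θ (State.mk (.and G (.builtIn .bot)) V).toL β :=
      -- The detour through $\mathbf 0$ is needed because `β` may contain the quantified variables
      -- free.
      .trans (State.toL_le hΘ (fun _ _ _ => Finset.notMem_empty _) .tensor_zero_le)
        (LFormula.Entails.zero_le (α := β))
    exact ⟨h _ _ _, h _ _ _⟩

/-- Entailment relates classes, so the claim is made for all representatives; transitivity chooses
one in the middle. The same device serves for transitions and configurations. -/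
theorem StateEntails.toL (hEq : HasEquality CT) (hΘ : IsTheory Θ) (hCT : theoryL K CT ⊆ Θ)
    {s t : StateClass K CT} (h : StateEntails CT s t) {S T : State L K} (hS : S.cls CT = s)
    (hT : T.cls CT = t) : LFormula.Entails Θ S.toL T.toL := by
  have h0 {S T : State L K} (h : S.cls CT = T.cls CT) : LFormula.Entails Θ S.toL T.toL :=
    (StateEquiv.toL hEq hΘ hCT (Quotient.exact h)).1
  induction h generalizing S T with
  | refl s => exact h0 (hS.trans hT.symm)
  | @trans s t r _ _ h h' =>
    obtain ⟨R, hR⟩ := Quotient.exists_rep t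
    exact (h hS hR).trans (h' hR hT)
  | weaken U B B' V h =>
    exact (h0 hS).trans ((State.ofStores_toL_le hΘ hCT h).trans (h0 hT.symm))
  | omitGlobal U B x V =>
    refine (h0 hS).trans (.trans ?_ (h0 hT.symm))
    exact State.toL_le_toL hΘ (Finset.subset_insert _ _) (State.le_toL hΘ (State.ofStores U B V))

theorem ConfigEquiv.toL (hEq : HasEquality CT) (hΘ : IsTheory Θ) (hCT : theoryL K CT ⊆ Θ)
    {C D : Config L K} (h : ConfigEquiv CT C D) :
    LFormula.Entails Θ C.toL D.toL ∧ LFormula.Entails Θ D.toL C.toL := by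
  have hf : LFormula.Entails Θ (State.failed : State L K).toL .zero :=
    State.toL_le hΘ (fun _ _ _ => Finset.notMem_empty _) (.refl _)
  have hle {α β γ : LFormula L K} : LFormula.Entails Θ (.plus (.plus α β) γ)
      (.plus α (.plus β γ)) :=
    .plus_le hΘ (.plus_mono hΘ (.refl _) .le_plus_left)
      (.trans .le_plus_right .le_plus_right)
  have hge {α β γ : LFormula L K} : LFormula.Entails Θ (.plus α (.plus β γ))
      (.plus (.plus α β) γ) :=
    .plus_le hΘ (.trans .le_plus_left .le_plus_left) (.plus_mono hΘ .le_plus_right (.refl _))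
  induction h with
  | refl => exact ⟨.refl _, .refl _⟩
  | symm _ h => exact h.symm
  | trans _ _ h h' => exact ⟨h.1.trans h'.1, h'.2.trans h.2⟩
  | orCongr D _ h => exact ⟨.plus_mono hΘ h.1 (.refl _), .plus_mono hΘ h.2 (.refl _)⟩
  | orComm =>
    exact ⟨.plus_le hΘ .le_plus_right .le_plus_left, .plus_le hΘ .le_plus_right .le_plus_left⟩
  | orAssoc => exact ⟨hle, hge⟩
  | stateEquiv C h =>
    have h := h.toL hEq hΘ hCT
    exact ⟨.plus_mono hΘ h.1 (.refl _), .plus_mono hΘ h.2 (.refl _)⟩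
  | failedOr C => exact ⟨.plus_le hΘ (hf.trans .zero_le) (.refl _), .le_plus_right⟩
  | empty => exact ⟨.zero_le, hf⟩
  | split G H V C =>
    refine ⟨.trans (.plus_mono hΘ ?_ (.refl _)) hle, hge.trans (.plus_mono hΘ ?_ (.refl _))⟩
    · refine State.toL_le hΘ (fun x _ hx hx' => hx ?_)
        (.plus_mono hΘ (State.le_toL hΘ ⟨G, V⟩) (State.le_toL hΘ ⟨H, V⟩))
      exact (Finset.mem_union.1 hx').elim (State.mem_fv_toL (S := ⟨G, V⟩)) (State.mem_fv_toL (S := ⟨H, V⟩))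
    · exact .plus_le hΘ
        (State.toL_le_toL hΘ (Finset.Subset.refl _) (.trans .le_plus_left (State.le_toL hΘ ⟨.or G H, V⟩)))
        (State.toL_le_toL hΘ (Finset.Subset.refl _) (.trans .le_plus_right (State.le_toL hΘ ⟨.or G H, V⟩)))

theorem Config.toL_le_of_cls_eq (hEq : HasEquality CT) (hΘ : IsTheory Θ)
    (hCT : theoryL K CT ⊆ Θ) {C D : Config L K} (h : C.cls CT = D.cls CT) :
    LFormula.Entails Θ C.toL D.toL :=
  (ConfigEquiv.toL hEq hΘ hCT (Quotient.exact h)).1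

theorem User.toGoal_subst (σ : ℕ → L.Term ℕ) (U : User L K) :
    User.toGoal (User.subst σ U) = (User.toGoal U).subst σ := by
  induction U with
  | top | atom a => rfl
  | and U U' h1 h2 => exact congrArg₂ _ h1 h2

theorem BuiltIn.toGoal_subst (σ : ℕ → L.Term ℕ) (B : BuiltIn L) :
    BuiltIn.toGoal K (BuiltIn.subst σ B) = (BuiltIn.toGoal K B).subst σ := by
  induction B with
  | top | atom a => rfl
  | and U U' h1 h2 => exact congrArg₂ _ h1 h2

theorem Goal.mem_vars_subst_rename {ρ : ℕ → ℕ} {G : Goal L K} {y : ℕ} :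
    y ∈ (G.subst (renameSubst ρ)).vars ↔ ∃ x ∈ G.vars, ρ x = y := by
  simp only [Goal.mem_vars_subst, renameSubst, Term.mem_varFinset_var, eq_comm]

/-- Injectivity prevents a local variable from being identified with a head variable. -/
theorem Rule.mem_localVars_rename {r : Rule L K} {ρ : ℕ → ℕ}
    (hρ : Set.InjOn ρ (r.vars : Set ℕ)) {x : ℕ} (hx : x ∈ r.localVars) :
    ρ x ∈ (r.rename ρ).localVars := by
  simp only [Rule.localVars, Finset.mem_sdiff, Finset.mem_union] at hx ⊢
  have hxr : x ∈ r.vars := by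
    simp only [Rule.vars, Finset.mem_union]; tauto
  simp only [Rule.rename, ← BuiltIn.vars_toGoal (K := K), ← User.vars_toGoal,
    BuiltIn.toGoal_subst, User.toGoal_subst, Goal.mem_vars_subst_rename]
  refine ⟨hx.1.imp (fun h => ⟨x, h, rfl⟩)
    fun h => ⟨x, by rwa [BuiltIn.vars_toGoal], rfl⟩, ?_⟩
  simp only [User.vars_toGoal]
  rintro (⟨y, hy, e⟩ | ⟨y, hy, e⟩)
  all_goals
    have hyr : y ∈ r.vars := by simp only [Rule.vars, Finset.mem_union]; tauto
    obtain rfl := hρ hyr hxr e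
    tauto

/-- The rule formula is instantiated by the renaming and consumes heads and guard. The context `G`
and the kept heads are then moved to the right of $\multimap$, so that the freshness of the local
variables allows their quantifier to be eliminated. -/
theorem Rule.toL_apply (hΘ : IsTheory Θ) {r : Rule L K} (hr : r.toL ∈ Θ) {ρ : ℕ → ℕ}
    (hρ : Set.InjOn ρ (r.vars : Set ℕ)) {G : Goal L K} {V : Finset ℕ}
    (hd : Disjoint (r.rename ρ).localVars (User.vars (r.rename ρ).kept ∪
      User.vars (r.rename ρ).removed ∪ G.vars ∪ V)) :
    LFormula.Entails Θ
      (State.mk (.and (User.toGoal (r.rename ρ).kept) (.and (User.toGoal (r.rename ρ).removed)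
        (.and (BuiltIn.toGoal K (r.rename ρ).guard) G))) V).toL
      (State.mk (.and (User.toGoal (r.rename ρ).kept) (.and (BuiltIn.toGoal K (r.rename ρ).guard)
        (.and (r.rename ρ).body G))) V).toL := by
  have hlocal {x : ℕ} (hx : x ∈ r.localVars) : x ∈ r.vars := by
    simp only [Rule.localVars, Rule.vars, Finset.mem_sdiff, Finset.mem_union] at hx ⊢
    tauto
  refine State.toL_le_toL hΘ (Finset.Subset.refl _) ?_
  have hrule := LFormula.Entails.subst_of_mem_theory hΘ hr (renameSubst ρ)
  simp only [LFormula.subst, ← Goal.toL_subst, ← User.toGoal_subst,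
    ← BuiltIn.toGoal_subst] at hrule
  have hle := State.le_toL hΘ (State.mk (.and (User.toGoal (r.rename ρ).kept)
    (.and (BuiltIn.toGoal K (r.rename ρ).guard) (.and (r.rename ρ).body G))) V)
  set R := (State.mk (.and (User.toGoal (r.rename ρ).kept)
    (.and (BuiltIn.toGoal K (r.rename ρ).guard) (.and (r.rename ρ).body G))) V).toL with hR
  have hex : LFormula.Entails Θ ((LFormula.exVars r.localVars
      (.tensor r.body.toL (BuiltIn.toGoal K r.guard).toL)).subst (renameSubst ρ))
      (.lolli (.tensor (User.toGoal (r.rename ρ).kept).toL G.toL) R) := by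
    refine .exVars_subst_le hΘ (τ := renameSubst ρ) (ρ := ρ)
      (fun x hx y hy e => hρ (hlocal hx) (hlocal hy) e) (fun _ _ => rfl) (fun _ _ _ => rfl)
      (fun x hx hx' => ?_) (fun x hx y hy hyl hxy => ?_) (.le_lolli ?_)
    · have h := Finset.disjoint_left.1 hd (Rule.mem_localVars_rename hρ hx)
      simp only [Finset.mem_union, not_or] at h
      simp only [LFormula.fv, Finset.mem_union, Goal.fv_toL, User.vars_toGoal] at hx'
      rcases hx' with (hx' | hx') | hx'
      exacts [h.1.1.1 hx', h.1.2 hx', h.2 (State.mem_fv_toL hx')]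
    · rw [renameSubst, Term.mem_varFinset_var] at hxy
      have hyr : y ∈ r.vars := by
        simp only [LFormula.fv, Finset.mem_union, Goal.fv_toL, BuiltIn.vars_toGoal] at hy
        simp only [Rule.vars, Finset.mem_union]
        tauto
      exact hyl (hρ (hlocal hx) hyr hxy ▸ hx)
    · simp only [LFormula.subst, ← Goal.toL_subst, ← BuiltIn.toGoal_subst]
      refine .trans (.of_cls_eq ?_) hle
      simp only [Goal.toL, LFormula.cls_tensor, Rule.rename]
      abel
  refine .trans (.of_cls_eq ?_) (.trans (.tensor_mono hrule (.refl G.toL))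
    (.trans (.of_cls_eq ?_) (.tensor_le hex)))
  · simp only [Goal.toL, LFormula.cls_tensor, Rule.rename]
    abel
  · simp only [LFormula.cls_tensor, Rule.rename]
    abel

theorem Step.toL (hEq : HasEquality CT) (hΘ : IsTheory Θ) (hCT : theoryL K CT ⊆ Θ)
    (hP : programL P ⊆ Θ) {c d : ConfigClass K CT} (h : Step CT P c d) {C D : Config L K}
    (hC : C.cls CT = c) (hD : D.cls CT = d) : LFormula.Entails Θ C.toL D.toL := by
  cases h with
  | apply r r' G V T hr hv hd _ =>
    obtain ⟨ρ, hρ, rfl⟩ := hv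
    refine (Config.toL_le_of_cls_eq hEq hΘ hCT hC).trans (.trans ?_
      (Config.toL_le_of_cls_eq hEq hΘ hCT hD.symm))
    exact .plus_mono hΘ (Rule.toL_apply hΘ (hP ⟨r, hr, rfl⟩) hρ hd) (.refl _)

theorem Steps.toL (hEq : HasEquality CT) (hΘ : IsTheory Θ) (hCT : theoryL K CT ⊆ Θ)
    (hP : programL P ⊆ Θ) {c d : ConfigClass K CT} (h : Steps CT P c d) {C D : Config L K}
    (hC : C.cls CT = c) (hD : D.cls CT = d) : LFormula.Entails Θ C.toL D.toL := by
  induction h generalizing D with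
  | refl => exact Config.toL_le_of_cls_eq hEq hΘ hCT (hC.trans hD.symm)
  | @tail d e _ h ih =>
    obtain ⟨E, hE⟩ := Quotient.exists_rep d
    exact (ih hE).trans (h.toL hEq hΘ hCT hP hE hD)

theorem ConfigEntails.toL (hEq : HasEquality CT) (hΘ : IsTheory Θ) (hCT : theoryL K CT ⊆ Θ)
    {c d : ConfigClass K CT} (h : ConfigEntails CT c d) {C D : Config L K}
    (hC : C.cls CT = c) (hD : D.cls CT = d) : LFormula.Entails Θ C.toL D.toL := by
  have h0 {C D : Config L K} (h : C.cls CT = D.cls CT) : LFormula.Entails Θ C.toL D.toL :=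
    Config.toL_le_of_cls_eq hEq hΘ hCT h
  induction h generalizing C D with
  | refl => exact h0 (hC.trans hD.symm)
  | @trans c d e _ _ h h' =>
    obtain ⟨E, hE⟩ := Quotient.exists_rep d
    exact (h hC hE).trans (h' hE hD)
  | weaken S T => exact (h0 hC).trans (.trans .le_plus_right (h0 hD.symm))
  | redundant S₁ S₂ T h =>
    exact (h0 hC).trans (.trans (.plus_le hΘ (.trans (h.toL hEq hΘ hCT rfl rfl) .le_plus_left)
      (.refl _)) (h0 hD.symm))

/-- Soundness of the operational semantics. -/
theorem provableFrom_of_reach (hEq : HasEquality CT) {S T : Config L K} (h : Reach CT P S T) :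
    LFormula.ProvableFrom (programL P ∪ theoryL K CT)
      (LFormula.univClosure (.lolli S.toL T.toL)) := by
  obtain ⟨U, hU, hT⟩ := h
  have hΘ := isTheory_program_union_theory P CT
  have h := (hU.toL hEq hΘ Set.subset_union_right Set.subset_union_left rfl rfl).trans
    (hT.toL hEq hΘ Set.subset_union_right rfl rfl)
  -- `Entails` has a formula on the left; $\mathbf 1$ takes this place and is cut away at the end.
  obtain ⟨Γ, hΓ, h⟩ := LFormula.Entails.le_univClosure hΘ rfl
    (.le_lolli (.trans .one_tensor h))
  exact ⟨Γ, hΓ, by simpa using LFormula.Provable.cut .oneR h⟩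

end Soundness

end CHR

theorem mainTheorem8 {L : FirstOrder.Language.{u, v}} {K : ℕ → Type w}
    (CT : Set (CHR.CTAxiom L)) (hEq : CHR.HasEquality CT) (hComplete : CHR.IsComplete CT)
    (P : Set (CHR.Rule L K)) (S T : CHR.Config L K) :
    (∃ U : CHR.Config L K,
        CHR.Steps CT P (S.cls CT) (U.cls CT) ∧ CHR.ConfigEntails CT (U.cls CT) (T.cls CT)) ↔
      CHR.LFormula.ProvableFrom (CHR.programL P ∪ CHR.theoryL K CT)
        (CHR.LFormula.univClosure (.lolli S.toL T.toL)) :=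
  ⟨CHR.provableFrom_of_reach hEq, CHR.reach_of_provableFrom hEq hComplete⟩
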